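/- **Theorem.** The realization problem for ConGolog programs over clocked basic action theories is decidable: there is an algorithm that, given (a code of) any program $\Delta=(\mathcal D,\delta)$ over a clocked basic action theory $\mathcal D$, always halts and decides whether $\delta$ has a realization with respect to $\mathcal D$. **Clocked basic action theories.** The vocabulary consists of finitely many object constants $\mathcal O$, action types $A$, relational fluents $R$, functional fluents $f$ (*clocks*, with values of sort time, i.e. real numbers), and rigid relation and (object-valued) function symbols. All arguments are objects, except that relational fluents and clocks also have a situation argument and that there is a distinguished action $\mathrm{wait}(t)$ with a duration $t\in\mathbb R_{\ge 0}$. A formula is *clocked* if its only atoms mentioning terms of sort time are comparisons $f(\vec x,s)\bowtie v$ and $v\bowtie v'$ with $v,v'\in\mathbb N$ and ${\bowtie}\in\{<,\le,=,\ge,>\}$; it is *time-independent* if it mentions no term of sort time; it is *uniform in $s$* if $s$ is the only situation term in it and $\mathrm{Poss}$ does not occur. A clocked basic action theory $\mathcal D$ consists of 1. finitely many clocked sentences uniform in the initial situation $S_0$, together with $f(\vec o,S_0)=0$ for every clock $f$, such that the information is complete: for every atomic sentence $\phi$ uniform in $S_0$, $\mathcal D\models\phi$ or $\mathcal D\models\neg\phi$;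 2. for every action type $A\neq\mathrm{wait}$ an axiom $\mathrm{Poss}(A(\vec x),s)\equiv\phi_A(\vec x,s)$ with $\phi_A$ clocked and uniform in $s$, and $\mathrm{Poss}(\mathrm{wait}(t),s)\equiv\top$; 3. for every relational fluent an axiom $R(\vec o,\mathrm{do}(a,s))\equiv\phi_R(\vec o,a,s)$ with $\phi_R$ clocked and uniform in $s$; 4. for every clock an axiom $$f(\vec o,\mathrm{do}(a,s))=y\;\equiv\;\exists t\,\bigl(a=\mathrm{wait}(t)\wedge y=f(\vec o,s)+t\bigr)\;\vee\;\neg\exists t\,\bigl(a=\mathrm{wait}(t)\bigr)\wedge\bigl(\phi_f(\vec o,a,s)\wedge y=0\;\vee\;\neg\phi_f(\vec o,a,s)\wedge y=f(\vec o,s)\bigr)$$ with $\phi_f$ time-independent and uniform in $s$; 5. domain closure and unique names axioms for actions and for the object constants, and the foundational axioms of the situation calculus (unique names for situations, second-order induction on situations, ordering of situations). Entailment $\models$ is truth in all models in which the sort time is standard. **Programs.** Program expressions are given by $$\delta ::= \alpha \mid \phi? \mid \delta;\delta \mid \delta\,|\,\delta \mid \pi x.\,\delta \mid \delta^* \mid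 \delta\,\|\,\delta,$$ where $\alpha$ is $A(\vec\rho)$ with object terms $\vec\rho$ or the time-suppressed action $\mathrm{wait}()$, where $\phi$ is a situation-suppressed clocked formula, and where $x$ ranges over objects; $\delta$ is closed, and $\mathrm{nil}:=\mathrm{True}?$. The relations $\mathrm{Trans}(\delta,s,a,\delta',s')$ (one step) and $\mathrm{Final}(\delta,s)$ are the least relations with - $\mathrm{Trans}(A(\vec\rho),s,a,\delta',s')$ iff $a=A(\vec\rho)$, $\mathrm{Poss}(a,s)$, $\delta'=\mathrm{nil}$ and $s'=\mathrm{do}(a,s)$; $\mathrm{Trans}(\mathrm{wait}(),s,a,\delta',s')$ iff $a=\mathrm{wait}(t)$ for some $t\ge 0$, $\delta'=\mathrm{nil}$ and $s'=\mathrm{do}(a,s)$; $\mathrm{Trans}(\phi?,s,a,\delta',s')$ is false; - $\mathrm{Trans}(\delta_1;\delta_2,s,a,\delta',s')$ iff $\delta'=(\gamma;\delta_2)$ and $\mathrm{Trans}(\delta_1,s,a,\gamma,s')$ for some $\gamma$, or $\mathrm{Final}(\delta_1,s)$ and $\mathrm{Trans}(\delta_2,s,a,\delta',s')$; - $\mathrm{Trans}(\delta_1|\delta_2,s,a,\delta',s')$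 iff $\mathrm{Trans}(\delta_i,s,a,\delta',s')$ for $i=1$ or $i=2$; $\mathrm{Trans}(\pi x.\delta,s,a,\delta',s')$ iff $\mathrm{Trans}(\delta^x_c,s,a,\delta',s')$ for some object $c$; $\mathrm{Trans}(\delta^*,s,a,\delta',s')$ iff $\delta'=(\gamma;\delta^*)$ and $\mathrm{Trans}(\delta,s,a,\gamma,s')$ for some $\gamma$; - $\mathrm{Trans}(\delta_1\|\delta_2,s,a,\delta',s')$ iff $\delta'=(\gamma\|\delta_2)$ and $\mathrm{Trans}(\delta_1,s,a,\gamma,s')$, or $\delta'=(\delta_1\|\gamma)$ and $\mathrm{Trans}(\delta_2,s,a,\gamma,s')$, for some $\gamma$; - $\mathrm{Final}(\alpha,s)$ is false; $\mathrm{Final}(\phi?,s)$ iff $\phi[s]$; $\mathrm{Final}(\delta_1;\delta_2,s)$ and $\mathrm{Final}(\delta_1\|\delta_2,s)$ iff $\mathrm{Final}(\delta_1,s)$ and $\mathrm{Final}(\delta_2,s)$; $\mathrm{Final}(\delta_1|\delta_2,s)$ iff $\mathrm{Final}(\delta_1,s)$ or $\mathrm{Final}(\delta_2,s)$; $\mathrm{Final}(\pi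 x.\delta,s)$ iff $\mathrm{Final}(\delta^x_c,s)$ for some object $c$; $\mathrm{Final}(\delta^*,s)$ is true. $\mathrm{Trans}^*(\delta,s,\vec a,\delta',s')$ is the reflexive transitive closure of $\mathrm{Trans}$, where $\vec a$ is the sequence of the performed actions. **Realizations.** A finite (possibly empty) sequence $\vec\alpha$ of ground actions, i.e. actions $A(\vec\rho)$ with $\vec\rho$ in $\mathcal O$ and $\mathrm{wait}(\tau)$ with $\tau\in\mathbb R_{\ge0}$, is a *realization* of $\delta$ with respect to $\mathcal D$ if $\mathcal D\models\mathrm{Trans}^*(\delta,S_0,\vec\alpha,\delta',\sigma')\wedge\mathrm{Final}(\delta',\sigma')$ for some program $\delta'$ and some ground situation term $\sigma'$. The realization problem asks whether some realization exists. -/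

import Mathlib

open scoped NNReal

namespace ClockedGolog

/-- A finite vocabulary: the number of object constants, and one arity per symbol for the action
types other than `wait`, the relational fluents, the functional fluents (clocks), the rigid
relation symbols and the rigid (object-valued) function symbols. All arguments are objects.
The action type `wait`, with one argument of sort time, is always present. -/
structure Signature where
  numObj : ℕ
  acts : List ℕ
  fluents : List ℕ
  clocks : List ℕ
  rigidRels : List ℕ
  rigidFuns : List ℕ

namespace Signature

abbrev ObjName (S : Signature) : Type := Fin S.numObj
abbrev ActType (S : Signature) : Type := Fin S.acts.length
abbrev Fluent (S : Signature) : Type := Fin S.fluents.length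
abbrev Clock (S : Signature) : Type := Fin S.clocks.length
abbrev RigidRel (S : Signature) : Type := Fin S.rigidRels.length
abbrev RigidFun (S : Signature) : Type := Fin S.rigidFuns.length

/-- The code of a vocabulary. -/
def code (S : Signature) : ℕ :=
  Encodable.encode [S.numObj, Encodable.encode S.acts, Encodable.encode S.fluents,
    Encodable.encode S.clocks, Encodable.encode S.rigidRels, Encodable.encode S.rigidFuns]

end Signature

/-! ### Terms and formulas -/

/-- Terms of sort object with free object variables among `0, …, n - 1`. -/
inductive Term (S : Signature) (n : ℕ) : Type
  | var (i : Fin n) : Term S n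
  | const (c : S.ObjName) : Term S n
  | app (f : S.RigidFun) (ts : Fin (S.rigidFuns.get f) → Term S n) : Term S n

/-- Terms of sort action that do not mention terms of sort time, with free action variables
among `0, …, k - 1` and free object variables among `0, …, n - 1`. -/
inductive ActTerm (S : Signature) (k n : ℕ) : Type
  | var (i : Fin k) : ActTerm S k n
  | app (A : S.ActType) (ts : Fin (S.acts.get A) → Term S n) : ActTerm S k n

/-- The comparison operators `<, ≤, =, ≥, >`. -/
inductive Cmp : Type
  | lt | le | eq | ge | gt

/-- The meaning of the comparison operators on the reals. -/
def Cmp.Holds : Cmp → ℝ → ℝ → Prop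
  | .lt, x, y => x < y
  | .le, x, y => x ≤ y
  | .eq, x, y => x = y
  | .ge, x, y => x ≥ y
  | .gt, x, y => x > y

/-- Situation-suppressed clocked formulas (equivalently, clocked formulas uniform in a situation
variable `s`), with `k` free action variables and `n` free object variables. Variables are
de Bruijn indices: a quantifier binds the variable `0` of its body. The only atoms that mention
terms of sort time are the comparisons `f(ts, s) ⋈ v` and `v ⋈ w` with natural numbers `v`, `w`.
The other connectives and the existential quantifiers are the usual abbreviations. -/
inductive Formula (S : Signature) : ℕ → ℕ → Type
  | verum {k n : ℕ} : Formula S k n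
  | fluent {k n : ℕ} (R : S.Fluent) (ts : Fin (S.fluents.get R) → Term S n) : Formula S k n
  | rigid {k n : ℕ} (P : S.RigidRel) (ts : Fin (S.rigidRels.get P) → Term S n) : Formula S k n
  | objEq {k n : ℕ} (t u : Term S n) : Formula S k n
  | actEq {k n : ℕ} (a b : ActTerm S k n) : Formula S k n
  | clockCmp {k n : ℕ} (f : S.Clock) (ts : Fin (S.clocks.get f) → Term S n) (r : Cmp) (v : ℕ) :
      Formula S k n
  | natCmp {k n : ℕ} (v : ℕ) (r : Cmp) (w : ℕ) : Formula S k n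
  | neg {k n : ℕ} (φ : Formula S k n) : Formula S k n
  | and {k n : ℕ} (φ ψ : Formula S k n) : Formula S k n
  | allObj {k n : ℕ} (φ : Formula S k (n + 1)) : Formula S k n
  | allAct {k n : ℕ} (φ : Formula S (k + 1) n) : Formula S k n

/-- The formula does not mention any term of sort time. -/
def Formula.TimeIndependent {S : Signature} : {k n : ℕ} → Formula S k n → Prop
  | _, _, .verum => True
  | _, _, .fluent _ _ => True
  | _, _, .rigid _ _ => True
  | _, _, .objEq _ _ => True
  | _, _, .actEq _ _ => True
  | _, _, .clockCmp _ _ _ _ => False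
  | _, _, .natCmp _ _ _ => False
  | _, _, .neg φ => φ.TimeIndependent
  | _, _, .and φ ψ => φ.TimeIndependent ∧ ψ.TimeIndependent
  | _, _, .allObj φ => φ.TimeIndependent
  | _, _, .allAct φ => φ.TimeIndependent

/-- The formula is an atom. -/
def Formula.IsAtomic {S : Signature} {k n : ℕ} : Formula S k n → Prop
  | .verum => True
  | .fluent _ _ => True
  | .rigid _ _ => True
  | .objEq _ _ => True
  | .actEq _ _ => True
  | .clockCmp _ _ _ _ => True
  | .natCmp _ _ _ => True
  | .neg _ => False
  | .and _ _ => False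
  | .allObj _ => False
  | .allAct _ => False

/-- Simultaneous substitution of object terms for object variables. -/
def Term.subst {S : Signature} {n m : ℕ} (σ : Fin n → Term S m) : Term S n → Term S m
  | .var i => σ i
  | .const c => .const c
  | .app f ts => .app f (fun i => (ts i).subst σ)

/-- The substitution `σ` under a binder for an object variable. -/
def liftSubst {S : Signature} {n m : ℕ} (σ : Fin n → Term S m) :
    Fin (n + 1) → Term S (m + 1) :=
  Fin.cons (.var 0) (fun i => (σ i).subst (fun j => .var j.succ))

def ActTerm.subst {S : Signature} {k n m : ℕ} (σ : Fin n → Term S m) :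
    ActTerm S k n → ActTerm S k m
  | .var i => .var i
  | .app A ts => .app A (fun i => (ts i).subst σ)

def Formula.subst {S : Signature} :
    {k n m : ℕ} → (Fin n → Term S m) → Formula S k n → Formula S k m
  | _, _, _, _, .verum => .verum
  | _, _, _, σ, .fluent R ts => .fluent R (fun i => (ts i).subst σ)
  | _, _, _, σ, .rigid P ts => .rigid P (fun i => (ts i).subst σ)
  | _, _, _, σ, .objEq t u => .objEq (t.subst σ) (u.subst σ)
  | _, _, _, σ, .actEq a b => .actEq (a.subst σ) (b.subst σ)
  | _, _, _, σ, .clockCmp f ts r v => .clockCmp f (fun i => (ts i).subst σ) r v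
  | _, _, _, _, .natCmp v r w => .natCmp v r w
  | _, _, _, σ, .neg φ => .neg (φ.subst σ)
  | _, _, _, σ, .and φ ψ => .and (φ.subst σ) (ψ.subst σ)
  | _, _, _, σ, .allObj φ => .allObj (φ.subst (liftSubst σ))
  | _, _, _, σ, .allAct φ => .allAct (φ.subst σ)

/-! ### Clocked basic action theories and their models -/

/-- The domain-specific axioms of a clocked basic action theory:
* `init`: the sentences about the initial situation (next to the axioms `f(o, S₀) = 0`);
* `pre A`: the right-hand side `φ_A(x, s)` of the precondition axiom of `A`;
* `ssa R`: the right-hand side `φ_R(o, a, s)` of the successor state axiom of `R`;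
* `reset f`: the condition `φ_f(o, a, s)` under which the action `a` resets the clock `f(o)`. -/
structure ClockedBAT (S : Signature) where
  init : List (Formula S 0 0)
  pre : (A : S.ActType) → Formula S 0 (S.acts.get A)
  ssa : (R : S.Fluent) → Formula S 1 (S.fluents.get R)
  reset : (f : S.Clock) → Formula S 1 (S.clocks.get f)
  reset_timeIndependent : ∀ f, (reset f).TimeIndependent

/-- Many-sorted interpretations. The sort time has its standard interpretation by the reals;
durations of `wait` are nonnegative. `before` interprets the ordering `⊏` of situations. -/
structure Interp (S : Signature) where
  Obj : Type
  Act : Type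
  Sit : Type
  const : S.ObjName → Obj
  rigidFun : (f : S.RigidFun) → (Fin (S.rigidFuns.get f) → Obj) → Obj
  rigidRel : (P : S.RigidRel) → (Fin (S.rigidRels.get P) → Obj) → Prop
  act : (A : S.ActType) → (Fin (S.acts.get A) → Obj) → Act
  wait : ℝ≥0 → Act
  S₀ : Sit
  doAct : Act → Sit → Sit
  before : Sit → Sit → Prop
  poss : Act → Sit → Prop
  fluent : (R : S.Fluent) → (Fin (S.fluents.get R) → Obj) → Sit → Prop
  clock : (f : S.Clock) → (Fin (S.clocks.get f) → Obj) → Sit → ℝ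

namespace Interp

variable {S : Signature} (M : Interp S)

/-- The value of an object term. -/
def term {n : ℕ} (e : Fin n → M.Obj) : Term S n → M.Obj
  | .var i => e i
  | .const c => M.const c
  | .app f ts => M.rigidFun f (fun i => term e (ts i))

/-- The value of an action term. -/
def actTerm {k n : ℕ} (ea : Fin k → M.Act) (e : Fin n → M.Obj) : ActTerm S k n → M.Act
  | .var i => ea i
  | .app A ts => M.act A (fun i => M.term e (ts i))

/-- Truth of a formula in the situation `s`. -/
def Sat : {k n : ℕ} → Formula S k n → (Fin k → M.Act) → (Fin n → M.Obj) → M.Sit → Prop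
  | _, _, .verum, _, _, _ => True
  | _, _, .fluent R ts, _, e, s => M.fluent R (fun i => M.term e (ts i)) s
  | _, _, .rigid P ts, _, e, _ => M.rigidRel P (fun i => M.term e (ts i))
  | _, _, .objEq t u, _, e, _ => M.term e t = M.term e u
  | _, _, .actEq a b, ea, e, _ => M.actTerm ea e a = M.actTerm ea e b
  | _, _, .clockCmp f ts r v, _, e, s => r.Holds (M.clock f (fun i => M.term e (ts i)) s) v
  | _, _, .natCmp v r w, _, _, _ => r.Holds v w
  | _, _, .neg φ, ea, e, s => ¬ Sat φ ea e s
  | _, _, .and φ ψ, ea, e, s => Sat φ ea e s ∧ Sat ψ ea e s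
  | _, _, .allObj φ, ea, e, s => ∀ o : M.Obj, Sat φ ea (Fin.cons o e) s
  | _, _, .allAct φ, ea, e, s => ∀ a : M.Act, Sat φ (Fin.cons a ea) e s

/-- Truth of a sentence in the situation `s`. -/
def SatClosed (φ : Formula S 0 0) (s : M.Sit) : Prop := M.Sat φ Fin.elim0 Fin.elim0 s

/-- The foundational axioms of the situation calculus (including second-order induction). -/
structure Foundational : Prop where
  doAct_inj : ∀ a b s t, M.doAct a s = M.doAct b t → a = b ∧ s = t
  induction : ∀ P : M.Sit → Prop, P M.S₀ → (∀ a s, P s → P (M.doAct a s)) → ∀ s, P s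
  not_before_init : ∀ s, ¬ M.before s M.S₀
  before_doAct : ∀ s a t, M.before s (M.doAct a t) ↔ M.before s t ∨ s = t

/-- Domain closure and unique names for actions. -/
structure ActionAxioms : Prop where
  closure : ∀ a, (∃ A o, a = M.act A o) ∨ ∃ t, a = M.wait t
  act_ne : ∀ A B o o', A ≠ B → M.act A o ≠ M.act B o'
  act_ne_wait : ∀ A o t, M.act A o ≠ M.wait t
  act_inj : ∀ A o o', M.act A o = M.act A o' → o = o'
  wait_inj : ∀ t t', M.wait t = M.wait t' → t = t'

/-- Domain closure and unique names for objects. -/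
structure ObjectAxioms : Prop where
  closure : ∀ o, ∃ c, o = M.const c
  const_ne : ∀ c d, c ≠ d → M.const c ≠ M.const d

/-- `M` is a model of the clocked basic action theory `D`. -/
structure Models (D : ClockedBAT S) : Prop where
  foundational : M.Foundational
  actions : M.ActionAxioms
  objects : M.ObjectAxioms
  init : ∀ φ ∈ D.init, M.SatClosed φ M.S₀
  clock_init : ∀ f o, M.clock f o M.S₀ = 0
  poss_act : ∀ A o s, M.poss (M.act A o) s ↔ M.Sat (D.pre A) Fin.elim0 o s
  poss_wait : ∀ t s, M.poss (M.wait t) s ↔ True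
  fluent_ssa : ∀ R o a s, M.fluent R o (M.doAct a s) ↔ M.Sat (D.ssa R) (fun _ => a) o s
  clock_ssa : ∀ f o a s y, M.clock f o (M.doAct a s) = y ↔
    (∃ t, a = M.wait t ∧ y = M.clock f o s + (t : ℝ)) ∨
    ((¬ ∃ t, a = M.wait t) ∧
      ((M.Sat (D.reset f) (fun _ => a) o s ∧ y = 0) ∨
        (¬ M.Sat (D.reset f) (fun _ => a) o s ∧ y = M.clock f o s)))

end Interp

/-- Complete information about the initial situation: every atomic sentence uniform in `S₀` is
entailed by the theory, or its negation is. -/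
def ClockedBAT.CompleteInfo {S : Signature} (D : ClockedBAT S) : Prop :=
  ∀ φ : Formula S 0 0, φ.IsAtomic →
    (∀ M : Interp S, M.Models D → M.SatClosed φ M.S₀) ∨
    (∀ M : Interp S, M.Models D → M.SatClosed (.neg φ) M.S₀)

/-! ### ConGolog programs -/

/-- Program expressions with free object variables among `0, …, n - 1`: actions (with `wait`
time-suppressed), tests, sequence, nondeterministic branching, nondeterministic choice of an
argument `πx. δ` (binding the variable `0` of `δ`), iteration, concurrency. -/
inductive Prog (S : Signature) : ℕ → Type
  | act {n : ℕ} (A : S.ActType) (ts : Fin (S.acts.get A) → Term S n) : Prog S n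
  | wait {n : ℕ} : Prog S n
  | test {n : ℕ} (φ : Formula S 0 n) : Prog S n
  | seq {n : ℕ} (δ₁ δ₂ : Prog S n) : Prog S n
  | choice {n : ℕ} (δ₁ δ₂ : Prog S n) : Prog S n
  | pick {n : ℕ} (δ : Prog S (n + 1)) : Prog S n
  | star {n : ℕ} (δ : Prog S n) : Prog S n
  | conc {n : ℕ} (δ₁ δ₂ : Prog S n) : Prog S n

namespace Prog

variable {S : Signature}

/-- The empty program `True?`. -/
def nil {n : ℕ} : Prog S n := .test .verum

def subst : {n m : ℕ} → (Fin n → Term S m) → Prog S n → Prog S m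
  | _, _, σ, .act A ts => .act A (fun i => (ts i).subst σ)
  | _, _, _, .wait => .wait
  | _, _, σ, .test φ => .test (φ.subst σ)
  | _, _, σ, .seq δ₁ δ₂ => .seq (δ₁.subst σ) (δ₂.subst σ)
  | _, _, σ, .choice δ₁ δ₂ => .choice (δ₁.subst σ) (δ₂.subst σ)
  | _, _, σ, .pick δ => .pick (δ.subst (liftSubst σ))
  | _, _, σ, .star δ => .star (δ.subst σ)
  | _, _, σ, .conc δ₁ δ₂ => .conc (δ₁.subst σ) (δ₂.subst σ)

/-- `δ` with the object name `c` in place of its variable. -/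
def inst (δ : Prog S 1) (c : S.ObjName) : Prog S 0 := δ.subst (fun _ => .const c)

end Prog

/-- `Final M δ s`: the program `δ` may terminate in the situation `s`. -/
inductive Final {S : Signature} (M : Interp S) : Prog S 0 → M.Sit → Prop
  | test {φ s} : M.SatClosed φ s → Final M (.test φ) s
  | seq {δ₁ δ₂ s} : Final M δ₁ s → Final M δ₂ s → Final M (.seq δ₁ δ₂) s
  | choice_left {δ₁ δ₂ s} : Final M δ₁ s → Final M (.choice δ₁ δ₂) s
  | choice_right {δ₁ δ₂ s} : Final M δ₂ s → Final M (.choice δ₁ δ₂) s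
  | pick {δ s} (c : S.ObjName) : Final M (δ.inst c) s → Final M (.pick δ) s
  | star {δ s} : Final M (.star δ) s
  | conc {δ₁ δ₂ s} : Final M δ₁ s → Final M δ₂ s → Final M (.conc δ₁ δ₂) s

/-- `Trans M δ s a δ' s'`: a single step of `δ` in `s` performs the action `a` and leads to the
situation `s'` with remaining program `δ'`. -/
inductive Trans {S : Signature} (M : Interp S) :
    Prog S 0 → M.Sit → M.Act → Prog S 0 → M.Sit → Prop
  | act {A ts s} :
      M.poss (M.act A (fun i => M.term Fin.elim0 (ts i))) s →
      Trans M (.act A ts) s (M.act A (fun i => M.term Fin.elim0 (ts i))) .nil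
        (M.doAct (M.act A (fun i => M.term Fin.elim0 (ts i))) s)
  | wait {s} (t : ℝ≥0) : Trans M .wait s (M.wait t) .nil (M.doAct (M.wait t) s)
  | seq_left {δ₁ δ₂ s a γ s'} : Trans M δ₁ s a γ s' → Trans M (.seq δ₁ δ₂) s a (.seq γ δ₂) s'
  | seq_right {δ₁ δ₂ s a δ' s'} :
      Final M δ₁ s → Trans M δ₂ s a δ' s' → Trans M (.seq δ₁ δ₂) s a δ' s'
  | choice_left {δ₁ δ₂ s a δ' s'} : Trans M δ₁ s a δ' s' → Trans M (.choice δ₁ δ₂) s a δ' s'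
  | choice_right {δ₁ δ₂ s a δ' s'} : Trans M δ₂ s a δ' s' → Trans M (.choice δ₁ δ₂) s a δ' s'
  | pick {δ s a δ' s'} (c : S.ObjName) :
      Trans M (δ.inst c) s a δ' s' → Trans M (.pick δ) s a δ' s'
  | star {δ s a γ s'} : Trans M δ s a γ s' → Trans M (.star δ) s a (.seq γ (.star δ)) s'
  | conc_left {δ₁ δ₂ s a γ s'} :
      Trans M δ₁ s a γ s' → Trans M (.conc δ₁ δ₂) s a (.conc γ δ₂) s'
  | conc_right {δ₁ δ₂ s a γ s'} :
      Trans M δ₂ s a γ s' → Trans M (.conc δ₁ δ₂) s a (.conc δ₁ γ) s'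

/-- The reflexive transitive closure of `Trans`, with the sequence of performed actions. -/
inductive TransStar {S : Signature} (M : Interp S) :
    Prog S 0 → M.Sit → List M.Act → Prog S 0 → M.Sit → Prop
  | refl {δ s} : TransStar M δ s [] δ s
  | step {δ s a γ t l δ' s'} :
      Trans M δ s a γ t → TransStar M γ t l δ' s' → TransStar M δ s (a :: l) δ' s'

/-- Ground action terms: `A(ρ)` with object names `ρ`, and `wait(τ)` with `τ ≥ 0`. -/
inductive GroundAct (S : Signature) : Type
  | act (A : S.ActType) (ρ : Fin (S.acts.get A) → S.ObjName) : GroundAct S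
  | wait (τ : ℝ≥0) : GroundAct S

/-- The value of a ground action term. -/
def Interp.groundAct {S : Signature} (M : Interp S) : GroundAct S → M.Act
  | .act A ρ => M.act A (fun i => M.const (ρ i))
  | .wait τ => M.wait τ

/-- The value of the ground situation term `do([α₁; …; α_k], S₀)`. -/
def Interp.groundSit {S : Signature} (M : Interp S) (σ : List (GroundAct S)) : M.Sit :=
  σ.foldl (fun s α => M.doAct (M.groundAct α) s) M.S₀

/-- `α` is a realization of `δ` with respect to `D`: the theory entails
`Trans*(δ, S₀, α, δ', σ') ∧ Final(δ', σ')` for a program `δ'` and a ground situation term `σ'`. -/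
def ClockedBAT.IsRealization {S : Signature} (D : ClockedBAT S) (δ : Prog S 0)
    (α : List (GroundAct S)) : Prop :=
  ∃ (δ' : Prog S 0) (σ' : List (GroundAct S)), ∀ M : Interp S, M.Models D →
    TransStar M δ M.S₀ (α.map M.groundAct) δ' (M.groundSit σ') ∧ Final M δ' (M.groundSit σ')

/-- A program over a clocked basic action theory (with complete information). -/
structure ClockedProgram where
  sig : Signature
  bat : ClockedBAT sig
  completeInfo : bat.CompleteInfo
  prog : Prog sig 0

/-- Some sequence of ground actions is a realization of the program. -/
def ClockedProgram.HasRealization (Δ : ClockedProgram) : Prop :=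
  ∃ α : List (GroundAct Δ.sig), Δ.bat.IsRealization Δ.prog α

/-! ### Codes: clocked programs as inputs of algorithms -/

/-- A natural number as code of a finite sequence of natural numbers. -/
def codeSeq {m : ℕ} (g : Fin m → ℕ) : ℕ := Encodable.encode (List.ofFn g)

def Term.code {S : Signature} {n : ℕ} : Term S n → ℕ
  | .var i => Nat.pair 0 i
  | .const c => Nat.pair 1 c
  | .app f ts => Nat.pair 2 (Nat.pair f (codeSeq fun i => (ts i).code))

def ActTerm.code {S : Signature} {k n : ℕ} : ActTerm S k n → ℕ
  | .var i => Nat.pair 0 i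
  | .app A ts => Nat.pair 1 (Nat.pair A (codeSeq fun i => (ts i).code))

def Cmp.code : Cmp → ℕ
  | .lt => 0
  | .le => 1
  | .eq => 2
  | .ge => 3
  | .gt => 4

def Formula.code {S : Signature} : {k n : ℕ} → Formula S k n → ℕ
  | _, _, .verum => Nat.pair 0 0
  | _, _, .fluent R ts => Nat.pair 1 (Nat.pair R (codeSeq fun i => (ts i).code))
  | _, _, .rigid P ts => Nat.pair 2 (Nat.pair P (codeSeq fun i => (ts i).code))
  | _, _, .objEq t u => Nat.pair 3 (Nat.pair t.code u.code)
  | _, _, .actEq a b => Nat.pair 4 (Nat.pair a.code b.code)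
  | _, _, .clockCmp f ts r v =>
      Nat.pair 5 (Nat.pair f (Nat.pair (codeSeq fun i => (ts i).code) (Nat.pair r.code v)))
  | _, _, .natCmp v r w => Nat.pair 6 (Nat.pair v (Nat.pair r.code w))
  | _, _, .neg φ => Nat.pair 7 φ.code
  | _, _, .and φ ψ => Nat.pair 8 (Nat.pair φ.code ψ.code)
  | _, _, .allObj φ => Nat.pair 9 φ.code
  | _, _, .allAct φ => Nat.pair 10 φ.code

def Prog.code {S : Signature} : {n : ℕ} → Prog S n → ℕ
  | _, .act A ts => Nat.pair 0 (Nat.pair A (codeSeq fun i => (ts i).code))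
  | _, .wait => Nat.pair 1 0
  | _, .test φ => Nat.pair 2 φ.code
  | _, .seq δ₁ δ₂ => Nat.pair 3 (Nat.pair δ₁.code δ₂.code)
  | _, .choice δ₁ δ₂ => Nat.pair 4 (Nat.pair δ₁.code δ₂.code)
  | _, .pick δ => Nat.pair 5 δ.code
  | _, .star δ => Nat.pair 6 δ.code
  | _, .conc δ₁ δ₂ => Nat.pair 7 (Nat.pair δ₁.code δ₂.code)

def ClockedBAT.code {S : Signature} (D : ClockedBAT S) : ℕ :=
  Encodable.encode [Encodable.encode (D.init.map Formula.code),
    codeSeq fun A => (D.pre A).code, codeSeq fun R => (D.ssa R).code,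
    codeSeq fun f => (D.reset f).code]

/-- The code of a clocked program: its vocabulary, its axioms and its program expression. -/
def ClockedProgram.code (Δ : ClockedProgram) : ℕ :=
  Encodable.encode [Δ.sig.code, Δ.bat.code, Δ.prog.code]

end ClockedGolog

namespace ClockedGolog

theorem codeSeq_injective {m : ℕ} : Function.Injective (codeSeq (m := m)) := by
  intro g h e
  exact List.ofFn_injective (Encodable.encode_injective e)

theorem Signature.code_injective : Function.Injective Signature.code := by
  rintro ⟨⟩ ⟨⟩ h
  simpa [Signature.code, Encodable.encode_inj] using h

theorem Term.code_injective {S : Signature} {n : ℕ} :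
    Function.Injective (Term.code (S := S) (n := n)) := by
  intro t
  induction t with
  | var i => intro u h; cases u <;> simp_all [Term.code, Fin.ext_iff]
  | const i => intro u h; cases u <;> simp_all [Term.code, Fin.ext_iff]
  | app f ts ih =>
    intro u h
    cases u with
    | app g us =>
      simp only [Term.code, Nat.pair_eq_pair, true_and] at h
      obtain ⟨h1, h2⟩ := h
      obtain rfl := Fin.ext h1
      congr 1
      funext i
      exact ih i (congrFun (codeSeq_injective h2) i)
    | _ => simp [Term.code] at h

theorem Term.codeSeq_inj {S : Signature} {n m : ℕ} {ts us : Fin m → Term S n} :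
    codeSeq (fun i => (ts i).code) = codeSeq (fun i => (us i).code) ↔ ts = us := by
  refine ⟨fun h => funext fun i => Term.code_injective (congrFun (codeSeq_injective h) i), ?_⟩
  rintro rfl; rfl

theorem ActTerm.code_injective {S : Signature} {k n : ℕ} :
    Function.Injective (ActTerm.code (S := S) (k := k) (n := n)) := by
  rintro (i | ⟨A, ts⟩) (j | ⟨B, us⟩) h <;> simp only [ActTerm.code, Nat.pair_eq_pair] at h
  · simp [Fin.ext h.2]
  · simp at h
  · simp at h
  · obtain ⟨-, h1, h2⟩ := h
    obtain rfl := Fin.ext h1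
    rw [Term.codeSeq_inj.1 h2]

theorem Cmp.code_injective : Function.Injective Cmp.code := by
  intro a b h
  cases a <;> cases b <;> simp_all [Cmp.code]

theorem Formula.code_injective {S : Signature} {k n : ℕ} :
    Function.Injective (Formula.code (S := S) (k := k) (n := n)) := by
  intro φ
  induction φ with
  | verum => intro ψ h; cases ψ <;> simp_all [Formula.code]
  | fluent R ts | rigid R ts =>
    intro ψ h
    cases ψ <;> simp only [Formula.code, Nat.pair_eq_pair] at h <;> try (simp at h; done)
    obtain ⟨-, h1, h2⟩ := h
    obtain rfl := Fin.ext h1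
    rw [Term.codeSeq_inj.1 h2]
  | objEq t u =>
    intro ψ h
    cases ψ <;> simp_all [Formula.code, Term.code_injective.eq_iff]
  | actEq t u =>
    intro ψ h
    cases ψ <;> simp_all [Formula.code, ActTerm.code_injective.eq_iff]
  | clockCmp f ts r v =>
    intro ψ h
    cases ψ <;> simp only [Formula.code, Nat.pair_eq_pair] at h <;> try (simp at h; done)
    obtain ⟨-, h1, h2, h3, h4⟩ := h
    obtain rfl := Fin.ext h1
    rw [Term.codeSeq_inj.1 h2, Cmp.code_injective h3, h4]
  | natCmp v r w =>
    intro ψ h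
    cases ψ <;> simp_all [Formula.code, Cmp.code_injective.eq_iff]
  | neg φ ih | allObj φ ih | allAct φ ih =>
    intro ψ h
    cases ψ <;> simp only [Formula.code, Nat.pair_eq_pair] at h <;> try (simp at h; done)
    rw [ih h.2]
  | and φ φ' ih ih' =>
    intro ψ h
    cases ψ <;> simp only [Formula.code, Nat.pair_eq_pair] at h <;> try (simp at h; done)
    rw [ih h.2.1, ih' h.2.2]

theorem Prog.code_injective {S : Signature} {n : ℕ} :
    Function.Injective (Prog.code (S := S) (n := n)) := by
  intro δ
  induction δ with
  | act A ts =>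
    intro ψ h
    cases ψ <;> simp only [Prog.code, Nat.pair_eq_pair] at h <;> try (simp at h; done)
    obtain ⟨-, h1, h2⟩ := h
    obtain rfl := Fin.ext h1
    rw [Term.codeSeq_inj.1 h2]
  | wait => intro ψ h; cases ψ <;> simp_all [Prog.code]
  | test φ =>
    intro ψ h
    cases ψ <;> simp only [Prog.code, Nat.pair_eq_pair] at h <;> try (simp at h; done)
    rw [Formula.code_injective h.2]
  | pick δ ih | star δ ih =>
    intro ψ h
    cases ψ <;> simp only [Prog.code, Nat.pair_eq_pair] at h <;> try (simp at h; done)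
    rw [ih h.2]
  | seq δ₁ δ₂ ih ih' | choice δ₁ δ₂ ih ih' | conc δ₁ δ₂ ih ih' =>
    intro ψ h
    cases ψ <;> simp only [Prog.code, Nat.pair_eq_pair] at h <;> try (simp at h; done)
    rw [ih h.2.1, ih' h.2.2]

theorem ClockedBAT.code_injective {S : Signature} :
    Function.Injective (ClockedBAT.code (S := S)) := by
  rintro ⟨i, p, s, r, _⟩ ⟨i', p', s', r', _⟩ h
  simp only [ClockedBAT.code, Encodable.encode_inj, List.cons.injEq, and_true] at h
  obtain ⟨h1, h2, h3, h4⟩ := h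
  obtain rfl := List.map_injective_iff.2 Formula.code_injective h1
  obtain rfl : p = p' :=
    funext fun A => Formula.code_injective (congrFun (codeSeq_injective h2) A)
  obtain rfl : s = s' :=
    funext fun A => Formula.code_injective (congrFun (codeSeq_injective h3) A)
  obtain rfl : r = r' :=
    funext fun A => Formula.code_injective (congrFun (codeSeq_injective h4) A)
  rfl

/-- Different clocked programs have different codes. -/
theorem ClockedProgram.code_injective : Function.Injective ClockedProgram.code := by
  rintro ⟨S, D, _, δ⟩ ⟨S', D', _, δ'⟩ h
  simp only [ClockedProgram.code, Encodable.encode_inj, List.cons.injEq, and_true] at h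
  obtain ⟨h1, h2, h3⟩ := h
  obtain rfl := Signature.code_injective h1
  obtain rfl := ClockedBAT.code_injective h2
  obtain rfl := Prog.code_injective h3
  rfl

end ClockedGolog

/-!
A model of a clocked basic action theory is determined by its rigid symbols and the initial values
of its fluents: by domain closure, unique names and induction it is the *canonical model* whose
objects are the object names, whose actions are the ground actions, and whose situations are the
lists of ground actions (`Frame.canon`, `HasFrame.agreeAt`). Under complete information all models
share these data (`ClockedBAT.CompleteInfo.hasFrame`), so a realization is a successful run of the
program in the canonical model, unless there is no model at all, in which case every sequence of
actions is a realization for trivial reasons (`ClockedProgram.hasRealization_iff`).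

The runs in the canonical model are abstracted to paths in a finite transition system, in three
respects.

* *Clocks.* A vector of clock values is replaced by a region equivalent one on a finite grid of
  mesh `1 / D`, where `D` exceeds the number of clocks and values above a bound `K` of all constants
  are identified (`ClockRel`). Equivalent values satisfy the same comparisons
  (`ClockRel.holds_iff`), and the equivalence is preserved by resets (`ClockRel.reset`). It is a
  bisimulation for delays: a position added on one side has a counterpart on the other
  (`SameOrder.extend`). On the grid, a delay is a multiple of `1 / (2 * D)`; the result is rounded
  to the grid by replacing the fractional parts by their ranks (`HalfRel.normalize`).
* *Actions in formulas.* A clocked formula only tests actions for equality, so under `k` quantifiers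
  over actions, `k + 1` waiting actions represent all of them (`ActEnv`). Hence the truth of
  formulas is computed from the finite abstract state (`Describes.evalF_iff`).
* *Programs.* Substitution is replaced by environments. A residual program is then built from
  pairs of a subexpression and an environment, and only finitely many can be reached
  (`finReach_cloR`). The computed steps are those of the program (`Describes.stepsMatch`).

The abstract system is computed from the code `n` of the program, and `n` itself serves as the bound
`K` on the constants. Everything is primitive recursive by recursion along subexpressions, whose
codes decrease (`primrec_treeRec`). Reachability in a finite system is decided by iterating until no
new states appear (`exists_computable_reach`).
-/


/-! ### Primitive recursion by subqueries -/

-- The closure properties of primitive recursive functions become rules of `fun_prop`.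
attribute [fun_prop] Primrec
attribute [fun_prop] Primrec.id Primrec.const Primrec.comp Primrec.fst Primrec.snd

namespace Primrec

variable {α β γ : Type*} [Primcodable α] [Primcodable β] [Primcodable γ]

@[fun_prop] theorem prodMk' {f : α → β} {g : α → γ} (hf : Primrec f) (hg : Primrec g) :
    Primrec fun a => (f a, g a) := Primrec.pair hf hg

@[fun_prop] theorem fst' {f : α → β × γ} (hf : Primrec f) : Primrec fun a => (f a).1 :=
  Primrec.fst.comp hf

@[fun_prop] theorem snd' {f : α → β × γ} (hf : Primrec f) : Primrec fun a => (f a).2 :=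
  Primrec.snd.comp hf

@[fun_prop] theorem natPair' {f g : α → ℕ} (hf : Primrec f) (hg : Primrec g) :
    Primrec fun a => Nat.pair (f a) (g a) := Primrec₂.natPair.comp hf hg

@[fun_prop] theorem unpair' {f : α → ℕ} (hf : Primrec f) : Primrec fun a => Nat.unpair (f a) :=
  Primrec.unpair.comp hf

@[fun_prop] theorem add' {f g : α → ℕ} (hf : Primrec f) (hg : Primrec g) :
    Primrec fun a => f a + g a := Primrec.nat_add.comp hf hg

@[fun_prop] theorem mul' {f g : α → ℕ} (hf : Primrec f) (hg : Primrec g) :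
    Primrec fun a => f a * g a := Primrec.nat_mul.comp hf hg

@[fun_prop] theorem div' {f g : α → ℕ} (hf : Primrec f) (hg : Primrec g) :
    Primrec fun a => f a / g a := Primrec.nat_div.comp hf hg

@[fun_prop] theorem mod' {f g : α → ℕ} (hf : Primrec f) (hg : Primrec g) :
    Primrec fun a => f a % g a := Primrec.nat_mod.comp hf hg

@[fun_prop] theorem min' {f g : α → ℕ} (hf : Primrec f) (hg : Primrec g) :
    Primrec fun a => min (f a) (g a) := Primrec.nat_min.comp hf hg

@[fun_prop] theorem ble' {f g : α → ℕ} (hf : Primrec f) (hg : Primrec g) :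
    Primrec fun a => Nat.ble (f a) (g a) :=
  (Primrec.nat_le.decide.comp hf hg).of_eq fun a => by
    rw [Bool.eq_iff_iff, decide_eq_true_iff, Nat.ble_eq]

@[fun_prop] theorem encode' {f : α → β} (hf : Primrec f) :
    Primrec fun a => Encodable.encode (f a) := Primrec.encode.comp hf

@[fun_prop] theorem cons' {f : α → β} {g : α → List β} (hf : Primrec f) (hg : Primrec g) :
    Primrec fun a => f a :: g a := Primrec.list_cons.comp hf hg

@[fun_prop] theorem append' {f g : α → List β} (hf : Primrec f) (hg : Primrec g) :
    Primrec fun a => f a ++ g a := Primrec.list_append.comp hf hg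

@[fun_prop] theorem length' {f : α → List β} (hf : Primrec f) :
    Primrec fun a => (f a).length := Primrec.list_length.comp hf

@[fun_prop] theorem flatten' {f : α → List (List β)} (hf : Primrec f) :
    Primrec fun a => (f a).flatten := Primrec.list_flatten.comp hf

@[fun_prop] theorem getI' [Inhabited β] {f : α → List β} {g : α → ℕ} (hf : Primrec f)
    (hg : Primrec g) : Primrec fun a => (f a).getI (g a) := Primrec.list_getI.comp hf hg

@[fun_prop] theorem lookup' [BEq β] [LawfulBEq β] {f : α → β} {g : α → List (β × γ)}
    (hf : Primrec f) (hg : Primrec g) : Primrec fun a => (g a).lookup (f a) := by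
  classical
  have h := Primrec.listLookup.comp hf hg
  rwa [lawful_beq_subsingleton instBEqOfDecidableEq ‹BEq β›] at h

@[fun_prop] theorem optionGetD' {f : α → Option β} {g : α → β} (hf : Primrec f)
    (hg : Primrec g) : Primrec fun a => (f a).getD (g a) := Primrec.option_getD.comp hf hg

@[fun_prop] theorem range' {f : α → ℕ} (hf : Primrec f) : Primrec fun a => List.range (f a) :=
  Primrec.list_range.comp hf

@[fun_prop] theorem map' {f : α → List β} {g : α → β → γ} (hf : Primrec f)
    (hg : Primrec fun p : α × β => g p.1 p.2) : Primrec fun a => (f a).map (g a) :=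
  Primrec.list_map hf hg

@[fun_prop] theorem flatMap' {f : α → List β} {g : α → β → List γ} (hf : Primrec f)
    (hg : Primrec fun p : α × β => g p.1 p.2) : Primrec fun a => (f a).flatMap (g a) :=
  Primrec.list_flatMap hf hg

@[fun_prop] theorem cond' {c : α → Bool} {f g : α → β} (hc : Primrec c) (hf : Primrec f)
    (hg : Primrec g) : Primrec fun a => bif c a then f a else g a := Primrec.cond hc hf hg

@[fun_prop] theorem beq' [BEq β] [LawfulBEq β] {f g : α → β} (hf : Primrec f)
    (hg : Primrec g) : Primrec fun a => f a == g a := by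
  classical
  have h := Primrec.beq.comp hf hg
  rwa [lawful_beq_subsingleton instBEqOfDecidableEq ‹BEq β›] at h

@[fun_prop] theorem not' {f : α → Bool} (hf : Primrec f) : Primrec fun a => !f a :=
  Primrec.not.comp hf

@[fun_prop] theorem and' {f g : α → Bool} (hf : Primrec f) (hg : Primrec g) :
    Primrec fun a => f a && g a := Primrec.and.comp hf hg

@[fun_prop] theorem or' {f g : α → Bool} (hf : Primrec f) (hg : Primrec g) :
    Primrec fun a => f a || g a := Primrec.or.comp hf hg

@[fun_prop] theorem toNat' {f : α → Bool} (hf : Primrec f) : Primrec fun a => (f a).toNat :=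
  (Primrec.dom_bool Bool.toNat).comp hf

@[fun_prop] theorem all' {f : α → List β} {g : α → β → Bool} (hf : Primrec f)
    (hg : Primrec fun p : α × β => g p.1 p.2) : Primrec fun a => (f a).all (g a) := by
  have h : Primrec fun a => (f a).foldr (fun b s => g a b && s) true :=
    Primrec.list_foldr (h := fun a p => g a p.1 && p.2) hf (.const true)
      (Primrec.and.comp (hg.comp (Primrec.fst.pair (Primrec.fst.comp .snd)))
        (Primrec.snd.comp .snd))
  exact h.of_eq fun a => by induction f a <;> simp_all

@[fun_prop] theorem any' {f : α → List β} {g : α → β → Bool} (hf : Primrec f)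
    (hg : Primrec fun p : α × β => g p.1 p.2) : Primrec fun a => (f a).any (g a) := by
  have h : Primrec fun a => !(f a).all (fun b => !g a b) := by fun_prop
  exact h.of_eq fun a => by simp [List.any_eq_not_all_not]

@[fun_prop] theorem filter' {f : α → List β} {g : α → β → Bool} (hf : Primrec f)
    (hg : Primrec fun p : α × β => g p.1 p.2) : Primrec fun a => (f a).filter (g a) := by
  have h : Primrec fun a => (f a).flatMap (fun b => bif g a b then [b] else []) := by fun_prop
  exact h.of_eq fun a => by
    induction f a with
    | nil => rfl
    | cons b l ih => cases hb : g a b <;> simp_all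

end Primrec

namespace ClockedGolog

section TreeRec

variable {α β : Type*}

/-- Recursion on a call tree of bounded height: `sub a` lists the recursive calls made by `a`. -/
def fuelRec (sub : α → List α) (comb : α → List β → β) : ℕ → α → β
  | 0, a => comb a []
  | k + 1, a => comb a ((sub a).map (fuelRec sub comb k))

/-- The function that answers `a` by combining its own answers to the subqueries `sub a`;
`m` is a measure which decreases along subqueries. -/
def treeRec (sub : α → List α) (comb : α → List β → β) (m : α → ℕ) (a : α) : β :=
  fuelRec sub comb (m a) a

variable {sub : α → List α} {comb : α → List β → β} {m : α → ℕ}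

theorem fuelRec_eq_treeRec (h : ∀ a, ∀ b ∈ sub a, m b < m a) (k : ℕ) :
    ∀ a, m a ≤ k → fuelRec sub comb k a = treeRec sub comb m a := by
  induction k using Nat.strong_induction_on with
  | _ k ih =>
    intro a ha
    rcases ha.eq_or_lt with rfl | hlt
    · rfl
    obtain ⟨k, rfl⟩ : ∃ j, k = j + 1 := ⟨k - 1, by omega⟩
    unfold treeRec
    cases hm : m a with
    | zero =>
      have : sub a = [] := List.eq_nil_iff_forall_not_mem.2 fun b hb => by
        have := h a b hb; omega
      simp [fuelRec, this]
    | succ j =>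
      simp only [fuelRec]
      congr 1
      refine List.map_congr_left fun b hb => ?_
      have := h a b hb
      rw [ih k (by omega) b (by omega), ih j (by omega) b (by omega)]

theorem treeRec_eq (h : ∀ a, ∀ b ∈ sub a, m b < m a) (a : α) :
    treeRec sub comb m a = comb a ((sub a).map (treeRec sub comb m)) := by
  rw [← fuelRec_eq_treeRec h (m a + 1) a (by omega)]
  simp only [fuelRec]
  congr 1
  refine List.map_congr_left fun b hb => ?_
  exact fuelRec_eq_treeRec h _ b (h a b hb).le

theorem primrec_treeRec [Primcodable α] [Primcodable β] (h : ∀ a, ∀ b ∈ sub a, m b < m a)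
    (hsub : Primrec sub) (hcomb : Primrec fun p : α × List β => comb p.1 p.2)
    (hm : Primrec m) : Primrec (treeRec sub comb m) :=
  Primrec.nat_omega_rec' _ (g := fun a l => some (comb a l)) hm hsub
    (Primrec.option_some.comp hcomb) h fun a => congrArg some (treeRec_eq h a).symm

end TreeRec

/-! ### Deciding reachability in finite transition systems -/

section Reach

variable {X : Type*} (next : ℕ → X → List X)

/-- The states reachable in at most `i` steps from the list `l`. -/
def layer (n : ℕ) (l : List X) : ℕ → List X
  | 0 => l
  | i + 1 => layer n l i ++ (layer n l i).flatMap (next n)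

/-- `Reach next n x y`: in the `n`-th transition system, `y` is reachable from `x`. -/
def Reach (n : ℕ) : X → X → Prop := Relation.ReflTransGen fun x y => y ∈ next n x

variable {next}

theorem layer_mono {n : ℕ} {l : List X} {i j : ℕ} (h : i ≤ j) :
    layer next n l i ⊆ layer next n l j := by
  induction h with
  | refl => exact List.Subset.refl _
  | step _ ih => exact fun x hx => List.mem_append_left _ (ih hx)

theorem exists_mem_layer_iff {n : ℕ} {l : List X} {y : X} :
    (∃ i, y ∈ layer next n l i) ↔ ∃ x ∈ l, Reach next n x y := by
  constructor
  · rintro ⟨i, hi⟩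
    induction i generalizing y with
    | zero => exact ⟨y, hi, .refl⟩
    | succ i ih =>
      rcases List.mem_append.1 hi with h | h
      · exact ih h
      · obtain ⟨z, hz, hy⟩ := List.mem_flatMap.1 h
        obtain ⟨x, hx, hr⟩ := ih hz
        exact ⟨x, hx, hr.tail hy⟩
  · rintro ⟨x, hx, hr⟩
    induction hr with
    | refl => exact ⟨0, hx⟩
    | tail _ hyz ih =>
      obtain ⟨i, hi⟩ := ih
      exact ⟨i + 1, List.mem_append_right _ (List.mem_flatMap.2 ⟨_, hi, hyz⟩)⟩

theorem mem_layer_of_stable {n : ℕ} {l : List X} {i : ℕ}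
    (h : layer next n l (i + 1) ⊆ layer next n l i) (j : ℕ) :
    layer next n l j ⊆ layer next n l i := by
  induction j with
  | zero => exact layer_mono (Nat.zero_le i)
  | succ j ih =>
    intro x hx
    rcases List.mem_append.1 hx with h' | h'
    · exact ih h'
    · obtain ⟨z, hz, hy⟩ := List.mem_flatMap.1 h'
      exact h (List.mem_append_right _ (List.mem_flatMap.2 ⟨z, ih hz, hy⟩))

theorem exists_stable {n : ℕ} {l : List X} {F : Set X} (hF : F.Finite) (hl : ∀ x ∈ l, x ∈ F)
    (hn : ∀ x ∈ F, ∀ y ∈ next n x, y ∈ F) :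
    ∃ i, layer next n l (i + 1) ⊆ layer next n l i := by
  have hsub : ∀ i, {x | x ∈ layer next n l i} ⊆ F := by
    intro i
    induction i with
    | zero => exact hl
    | succ i ih =>
      intro x hx
      rcases List.mem_append.1 hx with h | h
      · exact ih h
      · obtain ⟨z, hz, hy⟩ := List.mem_flatMap.1 h
        exact hn z (ih hz) x hy
  by_contra hcon
  push Not at hcon
  -- otherwise the cardinalities of the layers are unbounded
  have hcard : ∀ i, i ≤ {x | x ∈ layer next n l i}.ncard := by
    intro i
    induction i with
    | zero => exact Nat.zero_le _
    | succ i ih =>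
      refine Nat.succ_le_of_lt (lt_of_le_of_lt ih ?_)
      refine Set.ncard_lt_ncard ?_ (hF.subset (hsub _))
      exact ⟨layer_mono (Nat.le_succ i), hcon i⟩
  have h1 := hcard (F.ncard + 1)
  have h2 := Set.ncard_le_ncard (hsub (F.ncard + 1)) hF
  omega

/-- Reachability is decidable, uniformly in `n`, for a primitive recursive family of transition
systems in each of which only finitely many states are reachable. -/
theorem exists_computable_reach [Primcodable X] [DecidableEq X] {init : ℕ → List X}
    {final : ℕ → X → Bool} (hnext : Primrec fun p : ℕ × X => next p.1 p.2)
    (hinit : Primrec init) (hfinal : Primrec fun p : ℕ × X => final p.1 p.2)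
    (hfin : ∀ n, ∃ F : Set X, F.Finite ∧ (∀ x ∈ init n, x ∈ F) ∧
      ∀ x ∈ F, ∀ y ∈ next n x, y ∈ F) :
    ∃ alg : ℕ → Bool, Computable alg ∧
      ∀ n, alg n = true ↔ ∃ x ∈ init n, ∃ y, Reach next n x y ∧ final n y = true := by
  have hlayer : Primrec fun p : ℕ × ℕ => layer next p.1 (init p.1) p.2 := by
    have h := Primrec.nat_rec (f := init)
      (g := fun n (p : ℕ × List X) => p.2 ++ p.2.flatMap (next n)) hinit ?_
    · have h' : Primrec₂ fun n i => layer next n (init n) i := by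
        refine h.of_eq fun n i => ?_
        induction i with
        | zero => rfl
        | succ i ih => simp only [layer] at ih ⊢; rw [← ih]
      exact h'
    · have h1 : Primrec fun q : (ℕ × ℕ × List X) × X => next q.1.1 q.2 :=
        hnext.comp (g := fun q : (ℕ × ℕ × List X) × X => (q.1.1, q.2)) (by fun_prop)
      change Primrec fun q : ℕ × ℕ × List X => q.2.2 ++ q.2.2.flatMap (next q.1)
      fun_prop
  let stable : ℕ → ℕ → Bool := fun n i =>
    (layer next n (init n) (i + 1)).all fun x => (layer next n (init n) i).any fun y => x == y
  have hst : Primrec fun p : ℕ × ℕ => stable p.1 p.2 := by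
    have h1 : Primrec fun p : ℕ × ℕ => layer next p.1 (init p.1) (p.2 + 1) :=
      hlayer.comp (g := fun p : ℕ × ℕ => (p.1, p.2 + 1)) (by fun_prop)
    have key : ∀ A B : ℕ × ℕ → List X, Primrec A → Primrec B →
        Primrec fun p => (A p).all fun x => (B p).any fun y => x == y := by
      intro A B hA hB
      fun_prop
    exact key _ _ h1 hlayer
  have stable_iff : ∀ n i, stable n i = true ↔
      layer next n (init n) (i + 1) ⊆ layer next n (init n) i := by
    intro n i
    simp [stable, List.subset_def]
  have hex : ∀ n, ∃ i, stable n i = true := fun n => by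
    obtain ⟨F, hF, h1, h2⟩ := hfin n
    obtain ⟨i, hi⟩ := exists_stable hF h1 h2
    exact ⟨i, (stable_iff n i).2 hi⟩
  have hfind : Computable fun n => Nat.find (hex n) := by
    have h : Partrec fun n => Nat.rfind fun i => (Part.some (stable n i) : Part Bool) :=
      Partrec.rfind (p := fun n i => Part.some (stable n i)) hst.to_comp.partrec
    refine h.of_eq fun n => Part.eq_some_iff.2 ?_
    refine Nat.mem_rfind.2 ⟨?_, fun {k} hk => ?_⟩
    · exact Part.mem_some_iff.2 (Nat.find_spec (hex n)).symm
    · exact Part.mem_some_iff.2 (by simpa using (Nat.find_min (hex n) hk))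
  refine ⟨fun n => (layer next n (init n) (Nat.find (hex n))).any (final n), ?_, fun n => ?_⟩
  · have h1 : Primrec fun p : ℕ × ℕ => (layer next p.1 (init p.1) p.2).any (final p.1) := by
      have h2 : Primrec fun q : (ℕ × ℕ) × X => final q.1.1 q.2 :=
        hfinal.comp (g := fun q : (ℕ × ℕ) × X => (q.1.1, q.2)) (by fun_prop)
      fun_prop
    exact h1.to_comp.comp (Computable.id.pair hfind)
  · have hs := (stable_iff n _).1 (Nat.find_spec (hex n))
    simp only [List.any_eq_true]
    constructor
    · rintro ⟨y, hy, hf⟩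
      obtain ⟨x, hx, hr⟩ := exists_mem_layer_iff.1 ⟨_, hy⟩
      exact ⟨x, hx, y, hr, hf⟩
    · rintro ⟨x, hx, y, hr, hf⟩
      obtain ⟨i, hi⟩ := exists_mem_layer_iff.2 ⟨x, hx, hr⟩
      exact ⟨y, mem_layer_of_stable hs i hi, hf⟩

end Reach

/-! ### Reading codes -/

/-- The finite sequence with code `c`. -/
def seqOf (c : ℕ) : List ℕ := Denumerable.ofNat (List ℕ) c

/-- Entry `i` of the sequence with code `c`. -/
def item (c i : ℕ) : ℕ := (seqOf c).getI i

/-- The first component of a pair; in the code of an expression, the constructor tag. -/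
def tag (c : ℕ) : ℕ := c.unpair.1

/-- The second component of a pair; in the code of an expression, what follows the tag. -/
def body (c : ℕ) : ℕ := c.unpair.2

/-- The first component of the body of a code. -/
def lft (c : ℕ) : ℕ := (body c).unpair.1

/-- The second component of the body of a code. -/
def rgt (c : ℕ) : ℕ := (body c).unpair.2

@[simp] theorem tag_pair (a b : ℕ) : tag (Nat.pair a b) = a := by simp [tag]
@[simp] theorem body_pair (a b : ℕ) : body (Nat.pair a b) = b := by simp [body]
@[simp] theorem lft_pair (a b c : ℕ) : lft (Nat.pair a (Nat.pair b c)) = b := by simp [lft]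
@[simp] theorem rgt_pair (a b c : ℕ) : rgt (Nat.pair a (Nat.pair b c)) = c := by simp [rgt]

theorem body_lt {c : ℕ} (h : tag c ≠ 0) : body c < c := by
  have h1 : Nat.pair (tag c) (body c) = c := Nat.pair_unpair c
  have h2 := Nat.add_le_pair (tag c) (body c)
  omega

theorem lft_lt {c : ℕ} (h : tag c ≠ 0) : lft c < c :=
  (Nat.unpair_left_le _).trans_lt (body_lt h)

theorem rgt_lt {c : ℕ} (h : tag c ≠ 0) : rgt c < c :=
  (Nat.unpair_right_le _).trans_lt (body_lt h)

theorem lt_encode_of_mem {x : ℕ} {l : List ℕ} (h : x ∈ l) : x < Encodable.encode l := by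
  induction l with
  | nil => simp at h
  | cons a l ih =>
    rw [Encodable.encode_list_cons, Nat.lt_succ_iff, Encodable.encode_nat]
    rcases List.mem_cons.1 h with rfl | h
    · exact Nat.left_le_pair _ _
    · exact (ih h).le.trans (Nat.right_le_pair _ _)

theorem encode_seqOf (c : ℕ) : Encodable.encode (seqOf c) = c := Denumerable.encode_ofNat c

theorem seqOf_encode (l : List ℕ) : seqOf (Encodable.encode l) = l := Denumerable.ofNat_encode l

theorem seqOf_codeSeq {m : ℕ} (g : Fin m → ℕ) : seqOf (codeSeq g) = List.ofFn g :=
  seqOf_encode _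

theorem lt_of_mem_seqOf {x c : ℕ} (h : x ∈ seqOf c) : x < c :=
  (lt_encode_of_mem h).trans_eq (encode_seqOf c)

section Primrec

variable {α : Type*} [Primcodable α] {f g : α → ℕ}

@[fun_prop] theorem primrec_seqOf (hf : Primrec f) : Primrec fun a => seqOf (f a) :=
  (Primrec.ofNat (List ℕ)).comp hf

@[fun_prop] theorem primrec_item (hf : Primrec f) (hg : Primrec g) :
    Primrec fun a => item (f a) (g a) := by unfold item; fun_prop

@[fun_prop] theorem primrec_tag (hf : Primrec f) : Primrec fun a => tag (f a) := by
  unfold tag; fun_prop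

@[fun_prop] theorem primrec_body (hf : Primrec f) : Primrec fun a => body (f a) := by
  unfold body; fun_prop

@[fun_prop] theorem primrec_lft (hf : Primrec f) : Primrec fun a => lft (f a) := by
  unfold lft; fun_prop

@[fun_prop] theorem primrec_rgt (hf : Primrec f) : Primrec fun a => rgt (f a) := by
  unfold rgt; fun_prop

end Primrec

/-- The arities of the symbols of one kind in the program with code `n`: `1` stands for action
types, `2` for relational fluents, `3` for clocks, `4` for rigid relation symbols and `5` for
rigid function symbols. -/
def arities (n kind : ℕ) : List ℕ := seqOf (item (item n 0) kind)

/-- The number of objects of the program with code `n`. -/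
def numObj (n : ℕ) : ℕ := item (item n 0) 0

/-- The axioms of one kind of the program with code `n`: `0` stands for the initial situation, `1`
for preconditions, `2` for successor state axioms and `3` for clock resets. -/
def axioms (n kind : ℕ) : List ℕ := seqOf (item (item n 1) kind)

/-- A symbol of some kind applied to a list of objects, `(kind, symbol, arguments)`. The same type
serves for codes of actions: `(1, A, arguments)` stands for a ground action, and `(0, j, [])` with
`j = 0, 1, …` for pairwise different `wait` actions. -/
abbrev Atom : Type := ℕ × ℕ × List ℕ

/-- An abstract state: the values of the fluents, the rigid symbols and the clocks. The truth
values are `1` and anything else; clock values are multiples of one over `gridSize`. -/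
abbrev Store : Type := List (Atom × ℕ)

/-- The value of `k` in a store, `0` if there is none. -/
def look (st : Store) (k : Atom) : ℕ := (st.lookup k).getD 0

/-- The lists of length `k` with entries below `N`. -/
def tuples (N k : ℕ) : List (List ℕ) :=
  Nat.rec [[]] (fun _ T => T.flatMap fun l => (List.range N).map fun x => x :: l) k

/-- The atoms of one kind. -/
def atoms (n kind : ℕ) : List Atom :=
  (List.range (arities n kind).length).flatMap fun s =>
    (tuples (numObj n) ((arities n kind).getI s)).map fun l => (kind, s, l)

/-- All atoms except for the actions. -/
def keys (n : ℕ) : List Atom := atoms n 2 ++ atoms n 3 ++ atoms n 4 ++ atoms n 5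

/-- The granularity of clock values. It exceeds the number of clocks, so that every ordering of
the fractional parts of the clocks occurs on the grid. -/
def gridSize (n : ℕ) : ℕ := (keys n).length + 1

/-- The code of the value of a clock that has exceeded all constants. All constants are bounded by
the code `n`. -/
def cap (n : ℕ) : ℕ := gridSize n * (n + 1)

/-- A bound for the values in a store. -/
def storeBound (n : ℕ) : ℕ := cap n + numObj n

/-- All stores with the given keys and with values up to `B`. -/
def stores (B : ℕ) (ks : List Atom) : List Store :=
  ks.foldr (fun k T => T.flatMap fun l => (List.range (B + 1)).map fun x => (k, x) :: l) [[]]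

section Primrec

variable {α : Type*} [Primcodable α] {f g : α → ℕ}

@[fun_prop] theorem primrec_arities (hf : Primrec f) (hg : Primrec g) :
    Primrec fun a => arities (f a) (g a) := by unfold arities; fun_prop

@[fun_prop] theorem primrec_axioms (hf : Primrec f) (hg : Primrec g) :
    Primrec fun a => axioms (f a) (g a) := by unfold axioms; fun_prop

@[fun_prop] theorem primrec_numObj (hf : Primrec f) :
    Primrec fun a => numObj (f a) := by unfold numObj; fun_prop

@[fun_prop] theorem primrec_look {st : α → Store} {k : α → Atom} (hf : Primrec st)
    (hg : Primrec k) : Primrec fun a => look (st a) (k a) := by unfold look; fun_prop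

@[fun_prop] theorem primrec_tuples (hf : Primrec f) (hg : Primrec g) :
    Primrec fun a => tuples (f a) (g a) := by
  have h : Primrec₂ fun N k => tuples N k :=
    Primrec.nat_rec (f := fun _ : ℕ => [([] : List ℕ)])
      (g := fun N p => p.2.flatMap fun l => (List.range N).map fun x => x :: l)
      (by fun_prop) (by unfold Primrec₂; fun_prop)
  exact h.comp hf hg

@[fun_prop] theorem primrec_atoms (hf : Primrec f) (hg : Primrec g) :
    Primrec fun a => atoms (f a) (g a) := by unfold atoms; fun_prop

@[fun_prop] theorem primrec_keys (hf : Primrec f) :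
    Primrec fun a => keys (f a) := by unfold keys; fun_prop

@[fun_prop] theorem primrec_gridSize (hf : Primrec f) :
    Primrec fun a => gridSize (f a) := by unfold gridSize; fun_prop

@[fun_prop] theorem primrec_cap (hf : Primrec f) :
    Primrec fun a => cap (f a) := by unfold cap; fun_prop

@[fun_prop] theorem primrec_storeBound (hf : Primrec f) :
    Primrec fun a => storeBound (f a) := by unfold storeBound; fun_prop

@[fun_prop] theorem primrec_stores {ks : α → List Atom} (hf : Primrec f) (hk : Primrec ks) :
    Primrec fun a => stores (f a) (ks a) :=
  Primrec.list_foldr (f := ks) (g := fun _ => [([] : Store)])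
    (h := fun a p => p.2.flatMap fun l => (List.range (f a + 1)).map fun x => (p.1, x) :: l)
    hk (by fun_prop) (by
      have h1 : Primrec fun q : (α × Atom × List Store) => f q.1 := hf.comp .fst
      have h2 : Primrec fun q : (α × Atom × List Store) × Store => f q.1.1 :=
        h1.comp .fst
      unfold Primrec₂
      fun_prop)

end Primrec

/-! ### Evaluation of terms and formulas -/

/-- The value of the object term with code `c` in the environment `e`. -/
def evalT (st : Store) (e : List ℕ) (c : ℕ) : ℕ :=
  treeRec (α := Store × List ℕ × ℕ)
    (fun q => bif tag q.2.2 == 2 then (seqOf (rgt q.2.2)).map fun d => (q.1, q.2.1, d) else [])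
    (fun q vals => bif tag q.2.2 == 0 then q.2.1.getI (body q.2.2) else
      bif tag q.2.2 == 1 then body q.2.2 else look q.1 (5, lft q.2.2, vals))
    (fun q => q.2.2) (st, e, c)

theorem evalT_sub_lt (q : Store × List ℕ × ℕ) : ∀ b ∈ (bif tag q.2.2 == 2 then
    (seqOf (rgt q.2.2)).map fun d => (q.1, q.2.1, d) else []), b.2.2 < q.2.2 := by
  intro b hb
  cases h : tag q.2.2 == 2 <;> rw [h] at hb
  · simp at hb
  · obtain ⟨d, hd, rfl⟩ := List.mem_map.1 hb
    exact (lt_of_mem_seqOf hd).trans (rgt_lt (by simp at h; omega))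

theorem evalT_eq (st : Store) (e : List ℕ) (c : ℕ) : evalT st e c =
    bif tag c == 0 then e.getI (body c) else bif tag c == 1 then body c else
      look st (5, lft c, bif tag c == 2 then (seqOf (rgt c)).map (evalT st e) else []) := by
  conv_lhs => rw [evalT, treeRec_eq evalT_sub_lt]
  cases tag c == 2
  · simp
  · simp only [cond_true, List.map_map]
    rfl

/-- The values of the object terms in the sequence with code `c`. -/
def evalTs (st : Store) (e : List ℕ) (c : ℕ) : List ℕ := (seqOf c).map (evalT st e)

/-- The value of the action term with code `c`; `ea` is the environment of action variables. -/
def evalA (st : Store) (ea : List Atom) (e : List ℕ) (c : ℕ) : Atom :=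
  bif tag c == 0 then ea.getI (body c) else (1, lft c, evalTs st e (rgt c))

/-- The comparison with code `r`. -/
def cmpB (r x y : ℕ) : Bool :=
  bif r == 0 then !Nat.ble y x else bif r == 1 then Nat.ble x y else
    bif r == 2 then x == y else bif r == 3 then Nat.ble y x else !Nat.ble x y

/-- The range of the quantifiers over actions inside `k` such quantifiers: all ground actions and
`k + 1` waiting actions, one of which is different from all actions chosen before. -/
def actDomain (n k : ℕ) : List Atom :=
  atoms n 1 ++ (List.range (k + 1)).map fun j => (0, j, [])

/-- The queries about the truth of a formula: the code of the program, the store, the environments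
of action and object variables, and the code of the formula. -/
abbrev FQuery : Type := ℕ × Store × List Atom × List ℕ × ℕ

/-- The subformulas, with environments, on which the truth of a formula depends. -/
def subF (n : ℕ) (st : Store) (ea : List Atom) (e : List ℕ) (c : ℕ) : List FQuery :=
  bif tag c == 7 then [(n, st, ea, e, body c)] else
  bif tag c == 8 then [(n, st, ea, e, lft c), (n, st, ea, e, rgt c)] else
  bif tag c == 9 then (List.range (numObj n)).map fun o => (n, st, ea, o :: e, body c) else
  bif tag c == 10 then (actDomain n ea.length).map fun a => (n, st, a :: ea, e, body c) else []

/-- The truth value of a formula, given those of its subformulas. -/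
def combF (n : ℕ) (st : Store) (ea : List Atom) (e : List ℕ) (c : ℕ) (vals : List Bool) : Bool :=
  bif tag c == 1 then look st (2, lft c, evalTs st e (rgt c)) == 1 else
  bif tag c == 2 then look st (4, lft c, evalTs st e (rgt c)) == 1 else
  bif tag c == 3 then evalT st e (lft c) == evalT st e (rgt c) else
  bif tag c == 4 then evalA st ea e (lft c) == evalA st ea e (rgt c) else
  bif tag c == 5 then cmpB (lft (rgt c)) (look st (3, lft c, evalTs st e (tag (rgt c))))
    (rgt (rgt c) * gridSize n) else
  bif tag c == 6 then cmpB (tag (rgt c)) (lft c) (body (rgt c)) else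
  bif tag c == 7 then !vals.all (fun b => b) else vals.all (fun b => b)

/-- The truth value of the formula with code `c` over the program with code `n`. -/
def evalF (n : ℕ) (st : Store) (ea : List Atom) (e : List ℕ) (c : ℕ) : Bool :=
  treeRec (fun q : FQuery => subF q.1 q.2.1 q.2.2.1 q.2.2.2.1 q.2.2.2.2)
    (fun q vals => combF q.1 q.2.1 q.2.2.1 q.2.2.2.1 q.2.2.2.2 vals)
    (fun q => q.2.2.2.2) (n, st, ea, e, c)

theorem subF_lt (q : FQuery) :
    ∀ b ∈ subF q.1 q.2.1 q.2.2.1 q.2.2.2.1 q.2.2.2.2, b.2.2.2.2 < q.2.2.2.2 := by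
  obtain ⟨n, st, ea, e, c⟩ := q
  intro b hb
  simp only [subF] at hb
  by_cases h7 : tag c = 7
  · simp [h7] at hb; subst hb; exact body_lt (by omega)
  by_cases h8 : tag c = 8
  · simp [h8] at hb
    rcases hb with rfl | rfl
    exacts [lft_lt (by omega), rgt_lt (by omega)]
  by_cases h9 : tag c = 9
  · simp [h9] at hb; obtain ⟨_, _, rfl⟩ := hb; exact body_lt (by omega)
  by_cases h10 : tag c = 10
  · simp only [h10, Nat.reduceBEq, cond_true, cond_false, List.mem_map] at hb
    obtain ⟨_, _, rfl⟩ := hb; exact body_lt (by omega)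
  simp [beq_false_of_ne h7, beq_false_of_ne h8, beq_false_of_ne h9, beq_false_of_ne h10] at hb

theorem evalF_eq (n : ℕ) (st : Store) (ea : List Atom) (e : List ℕ) (c : ℕ) :
    evalF n st ea e c = combF n st ea e c
      ((subF n st ea e c).map fun q => evalF q.1 q.2.1 q.2.2.1 q.2.2.2.1 q.2.2.2.2) :=
  treeRec_eq subF_lt _

section Primrec

variable {α : Type*} [Primcodable α] {st : α → Store} {ea : α → List Atom} {e : α → List ℕ}
  {n c d k : α → ℕ}

@[fun_prop] theorem primrec_evalT (hst : Primrec st) (he : Primrec e) (hc : Primrec c) :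
    Primrec fun a => evalT (st a) (e a) (c a) := by
  have h := primrec_treeRec (α := Store × List ℕ × ℕ) (β := ℕ)
    (comb := fun q vals => bif tag q.2.2 == 0 then q.2.1.getI (body q.2.2) else
      bif tag q.2.2 == 1 then body q.2.2 else look q.1 (5, lft q.2.2, vals))
    evalT_sub_lt (by fun_prop) (by fun_prop) (by fun_prop)
  exact h.comp (g := fun a => (st a, e a, c a)) (by fun_prop)

@[fun_prop] theorem primrec_evalTs (hst : Primrec st) (he : Primrec e) (hc : Primrec c) :
    Primrec fun a => evalTs (st a) (e a) (c a) := by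
  have h : Primrec fun q : Store × List ℕ × ℕ => evalTs q.1 q.2.1 q.2.2 := by
    unfold evalTs; fun_prop
  exact h.comp (g := fun a => (st a, e a, c a)) (by fun_prop)

@[fun_prop] theorem primrec_evalA (hst : Primrec st) (hea : Primrec ea) (he : Primrec e)
    (hc : Primrec c) : Primrec fun a => evalA (st a) (ea a) (e a) (c a) := by
  unfold evalA; fun_prop

@[fun_prop] theorem primrec_cmpB (hn : Primrec n) (hc : Primrec c) (hd : Primrec d) :
    Primrec fun a => cmpB (n a) (c a) (d a) := by
  unfold cmpB; fun_prop

@[fun_prop] theorem primrec_actDomain (hn : Primrec n) (hk : Primrec k) :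
    Primrec fun a => actDomain (n a) (k a) := by
  unfold actDomain; fun_prop

theorem primrec_subF (hn : Primrec n) (hst : Primrec st) (hea : Primrec ea)
    (he : Primrec e) (hc : Primrec c) :
    Primrec fun a => subF (n a) (st a) (ea a) (e a) (c a) := by
  unfold subF
  fun_prop

theorem primrec_combF (hn : Primrec n) (hst : Primrec st) (hea : Primrec ea)
    (he : Primrec e) (hc : Primrec c) {vals : α → List Bool} (hv : Primrec vals) :
    Primrec fun a => combF (n a) (st a) (ea a) (e a) (c a) (vals a) := by
  unfold combF
  fun_prop

@[fun_prop] theorem primrec_evalF (hn : Primrec n) (hst : Primrec st) (hea : Primrec ea)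
    (he : Primrec e) (hc : Primrec c) :
    Primrec fun a => evalF (n a) (st a) (ea a) (e a) (c a) :=
  (primrec_treeRec subF_lt
    (primrec_subF (by fun_prop) (by fun_prop) (by fun_prop) (by fun_prop) (by fun_prop))
    (primrec_combF (by fun_prop) (by fun_prop) (by fun_prop) (by fun_prop) (by fun_prop)
      (by fun_prop)) (by fun_prop)).comp
    (g := fun a => (n a, st a, ea a, e a, c a)) (by fun_prop)

end Primrec

/-! ### Steps of programs -/

/-- The queries about a program expression: the code of the program, the store, the environment
of object variables and the code of the expression. -/
abbrev PQuery : Type := ℕ × Store × List ℕ × ℕ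

/-- The immediate subexpressions of a program expression, with environments. -/
def subP (n : ℕ) (st : Store) (e : List ℕ) (c : ℕ) : List PQuery :=
  bif tag c == 3 || tag c == 4 || tag c == 7 then [(n, st, e, lft c), (n, st, e, rgt c)] else
  bif tag c == 5 then (List.range (numObj n)).map fun o => (n, st, o :: e, body c) else
  bif tag c == 6 then [(n, st, e, body c)] else []

theorem subP_lt (q : PQuery) : ∀ b ∈ subP q.1 q.2.1 q.2.2.1 q.2.2.2, b.2.2.2 < q.2.2.2 := by
  obtain ⟨n, st, e, c⟩ := q
  intro b hb
  simp only [subP] at hb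
  by_cases h3 : tag c = 3 ∨ tag c = 4 ∨ tag c = 7
  · have : b = (n, st, e, lft c) ∨ b = (n, st, e, rgt c) := by
      rcases h3 with h | h | h <;> simpa [h] using hb
    rcases this with rfl | rfl
    exacts [lft_lt (by omega), rgt_lt (by omega)]
  push Not at h3
  simp only [beq_false_of_ne h3.1, beq_false_of_ne h3.2.1, beq_false_of_ne h3.2.2, Bool.or_self,
    cond_false] at hb
  by_cases h5 : tag c = 5
  · simp [h5] at hb; obtain ⟨_, _, rfl⟩ := hb; exact body_lt (by omega)
  by_cases h6 : tag c = 6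
  · simp [h6] at hb; subst hb; exact body_lt (by omega)
  simp [beq_false_of_ne h5, beq_false_of_ne h6] at hb

/-- Whether a program expression is final, given whether its subexpressions are. -/
def combFin (n : ℕ) (st : Store) (e : List ℕ) (c : ℕ) (vals : List Bool) : Bool :=
  bif tag c == 2 then evalF n st [] e (body c) else
  bif tag c == 3 || tag c == 7 then vals.all (fun b => b) else
  bif tag c == 4 || tag c == 5 then vals.any (fun b => b) else
  tag c == 6

/-- Whether the program expression with code `c` is final in the environment `e`. -/
def finC (n : ℕ) (st : Store) (e : List ℕ) (c : ℕ) : Bool :=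
  treeRec (fun q : PQuery => subP q.1 q.2.1 q.2.2.1 q.2.2.2)
    (fun q vals => combFin q.1 q.2.1 q.2.2.1 q.2.2.2 vals) (fun q => q.2.2.2) (n, st, e, c)

theorem finC_eq (n : ℕ) (st : Store) (e : List ℕ) (c : ℕ) :
    finC n st e c = combFin n st e c
      ((subP n st e c).map fun q => finC q.1 q.2.1 q.2.2.1 q.2.2.2) :=
  treeRec_eq subP_lt _

/-- A residual program: the expression with code `c` in the environment `e`. Substitution is
replaced by environments, so that finitely many residual programs are reachable for the simple
reason that codes of subexpressions decrease. -/
def cloR (c : ℕ) (e : List ℕ) : ℕ := Nat.pair 0 (Nat.pair c (Encodable.encode e))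

/-- A residual program: `r` followed by the expression with code `c` in the environment `e`. -/
def seqR (r c : ℕ) (e : List ℕ) : ℕ := Nat.pair 1 (Nat.pair r (Nat.pair c (Encodable.encode e)))

/-- A residual program: `r` and `r'` in parallel. -/
def concR (r r' : ℕ) : ℕ := Nat.pair 2 (Nat.pair r r')

/-- The residual program `nil`. -/
def nilR : ℕ := cloR (Nat.pair 2 (Nat.pair 0 0)) []

/-- The steps of a program expression, given those of its subexpressions. -/
def combStep (n : ℕ) (st : Store) (e : List ℕ) (c : ℕ) (vals : List (List (Atom × ℕ))) :
    List (Atom × ℕ) :=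
  bif tag c == 0 then
    bif evalF n st [] (evalTs st e (rgt c)) ((axioms n 1).getI (lft c)) then
      [((1, lft c, evalTs st e (rgt c)), nilR)] else [] else
  bif tag c == 1 then [((0, 0, []), nilR)] else
  bif tag c == 3 then ((vals.getI 0).map fun p => (p.1, seqR p.2 (rgt c) e)) ++
    bif finC n st e (lft c) then vals.getI 1 else [] else
  bif tag c == 4 || tag c == 5 then vals.flatten else
  bif tag c == 6 then (vals.getI 0).map fun p => (p.1, seqR p.2 c e) else
  bif tag c == 7 then ((vals.getI 0).map fun p => (p.1, concR p.2 (cloR (rgt c) e))) ++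
    (vals.getI 1).map fun p => (p.1, concR (cloR (lft c) e) p.2) else []

/-- The steps of the program expression with code `c` in the environment `e`: pairs of an action
and a residual program. -/
def stepC (n : ℕ) (st : Store) (e : List ℕ) (c : ℕ) : List (Atom × ℕ) :=
  treeRec (fun q : PQuery => subP q.1 q.2.1 q.2.2.1 q.2.2.2)
    (fun q vals => combStep q.1 q.2.1 q.2.2.1 q.2.2.2 vals) (fun q => q.2.2.2) (n, st, e, c)

theorem stepC_eq (n : ℕ) (st : Store) (e : List ℕ) (c : ℕ) :
    stepC n st e c = combStep n st e c
      ((subP n st e c).map fun q => stepC q.1 q.2.1 q.2.2.1 q.2.2.2) :=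
  treeRec_eq subP_lt _

section Shapes

variable {n : ℕ} {st : Store} {e : List ℕ} {c : ℕ}

theorem finC_test (h : tag c = 2) : finC n st e c = evalF n st [] e (body c) := by
  rw [finC_eq]; simp [combFin, h]

theorem finC_both (h : tag c = 3 ∨ tag c = 7) :
    finC n st e c = (finC n st e (lft c) && finC n st e (rgt c)) := by
  rw [finC_eq]; rcases h with h | h <;> simp [combFin, subP, h]

theorem finC_choice (h : tag c = 4) :
    finC n st e c = (finC n st e (lft c) || finC n st e (rgt c)) := by
  rw [finC_eq]; simp [combFin, subP, h]

theorem finC_pick (h : tag c = 5) :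
    finC n st e c = (List.range (numObj n)).any fun o => finC n st (o :: e) (body c) := by
  rw [finC_eq]; simp [combFin, subP, h, List.any_map, Function.comp_def]

theorem finC_star (h : tag c = 6) : finC n st e c = true := by
  rw [finC_eq]; simp [combFin, h]

theorem finC_act (h : tag c = 0 ∨ tag c = 1) : finC n st e c = false := by
  rw [finC_eq]; rcases h with h | h <;> simp [combFin, h]

theorem stepC_act (h : tag c = 0) : stepC n st e c =
    bif evalF n st [] (evalTs st e (rgt c)) ((axioms n 1).getI (lft c)) then
      [((1, lft c, evalTs st e (rgt c)), nilR)] else [] := by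
  rw [stepC_eq]; simp [combStep, h]

theorem stepC_wait (h : tag c = 1) : stepC n st e c = [((0, 0, []), nilR)] := by
  rw [stepC_eq]; simp [combStep, h]

theorem stepC_seq (h : tag c = 3) : stepC n st e c =
    ((stepC n st e (lft c)).map fun p => (p.1, seqR p.2 (rgt c) e)) ++
      bif finC n st e (lft c) then stepC n st e (rgt c) else [] := by
  rw [stepC_eq]; simp [combStep, subP, h, List.getI]

theorem stepC_choice (h : tag c = 4) :
    stepC n st e c = stepC n st e (lft c) ++ stepC n st e (rgt c) := by
  rw [stepC_eq]; simp [combStep, subP, h]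

theorem stepC_pick (h : tag c = 5) : stepC n st e c =
    (List.range (numObj n)).flatMap fun o => stepC n st (o :: e) (body c) := by
  rw [stepC_eq]; simp [combStep, subP, h, List.flatMap, Function.comp_def]

theorem stepC_star (h : tag c = 6) : stepC n st e c =
    (stepC n st e (body c)).map fun p => (p.1, seqR p.2 c e) := by
  rw [stepC_eq]; simp [combStep, subP, h, List.getI]

theorem stepC_conc (h : tag c = 7) : stepC n st e c =
    ((stepC n st e (lft c)).map fun p => (p.1, concR p.2 (cloR (rgt c) e))) ++
      (stepC n st e (rgt c)).map fun p => (p.1, concR (cloR (lft c) e) p.2) := by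
  rw [stepC_eq]; simp [combStep, subP, h, List.getI]

theorem stepC_other (h : tag c = 2 ∨ 7 < tag c) : stepC n st e c = [] := by
  rw [stepC_eq]
  rcases h with h | h
  · simp [combStep, h]
  · have (i : ℕ) (hi : i < 8) : (tag c == i) = false := beq_false_of_ne (by omega)
    simp [combStep, this]

end Shapes

/-- The immediate parts of a residual program. -/
def subR (n : ℕ) (st : Store) (r : ℕ) : List (ℕ × Store × ℕ) :=
  bif tag r == 1 then [(n, st, lft r)] else
  bif tag r == 2 then [(n, st, lft r), (n, st, rgt r)] else []

theorem subR_lt (q : ℕ × Store × ℕ) : ∀ b ∈ subR q.1 q.2.1 q.2.2, b.2.2 < q.2.2 := by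
  obtain ⟨n, st, c⟩ := q
  intro b hb
  simp only [subR] at hb
  by_cases h1 : tag c = 1
  · simp [h1] at hb; subst hb; exact lft_lt (by omega)
  by_cases h2 : tag c = 2
  · simp [h2] at hb
    rcases hb with rfl | rfl
    exacts [lft_lt (by omega), rgt_lt (by omega)]
  simp [beq_false_of_ne h1, beq_false_of_ne h2] at hb

/-- Whether a residual program is final, given whether its parts are. -/
def combFinR (n : ℕ) (st : Store) (r : ℕ) (vals : List Bool) : Bool :=
  bif tag r == 0 then finC n st (seqOf (rgt r)) (lft r) else
  bif tag r == 1 then vals.all (fun b => b) && finC n st (seqOf (body (rgt r))) (tag (rgt r)) else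
  bif tag r == 2 then vals.all (fun b => b) else false

/-- Whether a residual program is final. -/
def finR (n : ℕ) (st : Store) (r : ℕ) : Bool :=
  treeRec (fun q : ℕ × Store × ℕ => subR q.1 q.2.1 q.2.2)
    (fun q vals => combFinR q.1 q.2.1 q.2.2 vals) (fun q => q.2.2) (n, st, r)

theorem finR_eq (n : ℕ) (st : Store) (r : ℕ) :
    finR n st r = combFinR n st r ((subR n st r).map fun q => finR q.1 q.2.1 q.2.2) :=
  treeRec_eq subR_lt _

/-- The steps of a residual program, given those of its parts. -/
def combStepR (n : ℕ) (st : Store) (r : ℕ) (vals : List (List (Atom × ℕ))) : List (Atom × ℕ) :=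
  bif tag r == 0 then stepC n st (seqOf (rgt r)) (lft r) else
  bif tag r == 1 then
    ((vals.getI 0).map fun p => (p.1, seqR p.2 (tag (rgt r)) (seqOf (body (rgt r))))) ++
      bif finR n st (lft r) then stepC n st (seqOf (body (rgt r))) (tag (rgt r)) else [] else
  bif tag r == 2 then ((vals.getI 0).map fun p => (p.1, concR p.2 (rgt r))) ++
    (vals.getI 1).map fun p => (p.1, concR (lft r) p.2) else []

/-- The steps of a residual program: pairs of an action and a residual program. -/
def stepR (n : ℕ) (st : Store) (r : ℕ) : List (Atom × ℕ) :=
  treeRec (fun q : ℕ × Store × ℕ => subR q.1 q.2.1 q.2.2)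
    (fun q vals => combStepR q.1 q.2.1 q.2.2 vals) (fun q => q.2.2) (n, st, r)

theorem stepR_eq (n : ℕ) (st : Store) (r : ℕ) :
    stepR n st r = combStepR n st r ((subR n st r).map fun q => stepR q.1 q.2.1 q.2.2) :=
  treeRec_eq subR_lt _

@[simp] theorem finR_cloR (n : ℕ) (st : Store) (c : ℕ) (e : List ℕ) :
    finR n st (cloR c e) = finC n st e c := by
  rw [finR_eq]; simp [combFinR, cloR, seqOf_encode]

@[simp] theorem finR_seqR (n : ℕ) (st : Store) (r c : ℕ) (e : List ℕ) :
    finR n st (seqR r c e) = (finR n st r && finC n st e c) := by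
  rw [finR_eq]; simp [combFinR, subR, seqR, seqOf_encode]

@[simp] theorem finR_concR (n : ℕ) (st : Store) (r r' : ℕ) :
    finR n st (concR r r') = (finR n st r && finR n st r') := by
  rw [finR_eq]; simp [combFinR, subR, concR]

@[simp] theorem stepR_cloR (n : ℕ) (st : Store) (c : ℕ) (e : List ℕ) :
    stepR n st (cloR c e) = stepC n st e c := by
  rw [stepR_eq]; simp [combStepR, cloR, seqOf_encode]

@[simp] theorem stepR_seqR (n : ℕ) (st : Store) (r c : ℕ) (e : List ℕ) :
    stepR n st (seqR r c e) = ((stepR n st r).map fun p => (p.1, seqR p.2 c e)) ++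
      bif finR n st r then stepC n st e c else [] := by
  rw [stepR_eq]; simp [combStepR, subR, seqR, seqOf_encode, List.getI]

@[simp] theorem stepR_concR (n : ℕ) (st : Store) (r r' : ℕ) :
    stepR n st (concR r r') = ((stepR n st r).map fun p => (p.1, concR p.2 r')) ++
      (stepR n st r').map fun p => (p.1, concR r p.2) := by
  rw [stepR_eq]; simp [combStepR, subR, concR, List.getI]

section Primrec

variable {α : Type*} [Primcodable α] {st : α → Store} {e : α → List ℕ} {n c r : α → ℕ}

@[fun_prop] theorem primrec_cloR (hc : Primrec c) (he : Primrec e) :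
    Primrec fun a => cloR (c a) (e a) := by unfold cloR; fun_prop

@[fun_prop] theorem primrec_seqR (hr : Primrec r) (hc : Primrec c) (he : Primrec e) :
    Primrec fun a => seqR (r a) (c a) (e a) := by unfold seqR; fun_prop

@[fun_prop] theorem primrec_concR (hr : Primrec r) (hc : Primrec c) :
    Primrec fun a => concR (r a) (c a) := by unfold concR; fun_prop

theorem primrec_subP (hn : Primrec n) (hst : Primrec st) (he : Primrec e) (hc : Primrec c) :
    Primrec fun a => subP (n a) (st a) (e a) (c a) := by
  unfold subP; fun_prop

theorem primrec_combFin (hn : Primrec n) (hst : Primrec st) (he : Primrec e) (hc : Primrec c)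
    {vals : α → List Bool} (hv : Primrec vals) :
    Primrec fun a => combFin (n a) (st a) (e a) (c a) (vals a) := by
  unfold combFin; fun_prop

@[fun_prop] theorem primrec_finC (hn : Primrec n) (hst : Primrec st) (he : Primrec e)
    (hc : Primrec c) : Primrec fun a => finC (n a) (st a) (e a) (c a) :=
  (primrec_treeRec subP_lt
    (primrec_subP (by fun_prop) (by fun_prop) (by fun_prop) (by fun_prop))
    (primrec_combFin (by fun_prop) (by fun_prop) (by fun_prop) (by fun_prop) (by fun_prop))
    (by fun_prop)).comp (g := fun a => (n a, st a, e a, c a)) (by fun_prop)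

theorem primrec_combStep (hn : Primrec n) (hst : Primrec st) (he : Primrec e) (hc : Primrec c)
    {vals : α → List (List (Atom × ℕ))} (hv : Primrec vals) :
    Primrec fun a => combStep (n a) (st a) (e a) (c a) (vals a) := by
  unfold combStep; fun_prop

@[fun_prop] theorem primrec_stepC (hn : Primrec n) (hst : Primrec st) (he : Primrec e)
    (hc : Primrec c) : Primrec fun a => stepC (n a) (st a) (e a) (c a) :=
  (primrec_treeRec subP_lt
    (primrec_subP (by fun_prop) (by fun_prop) (by fun_prop) (by fun_prop))
    (primrec_combStep (by fun_prop) (by fun_prop) (by fun_prop) (by fun_prop) (by fun_prop))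
    (by fun_prop)).comp (g := fun a => (n a, st a, e a, c a)) (by fun_prop)

theorem primrec_subR (hn : Primrec n) (hst : Primrec st) (hr : Primrec r) :
    Primrec fun a => subR (n a) (st a) (r a) := by
  unfold subR; fun_prop

theorem primrec_combFinR (hn : Primrec n) (hst : Primrec st) (hr : Primrec r)
    {vals : α → List Bool} (hv : Primrec vals) :
    Primrec fun a => combFinR (n a) (st a) (r a) (vals a) := by
  unfold combFinR; fun_prop

@[fun_prop] theorem primrec_finR (hn : Primrec n) (hst : Primrec st) (hr : Primrec r) :
    Primrec fun a => finR (n a) (st a) (r a) :=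
  (primrec_treeRec subR_lt (primrec_subR (by fun_prop) (by fun_prop) (by fun_prop))
    (primrec_combFinR (by fun_prop) (by fun_prop) (by fun_prop) (by fun_prop))
    (by fun_prop)).comp (g := fun a => (n a, st a, r a)) (by fun_prop)

theorem primrec_combStepR (hn : Primrec n) (hst : Primrec st) (hr : Primrec r)
    {vals : α → List (List (Atom × ℕ))} (hv : Primrec vals) :
    Primrec fun a => combStepR (n a) (st a) (r a) (vals a) := by
  unfold combStepR; fun_prop

@[fun_prop] theorem primrec_stepR (hn : Primrec n) (hst : Primrec st) (hr : Primrec r) :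
    Primrec fun a => stepR (n a) (st a) (r a) :=
  (primrec_treeRec subR_lt (primrec_subR (by fun_prop) (by fun_prop) (by fun_prop))
    (primrec_combStepR (by fun_prop) (by fun_prop) (by fun_prop) (by fun_prop))
    (by fun_prop)).comp (g := fun a => (n a, st a, r a)) (by fun_prop)

end Primrec

/-! ### The abstract transition system -/

/-- The residues, modulo one unit of time, of the clock values in the list `ws`, together with the
residue `0` of the present. Values are multiples of one over `2 * D`, and values above `K` are
left out. -/
def residues (D K : ℕ) (ws : List ℕ) : List ℕ :=
  0 :: (ws.filter fun w => Nat.ble w (2 * D * K)).map fun w => w % (2 * D)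

/-- The number of entries of `l` below `x`. -/
def rank (l : List ℕ) (x : ℕ) : ℕ := ((List.range x).filter fun y => l.any fun z => z == y).length

/-- The clock value `w`, a multiple of one over `2 * D`, rounded to a multiple of one over `D`. The
integral part is kept, and the fractional part is replaced by its rank among the residues `l`.
A value above `K` becomes `K + 1`. -/
def normalize (D K : ℕ) (l : List ℕ) (w : ℕ) : ℕ :=
  bif Nat.ble w (2 * D * K) then D * (w / (2 * D)) + rank l (w % (2 * D)) else D * (K + 1)

/-- The values of the clocks after a delay of `d`, a multiple of one over `2 * gridSize n`. -/
def delayed (n : ℕ) (st : Store) (d : ℕ) : List ℕ :=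
  (atoms n 3).map fun k => 2 * look st k + d

/-- The value of `k` after the action `a` with duration `d`. -/
def nextVal (n : ℕ) (st : Store) (a : Atom) (d : ℕ) (k : Atom) : ℕ :=
  bif k.1 == 2 then (evalF n st [a] k.2.2 ((axioms n 2).getI k.2.1)).toNat else
  bif k.1 == 3 then
    bif a.1 == 0 then
      normalize (gridSize n) n (residues (gridSize n) n (delayed n st d)) (2 * look st k + d) else
    bif evalF n st [a] k.2.2 ((axioms n 3).getI k.2.1) then 0 else look st k else
  look st k

/-- The store after the action `a` with duration `d`. -/
def nextStore (n : ℕ) (st : Store) (a : Atom) (d : ℕ) : Store :=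
  (keys n).map fun k => (k, min (nextVal n st a d k) (storeBound n))

/-- The successors of a configuration, which consists of a residual program and a store. A delay
by `n + 1` takes all clocks beyond the constants, so that no larger delays are needed. -/
def succs (n : ℕ) (x : ℕ × Store) : List (ℕ × Store) :=
  (stepR n x.2 x.1).flatMap fun p =>
    bif p.1.1 == 0 then
      (List.range (2 * cap n + 1)).map fun d => (p.2, nextStore n x.2 p.1 d)
    else [(p.2, nextStore n x.2 p.1 0)]

/-- The stores that describe an initial situation. -/
def initStores (n : ℕ) : List Store :=
  (stores (storeBound n) (keys n)).filter fun st =>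
    ((atoms n 5).all fun k => !Nat.ble (numObj n) (look st k)) &&
    ((atoms n 3).all fun k => look st k == 0) &&
    (axioms n 0).all fun c => evalF n st [] [] c

/-- The initial configurations. -/
def initConfs (n : ℕ) : List (ℕ × Store) :=
  (initStores n).map fun st => (cloR (item n 2) [], st)

section Primrec

variable {α : Type*} [Primcodable α] {st : α → Store} {l : α → List ℕ} {n D K w d : α → ℕ}

@[fun_prop] theorem primrec_residues (hD : Primrec D) (hK : Primrec K) (hl : Primrec l) :
    Primrec fun a => residues (D a) (K a) (l a) := by unfold residues; fun_prop

@[fun_prop] theorem primrec_rank (hl : Primrec l) (hw : Primrec w) :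
    Primrec fun a => rank (l a) (w a) := by unfold rank; fun_prop

@[fun_prop] theorem primrec_normalize (hD : Primrec D) (hK : Primrec K) (hl : Primrec l)
    (hw : Primrec w) : Primrec fun a => normalize (D a) (K a) (l a) (w a) := by
  unfold normalize; fun_prop

@[fun_prop] theorem primrec_delayed (hn : Primrec n) (hst : Primrec st) (hd : Primrec d) :
    Primrec fun a => delayed (n a) (st a) (d a) := by unfold delayed; fun_prop

@[fun_prop] theorem primrec_nextVal (hn : Primrec n) (hst : Primrec st) {b k : α → Atom}
    (hb : Primrec b) (hd : Primrec d) (hk : Primrec k) :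
    Primrec fun a => nextVal (n a) (st a) (b a) (d a) (k a) := by unfold nextVal; fun_prop

@[fun_prop] theorem primrec_nextStore (hn : Primrec n) (hst : Primrec st) {b : α → Atom}
    (hb : Primrec b) (hd : Primrec d) :
    Primrec fun a => nextStore (n a) (st a) (b a) (d a) := by unfold nextStore; fun_prop

theorem primrec_succs : Primrec fun p : ℕ × ℕ × Store => succs p.1 p.2 := by
  unfold succs; fun_prop

@[fun_prop] theorem primrec_initStores (hn : Primrec n) :
    Primrec fun a => initStores (n a) := by unfold initStores; fun_prop

theorem primrec_initConfs : Primrec initConfs := by unfold initConfs; fun_prop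

end Primrec

/-! ### Finitely many configurations are reachable -/

/-- Under the steps in arbitrary stores, finitely many residual programs are reachable from `r`. -/
def FinReach (n r : ℕ) : Prop :=
  ∃ F : Set ℕ, F.Finite ∧ r ∈ F ∧ ∀ x ∈ F, ∀ st, ∀ p ∈ stepR n st x, p.2 ∈ F

theorem FinReach.of_step {n r : ℕ} {G : Set ℕ} (hG : G.Finite)
    (h : ∀ x ∈ G, ∀ st, ∀ p ∈ stepR n st x, p.2 ∈ G)
    (hr : ∀ st, ∀ p ∈ stepR n st r, p.2 ∈ G) : FinReach n r := by
  refine ⟨insert r G, hG.insert r, Set.mem_insert _ _, ?_⟩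
  rintro x (rfl | hx) st p hp
  exacts [.inr (hr st p hp), .inr (h x hx st p hp)]

theorem stepR_nilR (n : ℕ) (st : Store) : stepR n st nilR = [] := by
  rw [nilR, stepR_cloR, stepC_other (by simp)]

theorem finReach_cloR (n c : ℕ) : ∀ e, FinReach n (cloR c e) := by
  induction c using Nat.strong_induction_on with
  | _ c ih =>
  intro e
  simp only [FinReach] at ih
  rcases show tag c = 0 ∨ tag c = 1 ∨ (tag c = 2 ∨ 7 < tag c) ∨ tag c = 3 ∨ tag c = 4 ∨
    tag c = 5 ∨ tag c = 6 ∨ tag c = 7 by omega with h | h | h | h | h | h | h | h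
  · refine FinReach.of_step (G := {nilR}) (Set.finite_singleton _) ?_ fun st p hp => ?_
    · rintro x rfl st p hp; simp [stepR_nilR] at hp
    · rw [stepR_cloR, stepC_act h] at hp
      generalize evalF n st [] _ _ = b at hp
      cases b <;> simp_all
  · refine FinReach.of_step (G := {nilR}) (Set.finite_singleton _) ?_ fun st p hp => ?_
    · rintro x rfl st p hp; simp [stepR_nilR] at hp
    · rw [stepR_cloR, stepC_wait h] at hp
      simp_all
  · refine FinReach.of_step Set.finite_empty (fun x hx => hx.elim) fun st p hp => ?_
    rw [stepR_cloR, stepC_other h] at hp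
    simp at hp
  · obtain ⟨F, hF, hr1, hs1⟩ := ih _ (lft_lt (by omega)) e
    obtain ⟨G, hG, hr2, hs2⟩ := ih _ (rgt_lt (by omega)) e
    refine FinReach.of_step (G := (fun x => seqR x (rgt c) e) '' F ∪ G)
      ((hF.image _).union hG) ?_ ?_
    · rintro _ (⟨x, hx, rfl⟩ | hx) st p hp
      · simp only [stepR_seqR, List.mem_append, List.mem_map] at hp
        rcases hp with ⟨q, hq, rfl⟩ | hp
        · exact .inl ⟨_, hs1 x hx st q hq, rfl⟩
        · cases h : finR n st x <;> simp only [h, cond_true, cond_false, List.not_mem_nil] at hp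
          exact .inr (hs2 _ hr2 st p (by rwa [stepR_cloR]))
      · exact .inr (hs2 _ hx st p hp)
    · intro st p hp
      rw [stepR_cloR, stepC_seq h, List.mem_append, List.mem_map] at hp
      rcases hp with ⟨q, hq, rfl⟩ | hp
      · exact .inl ⟨_, hs1 _ hr1 st _ (by rwa [stepR_cloR]), rfl⟩
      · cases h : finC n st e (lft c) <;> simp only [h, cond_true, cond_false,
          List.not_mem_nil] at hp
        exact .inr (hs2 _ hr2 st p (by rwa [stepR_cloR]))
  · obtain ⟨F, hF, hr1, hs1⟩ := ih _ (lft_lt (by omega)) e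
    obtain ⟨G, hG, hr2, hs2⟩ := ih _ (rgt_lt (by omega)) e
    refine FinReach.of_step (hF.union hG) ?_ ?_
    · rintro x (hx | hx) st p hp
      exacts [.inl (hs1 x hx st p hp), .inr (hs2 x hx st p hp)]
    · intro st p hp
      rw [stepR_cloR, stepC_choice h, List.mem_append] at hp
      rcases hp with hp | hp
      exacts [.inl (hs1 _ hr1 st p (by rwa [stepR_cloR])),
        .inr (hs2 _ hr2 st p (by rwa [stepR_cloR]))]
  · choose F hF hr1 hs1 using fun o : ℕ => ih _ (body_lt (c := c) (by omega)) (o :: e)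
    refine FinReach.of_step (G := ⋃ o ∈ Set.Iio (numObj n), F o)
      ((Set.finite_Iio _).biUnion fun o _ => hF o) ?_ ?_
    · intro x hx st p hp
      simp only [Set.mem_iUnion] at hx ⊢
      obtain ⟨o, ho, hx⟩ := hx
      exact ⟨o, ho, hs1 o x hx st p hp⟩
    · intro st p hp
      rw [stepR_cloR, stepC_pick h, List.mem_flatMap] at hp
      obtain ⟨o, ho, hp⟩ := hp
      simp only [Set.mem_iUnion]
      exact ⟨o, List.mem_range.1 ho, hs1 o _ (hr1 o) st p (by rwa [stepR_cloR])⟩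
  · obtain ⟨F, hF, hr1, hs1⟩ := ih _ (body_lt (by omega)) e
    have hc : ∀ st, ∀ p ∈ stepR n st (cloR c e), p.2 ∈ (fun x => seqR x c e) '' F := by
      intro st p hp
      rw [stepR_cloR, stepC_star h, List.mem_map] at hp
      obtain ⟨q, hq, rfl⟩ := hp
      exact ⟨_, hs1 _ hr1 st _ (by rwa [stepR_cloR]), rfl⟩
    refine FinReach.of_step (hF.image fun x => seqR x c e) ?_ hc
    rintro _ ⟨x, hx, rfl⟩ st p hp
    simp only [stepR_seqR, List.mem_append, List.mem_map] at hp
    rcases hp with ⟨q, hq, rfl⟩ | hp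
    · exact ⟨_, hs1 x hx st q hq, rfl⟩
    · cases h : finR n st x <;> simp only [h, cond_true, cond_false, List.not_mem_nil] at hp
      exact hc st p (by rwa [stepR_cloR])
  · obtain ⟨F, hF, hr1, hs1⟩ := ih _ (lft_lt (by omega)) e
    obtain ⟨G, hG, hr2, hs2⟩ := ih _ (rgt_lt (by omega)) e
    refine FinReach.of_step (hF.image2 concR hG) ?_ ?_
    · rintro _ ⟨x, hx, y, hy, rfl⟩ st p hp
      simp only [stepR_concR, List.mem_append, List.mem_map] at hp
      rcases hp with ⟨q, hq, rfl⟩ | ⟨q, hq, rfl⟩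
      exacts [⟨_, hs1 x hx st q hq, _, hy, rfl⟩, ⟨_, hx, _, hs2 y hy st q hq, rfl⟩]
    · intro st p hp
      rw [stepR_cloR, stepC_conc h, List.mem_append, List.mem_map, List.mem_map] at hp
      rcases hp with ⟨q, hq, rfl⟩ | ⟨q, hq, rfl⟩
      exacts [⟨_, hs1 _ hr1 st _ (by rwa [stepR_cloR]), _, hr2, rfl⟩,
        ⟨_, hr1, _, hs2 _ hr2 st _ (by rwa [stepR_cloR]), rfl⟩]

theorem map_mem_stores {B : ℕ} (f : Atom → ℕ) (hf : ∀ k, f k ≤ B) (ks : List Atom) :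
    (ks.map fun k => (k, f k)) ∈ stores B ks := by
  induction ks with
  | nil => simp [stores]
  | cons k ks ih =>
    refine List.mem_flatMap.2 ⟨_, ih, List.mem_map.2 ⟨f k, ?_, rfl⟩⟩
    have := hf k
    simp; omega

theorem nextStore_mem_stores (n : ℕ) (st : Store) (a : Atom) (d : ℕ) :
    nextStore n st a d ∈ stores (storeBound n) (keys n) :=
  map_mem_stores _ (fun _ => Nat.min_le_right _ _) _

theorem exists_finite_closed (n : ℕ) : ∃ F : Set (ℕ × Store), F.Finite ∧
    (∀ x ∈ initConfs n, x ∈ F) ∧ ∀ x ∈ F, ∀ y ∈ succs n x, y ∈ F := by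
  obtain ⟨F, hF, hr, hs⟩ := finReach_cloR n (item n 2) []
  refine ⟨F ×ˢ {st | st ∈ stores (storeBound n) (keys n)}, hF.prod (List.finite_toSet _), ?_, ?_⟩
  · intro x hx
    obtain ⟨st, hst, rfl⟩ := List.mem_map.1 hx
    exact ⟨hr, (List.mem_filter.1 hst).1⟩
  · rintro ⟨r, st⟩ ⟨hr, -⟩ y hy
    obtain ⟨p, hp, hy⟩ := List.mem_flatMap.1 hy
    have hp2 := hs r hr st p hp
    cases h : p.1.1 == 0 <;> simp only [h, cond_true, cond_false, List.mem_map,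
      List.mem_singleton] at hy
    · subst hy; exact ⟨hp2, nextStore_mem_stores ..⟩
    · obtain ⟨d, -, rfl⟩ := hy; exact ⟨hp2, nextStore_mem_stores ..⟩

/-- Both the existence of an initial store and reachability of a final configuration from an
initial one are decided by an algorithm. -/
theorem exists_computable_decision : ∃ alg : ℕ → Bool, Computable alg ∧ ∀ n, alg n = true ↔
    initStores n = [] ∨ ∃ st ∈ initStores n, ∃ y,
      Reach succs n (cloR (item n 2) [], st) y ∧ finR n y.2 y.1 = true := by
  obtain ⟨alg, halg, h⟩ := exists_computable_reach (next := succs) (init := initConfs)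
    (final := fun n y => finR n y.2 y.1) primrec_succs primrec_initConfs (by fun_prop)
    exists_finite_closed
  have he : Primrec fun n => Nat.ble (initStores n).length 0 := by fun_prop
  refine ⟨fun n => Nat.ble (initStores n).length 0 || alg n,
    Primrec.or.to_comp.comp he.to_comp halg, fun n => ?_⟩
  rw [Bool.or_eq_true, h]
  simp [initConfs]

/-! ### Clock regions -/

section Regions

variable {κ ι : Type*}

/-- The differences of the positions in `A` compare to integers in the same way for `v` and `w`. -/
def SameOrder (A : Set κ) (v w : κ → ℝ) : Prop :=
  ∀ i ∈ A, ∀ j ∈ A, ∀ m : ℤ, v i - v j < m ↔ w i - w j < m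

theorem SameOrder.symm {A : Set κ} {v w : κ → ℝ} (h : SameOrder A v w) : SameOrder A w v :=
  fun i hi j hj m => (h i hi j hj m).symm

theorem SameOrder.trans {A : Set κ} {v w z : κ → ℝ} (h : SameOrder A v w)
    (h' : SameOrder A w z) : SameOrder A v z :=
  fun i hi j hj m => (h i hi j hj m).trans (h' i hi j hj m)

theorem lt_intCast_iff_of_between {x y : ℝ} {c : ℤ} (h1 : c < x) (h2 : x < c + 1) (h3 : c < y)
    (h4 : y < c + 1) (m : ℤ) : (x < m ↔ y < m) ∧ ((m : ℝ) < x ↔ (m : ℝ) < y) := by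
  rcases le_or_gt m c with h | h
  · have h' : (m : ℝ) ≤ c := by exact_mod_cast h
    exact ⟨⟨fun _ => by linarith, fun _ => by linarith⟩,
      ⟨fun _ => by linarith, fun _ => by linarith⟩⟩
  · have h' : (c : ℝ) + 1 ≤ m := by exact_mod_cast h
    exact ⟨⟨fun _ => by linarith, fun _ => by linarith⟩,
      ⟨fun _ => by linarith, fun _ => by linarith⟩⟩

/-- A further position on one side has a counterpart on the other side. This is why equivalence
of clock values is a bisimulation for delays. -/
theorem SameOrder.extend [Finite κ] {A : Set κ} {v w : κ → ℝ} (h : SameOrder A v w) (p : ℝ) :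
    ∃ q : ℝ, ∀ i ∈ A, ∀ m : ℤ, (v i - p < m ↔ w i - q < m) ∧ (p - v i < m ↔ q - w i < m) := by
  by_cases hp : ∃ j ∈ A, ∃ m : ℤ, p = v j + m
  · obtain ⟨j, hj, c, rfl⟩ := hp
    refine ⟨w j + c, fun i hi m => ⟨?_, ?_⟩⟩
    · have h1 := h i hi j hj (m + c)
      push_cast at h1
      constructor <;> intro h2
      · have := h1.1 (by linarith); linarith
      · have := h1.2 (by linarith); linarith
    · have h1 := h j hj i hi (m - c)
      push_cast at h1
      constructor <;> intro h2
      · have := h1.1 (by linarith); linarith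
      · have := h1.2 (by linarith); linarith
  push Not at hp
  have hlo : ∀ i ∈ A, v i + (⌊p - v i⌋ : ℝ) < p := fun i hi =>
    lt_of_le_of_ne (by linarith [Int.floor_le (p - v i)]) (hp i hi _).symm
  have hhi : ∀ i, p < v i + (⌊p - v i⌋ : ℝ) + 1 := fun i => by
    linarith [Int.lt_floor_add_one (p - v i)]
  let T := A.toFinite.toFinset
  obtain ⟨q, hq1, hq2⟩ := Order.exists_between_finsets
    (T.image fun i => w i + (⌊p - v i⌋ : ℝ)) (T.image fun i => w i + (⌊p - v i⌋ : ℝ) + 1) (by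
      intro x hx y hy
      obtain ⟨i, hi, rfl⟩ := Finset.mem_image.1 hx
      obtain ⟨j, hj, rfl⟩ := Finset.mem_image.1 hy
      have hi' : i ∈ A := by simpa [T] using hi
      have hj' : j ∈ A := by simpa [T] using hj
      have h1 := (h i hi' j hj' (⌊p - v j⌋ + 1 - ⌊p - v i⌋)).1 (by
        push_cast; linarith [hlo i hi', hhi j])
      push_cast at h1
      linarith)
  refine ⟨q, fun i hi m => ?_⟩
  have hiT : i ∈ T := by simpa [T] using hi
  have h3 := hq1 _ (Finset.mem_image_of_mem _ hiT)
  have h4 := hq2 _ (Finset.mem_image_of_mem _ hiT)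
  have h5 := hlo i hi
  have h6 := hhi i
  have key := fun m => lt_intCast_iff_of_between (x := p - v i) (y := q - w i) (c := ⌊p - v i⌋)
    (by linarith) (by linarith) (by linarith) (by linarith) m
  refine ⟨?_, (key m).1⟩
  have h7 := (key (-m)).2
  push_cast at h7
  constructor <;> intro h8
  · have := h7.1 (by linarith); linarith
  · have := h7.2 (by linarith); linarith

/-- Positions given by integral parts `a` and fractional parts: only the ordering of the fractional
parts matters. -/
theorem sameOrder_of_parts {A : Set κ} {a : κ → ℤ} {f g : κ → ℝ}
    (hf : ∀ i ∈ A, 0 ≤ f i ∧ f i < 1) (hg : ∀ i ∈ A, 0 ≤ g i ∧ g i < 1)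
    (hfg : ∀ i ∈ A, ∀ j ∈ A, f i < f j ↔ g i < g j) :
    SameOrder A (fun i => a i + f i) (fun i => a i + g i) := by
  have key : ∀ (c m : ℤ) (x y : ℝ), 0 ≤ x → x < 1 → 0 ≤ y → y < 1 →
      ((c : ℝ) + (x - y) < m ↔ c < m ∨ c = m ∧ x < y) := by
    intro c m x y h1 h2 h3 h4
    rcases lt_trichotomy c m with h | h | h
    · have h' : (c : ℝ) + 1 ≤ m := by exact_mod_cast h
      exact ⟨fun _ => .inl h, fun _ => by linarith⟩
    · subst h
      simp
    · have h' : (m : ℝ) + 1 ≤ c := by exact_mod_cast h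
      exact ⟨fun _ => by linarith, fun h6 => by omega⟩
  intro i hi j hj m
  have h1 := key (a i - a j) m (f i) (f j) (hf i hi).1 (hf i hi).2 (hf j hj).1 (hf j hj).2
  have h2 := key (a i - a j) m (g i) (g j) (hg i hi).1 (hg i hi).2 (hg j hj).1 (hg j hj).2
  rw [hfg i hi j hj, ← h2] at h1
  push_cast at h1
  convert h1 using 2 <;> ring

/-- Clock values together with the value `0` at the additional position `none`. Differences to it
are the clock values themselves. -/
def withZero (v : ι → ℝ) (o : Option ι) : ℝ := o.elim 0 v

@[simp] theorem withZero_none (v : ι → ℝ) : withZero v none = 0 := rfl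
@[simp] theorem withZero_some (v : ι → ℝ) (i : ι) : withZero v (some i) = v i := rfl

/-- The positions of the values up to `B`. -/
def active (B : ℕ) (u : ι → ℕ) : Set (Option ι) := {o | ∀ i, o = some i → u i ≤ B}

@[simp] theorem none_mem_active (B : ℕ) (u : ι → ℕ) : none ∈ active B u := by
  intro i hi; simp at hi

@[simp] theorem some_mem_active {B : ℕ} {u : ι → ℕ} {i : ι} : some i ∈ active B u ↔ u i ≤ B :=
  ⟨fun h => h i rfl, fun h j hj => by obtain rfl := Option.some.inj hj; exact h⟩

/-- The clock values `v` and the values `u` on the grid with `D` points per unit of time are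
region equivalent for constants up to `K`: a grid value above `K` equals `K + 1` and stands for any
clock value above `K`, and the other ones, with the value `0` added, have the same order. -/
structure ClockRel (D K : ℕ) (v : ι → ℝ) (u : ι → ℕ) : Prop where
  above : ∀ i, D * K < u i → u i = D * (K + 1) ∧ (K : ℝ) < v i
  order : SameOrder (active (D * K) u) (withZero v) (withZero fun i => (u i : ℝ) / D)

/-- Region equivalence to values on the grid with `2 * D` points per unit of time, where all
values above `K` are accepted. -/
structure HalfRel (D K : ℕ) (v : ι → ℝ) (w : ι → ℕ) : Prop where
  above : ∀ i, 2 * D * K < w i → (K : ℝ) < v i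
  order : SameOrder (active (2 * D * K) w) (withZero v) (withZero fun i => (w i : ℝ) / (2 * D))

variable {D K : ℕ} {v : ι → ℝ} {u : ι → ℕ}

theorem ClockRel.lt_iff (hD : 0 < D) (h : ClockRel D K v u) (i : ι) {c : ℕ} (hc : c ≤ K) :
    v i < c ↔ u i < c * D := by
  have hD' : (0 : ℝ) < D := by exact_mod_cast hD
  rcases le_or_gt (u i) (D * K) with hi | hi
  · have h1 := h.order (some i) (some_mem_active.2 hi) none (none_mem_active _ _) c
    simp only [withZero_some, withZero_none, sub_zero, Int.cast_natCast, div_lt_iff₀ hD'] at h1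
    rw [h1]
    exact_mod_cast Iff.rfl
  · obtain ⟨h1, h2⟩ := h.above i hi
    have h3 : (c : ℝ) ≤ K := by exact_mod_cast hc
    have h4 : c * D ≤ D * K := by rw [mul_comm]; exact Nat.mul_le_mul_left D hc
    exact ⟨fun _ => by linarith, fun _ => by omega⟩

theorem ClockRel.gt_iff (hD : 0 < D) (h : ClockRel D K v u) (i : ι) {c : ℕ} (hc : c ≤ K) :
    (c : ℝ) < v i ↔ c * D < u i := by
  have hD' : (0 : ℝ) < D := by exact_mod_cast hD
  rcases le_or_gt (u i) (D * K) with hi | hi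
  · have h1 := h.order none (none_mem_active _ _) (some i) (some_mem_active.2 hi) (-(c : ℤ))
    simp only [withZero_some, withZero_none, zero_sub, Int.cast_neg, neg_lt_neg_iff,
      Int.cast_natCast, lt_div_iff₀ hD'] at h1
    rw [h1]
    exact_mod_cast Iff.rfl
  · obtain ⟨h1, h2⟩ := h.above i hi
    have h3 : (c : ℝ) ≤ K := by exact_mod_cast hc
    have h4 : c * D ≤ D * K := by rw [mul_comm]; exact Nat.mul_le_mul_left D hc
    exact ⟨fun _ => by omega, fun _ => by linarith⟩

theorem ble_iff {x y : ℕ} : Nat.ble x y = true ↔ x ≤ y := by rw [Nat.ble_eq]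

theorem not_ble_iff {x y : ℕ} : (!Nat.ble x y) = true ↔ y < x := by
  rw [Bool.not_eq_true', ← Bool.not_eq_true, ble_iff, not_le]

/-- The comparison operators on natural numbers. -/
theorem cmpB_code_iff (r : Cmp) (x y : ℕ) : cmpB r.code x y = true ↔ r.Holds x y := by
  cases r <;> simp only [Cmp.Holds, cmpB, Cmp.code, Nat.reduceBEq, BEq.rfl, cond_true, cond_false,
    ble_iff, not_ble_iff, beq_iff_eq, ge_iff_le, gt_iff_lt, Nat.cast_lt, Nat.cast_le, Nat.cast_inj]

/-- Equivalent clock values satisfy the same comparisons. -/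
theorem ClockRel.holds_iff (hD : 0 < D) (h : ClockRel D K v u) (i : ι) {c : ℕ} (hc : c ≤ K)
    (r : Cmp) : r.Holds (v i) c ↔ cmpB r.code (u i) (c * D) = true := by
  have h1 := h.lt_iff hD i hc
  have h2 := h.gt_iff hD i hc
  rw [← Nat.cast_lt (α := ℝ)] at h1 h2
  rw [cmpB_code_iff]
  cases r <;> simp only [Cmp.Holds, ge_iff_le, gt_iff_lt]
  · exact h1
  · rw [← not_lt, h2, not_lt]
  · rw [le_antisymm_iff, le_antisymm_iff, ← not_lt, ← not_lt, h1, h2, not_lt, not_lt]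
  · rw [← not_lt, h1, not_lt]
  · exact h2

theorem clockRel_zero (D K : ℕ) : ClockRel D K (fun _ : ι => (0 : ℝ)) (fun _ => 0) where
  above := by simp
  order := by
    have (o : Option ι) : withZero (fun _ : ι => (0 : ℝ)) o = 0 := by cases o <;> rfl
    intro i _ j _ m
    simp [this]

/-- Region equivalence is preserved by resets. -/
theorem ClockRel.reset (h : ClockRel D K v u) (p : ι → Prop) [DecidablePred p] :
    ClockRel D K (fun i => if p i then 0 else v i) (fun i => if p i then 0 else u i) where
  above i := by
    by_cases hi : p i
    · simp [hi]
    · simpa [hi] using h.above i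
  order := by
    -- a clock that is reset takes the additional position
    let f : Option ι → Option ι := fun o => o.bind fun i => if p i then none else some i
    have hf : ∀ o ∈ active (D * K) (fun i => if p i then 0 else u i), f o ∈ active (D * K) u := by
      intro o ho
      cases o with
      | none => simp [f]
      | some i =>
        by_cases hi : p i
        · simp [f, hi]
        · simpa [f, hi] using ho
    have hv : ∀ o, withZero (fun i => if p i then 0 else v i) o = withZero v (f o) := by
      intro o
      cases o with
      | none => rfl
      | some i => by_cases hi : p i <;> simp [f, hi]
    have hu : ∀ o, withZero (fun i => ((if p i then 0 else u i : ℕ) : ℝ) / D) o =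
        withZero (fun i => (u i : ℝ) / D) (f o) := by
      intro o
      cases o with
      | none => rfl
      | some i => by_cases hi : p i <;> simp [f, hi]
    intro i hi j hj m
    rw [hv, hv, hu, hu]
    exact h.order _ (hf i hi) _ (hf j hj) m

theorem ClockRel.nonneg (h : ClockRel D K v u) (i : ι) : 0 ≤ v i := by
  rcases le_or_gt (u i) (D * K) with hi | hi
  · have h1 := h.order (some i) (some_mem_active.2 hi) none (none_mem_active _ _) 0
    simp only [withZero_some, withZero_none, sub_zero, Int.cast_zero] at h1
    rw [← not_lt, h1, not_lt]
    positivity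
  · exact (Nat.cast_nonneg K).trans (h.above i hi).2.le

theorem ClockRel.le (h : ClockRel D K v u) (i : ι) : u i ≤ D * (K + 1) := by
  rcases le_or_gt (u i) (D * K) with hi | hi
  · exact hi.trans (Nat.mul_le_mul_left D (Nat.le_succ K))
  · exact (h.above i hi).1.le

theorem ClockRel.congr {v' : ι → ℝ} {u' : ι → ℕ} (h : ClockRel D K v u)
    (hv : ∀ i, v' i = v i) (hu : ∀ i, u' i = u i) : ClockRel D K v' u' := by
  rwa [funext hv, funext hu]

theorem halfRel_of_delay (hD : 0 < D) (h : ClockRel D K v u) {t : ℝ} (ht : 0 ≤ t) {d : ℕ}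
    (ha : ∀ i, u i ≤ D * K → ∀ m : ℤ, (v i + t < m ↔ (u i : ℝ) / D + d / (2 * D) < m) ∧
      (-(v i + t) < m ↔ -((u i : ℝ) / D + d / (2 * D)) < m)) :
    HalfRel D K (fun i => v i + t) (fun i => 2 * u i + d) := by
  have hD' : (0 : ℝ) < D := by exact_mod_cast hD
  have hval : ∀ i, ((2 * u i + d : ℕ) : ℝ) / (2 * D) = (u i : ℝ) / D + d / (2 * D) := by
    intro i; push_cast; field_simp
  have hact : ∀ i, 2 * u i + d ≤ 2 * D * K → u i ≤ D * K := by
    intro i hi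
    have : 2 * D * K = 2 * (D * K) := by ring
    omega
  refine ⟨fun i hi => ?_, fun i hi j hj m => ?_⟩
  · rcases le_or_gt (u i) (D * K) with hu | hu
    · have h1 := (ha i hu (-(K : ℤ))).2
      rw [← hval i] at h1
      push_cast at h1
      have h2 : (2 * D * K : ℝ) < 2 * u i + d := by exact_mod_cast hi
      have h3 : (K : ℝ) < (2 * u i + d) / (2 * D) := by
        rw [lt_div_iff₀ (by positivity)]; linarith
      have := h1.2 (by linarith)
      linarith
    · have := (h.above i hu).2
      linarith
  · cases i with
    | none =>
      cases j with
      | none => simp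
      | some j =>
        have h1 := (ha j (hact j (hj j rfl)) m).2
        rw [← hval j] at h1
        simpa using h1
    | some i =>
      have hi' := hact i (hi i rfl)
      cases j with
      | none =>
        have h1 := (ha i hi' m).1
        rw [← hval i] at h1
        simpa using h1
      | some j =>
        have hj' := hact j (hj j rfl)
        have h1 := h.order (some i) (some_mem_active.2 hi') (some j) (some_mem_active.2 hj') m
        simp only [withZero_some, hval, add_sub_add_right_eq_sub] at h1 ⊢
        exact h1

/-- The rounding of the real number `x` to a multiple of one half. -/
theorem exists_round {x : ℝ} (hx : 0 ≤ x) : ∃ d : ℕ, ∀ k : ℤ,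
    (x < k ↔ (d : ℝ) < 2 * k) ∧ ((k : ℝ) < x ↔ 2 * (k : ℝ) < d) := by
  have h1 : (0 : ℤ) ≤ ⌊x⌋ + ⌈x⌉ := add_nonneg (Int.floor_nonneg.2 hx) (Int.ceil_nonneg hx)
  refine ⟨(⌊x⌋ + ⌈x⌉).toNat, fun k => ?_⟩
  have h2 : (((⌊x⌋ + ⌈x⌉).toNat : ℕ) : ℝ) = ((⌊x⌋ + ⌈x⌉ : ℤ) : ℝ) := by
    exact_mod_cast congrArg (fun z : ℤ => (z : ℝ)) (Int.toNat_of_nonneg h1)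
  have h3 : ⌈x⌉ ≤ ⌊x⌋ + 1 := Int.ceil_le_floor_add_one x
  have h4 : ⌊x⌋ ≤ ⌈x⌉ := Int.floor_le_ceil x
  rw [h2]
  norm_cast
  rw [← Int.floor_lt, ← Int.lt_ceil]
  constructor <;> constructor <;> intro h <;> try omega

/-- Delays of the clocks are matched on the grid. -/
theorem ClockRel.exists_delay [Finite ι] (hD : 0 < D) (h : ClockRel D K v u) {t : ℝ}
    (ht : 0 ≤ t) : ∃ d ≤ 2 * (D * (K + 1)),
      HalfRel D K (fun i => v i + t) (fun i => 2 * u i + d) := by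
  have hD' : (0 : ℝ) < D := by exact_mod_cast hD
  rcases lt_or_ge (K : ℝ) t with htK | htK
  · -- all clocks exceed the constants
    refine ⟨_, le_rfl, fun i _ => by linarith [h.nonneg i], ?_⟩
    have hn : ∀ o ∈ active (2 * D * K) (fun i => 2 * u i + 2 * (D * (K + 1))), o = none := by
      intro o ho
      cases o with
      | none => rfl
      | some i =>
        have h1 := some_mem_active.1 ho
        have h2 : 2 * (D * (K + 1)) = 2 * D * K + 2 * D := by ring
        omega
    intro i hi j hj m
    rw [hn i hi, hn j hj]
    simp
  obtain ⟨q, hq⟩ := h.order.extend (-t)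
  have hq0 : 0 ≤ -q := by
    have h1 := (hq none (none_mem_active _ _) 0).1
    simp only [withZero_none, Int.cast_zero, zero_sub] at h1
    by_contra h2
    have := h1.2 (by linarith)
    linarith
  obtain ⟨d, hd⟩ := exists_round (x := D * -q) (by positivity)
  refine ⟨d, ?_, halfRel_of_delay hD h ht fun i hi m => ?_⟩
  · have h1 := (hq none (none_mem_active _ _) (-(K : ℤ))).2
    have h2 := (hd ((D * K : ℕ) : ℤ)).2
    simp only [withZero_none, sub_zero] at h1
    push_cast at h1 h2
    have h3 : ¬ (2 * (D * K) : ℝ) < d := by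
      rw [← h2]
      intro h4
      have h5 : (K : ℝ) < -q := lt_of_mul_lt_mul_left h4 hD'.le
      have := h1.2 (by linarith)
      linarith
    have h4 : d ≤ 2 * (D * K) := by
      rw [not_lt] at h3; exact_mod_cast h3
    nlinarith
  · have h1 := hq (some i) (some_mem_active.2 hi) m
    simp only [withZero_some] at h1
    have h2 := (hd (m * D - u i)).1
    have h3 := (hd (-(m * D) - u i)).2
    push_cast at h2 h3
    have e1 : (u i : ℝ) / D + d / (2 * D) = (2 * u i + d) / (2 * D) := by field_simp
    have e2 : (u i : ℝ) / D - q = (u i + D * -q) / D := by field_simp; ring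
    rw [e1]
    constructor
    · rw [show v i + t = v i - -t by ring, h1.1, e2, div_lt_iff₀ hD', div_lt_iff₀ (by positivity)]
      constructor <;> intro h4
      · have := h2.1 (by linarith); linarith
      · have := h2.2 (by linarith); linarith
    · rw [show -(v i + t) = -t - v i by ring, h1.2,
        show q - (u i : ℝ) / D = -((u i : ℝ) / D - q) by ring, e2, neg_lt, lt_div_iff₀ hD', neg_lt,
        lt_div_iff₀ (by positivity)]
      constructor <;> intro h4
      · have := h3.1 (by linarith); linarith
      · have := h3.2 (by linarith); linarith

/-- Delays on the grid are matched by delays of the clocks. -/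
theorem ClockRel.exists_delay_of_grid [Finite ι] (hD : 0 < D) (h : ClockRel D K v u) (d : ℕ) :
    ∃ t : ℝ, 0 ≤ t ∧ HalfRel D K (fun i => v i + t) (fun i => 2 * u i + d) := by
  have hD' : (0 : ℝ) < D := by exact_mod_cast hD
  obtain ⟨p, hp⟩ := h.order.symm.extend (-((d : ℝ) / (2 * D)))
  have hp0 : 0 ≤ -p := by
    have h1 := (hp none (none_mem_active _ _) 0).1
    simp only [withZero_none, Int.cast_zero, zero_sub] at h1
    by_contra h2
    have h3 := h1.2 (by linarith)
    have h4 : 0 ≤ (d : ℝ) / (2 * D) := by positivity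
    linarith
  refine ⟨-p, hp0, halfRel_of_delay hD h hp0 fun i hi m => ?_⟩
  have h1 := hp (some i) (some_mem_active.2 hi) m
  simp only [withZero_some] at h1
  constructor
  · rw [← sub_eq_add_neg, ← h1.1]; ring_nf
  · rw [show -(v i + -p) = p - v i by ring, ← h1.2]; ring_nf

end Regions

/-! ### Rounding to the grid -/

theorem rank_zero (l : List ℕ) : rank l 0 = 0 := rfl

theorem rank_eq_card (l : List ℕ) (x : ℕ) :
    rank l x = ((Finset.range x).filter fun y => y ∈ l).card := by
  unfold rank
  rw [← List.toFinset_card_of_nodup (List.nodup_range.filter _)]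
  congr 1
  ext y
  simp

theorem rank_lt_rank {l : List ℕ} {x y : ℕ} (hx : x ∈ l) (h : x < y) : rank l x < rank l y := by
  rw [rank_eq_card, rank_eq_card]
  refine Finset.card_lt_card ⟨fun z hz => ?_, fun hsub => ?_⟩
  · simp only [Finset.mem_filter, Finset.mem_range] at hz ⊢
    exact ⟨hz.1.trans h, hz.2⟩
  · have := hsub (Finset.mem_filter.2 ⟨Finset.mem_range.2 h, hx⟩)
    simp at this

theorem rank_lt_rank_iff {l : List ℕ} {x y : ℕ} (hx : x ∈ l) (hy : y ∈ l) :
    rank l x < rank l y ↔ x < y := by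
  refine ⟨fun h => ?_, rank_lt_rank hx⟩
  by_contra hle
  rcases (not_lt.1 hle).eq_or_lt with rfl | h'
  · exact lt_irrefl _ h
  · exact lt_asymm h (rank_lt_rank hy h')

theorem rank_lt_length {l : List ℕ} {x : ℕ} (hx : x ∈ l) : rank l x < l.length := by
  rw [rank_eq_card]
  refine lt_of_lt_of_le (Finset.card_lt_card (t := l.toFinset) ⟨fun z hz => ?_, fun hsub => ?_⟩)
    l.toFinset_card_le
  · simp only [Finset.mem_filter] at hz
    simpa using hz.2
  · have := hsub (List.mem_toFinset.2 hx)
    simp at this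

/-- Rounding to the coarser grid preserves regions. -/
theorem HalfRel.normalize {ι : Type*} {D K : ℕ} (hD : 0 < D) {v : ι → ℝ} {w : ι → ℕ}
    (h : HalfRel D K v w) {ws : List ℕ} (hws : ∀ i, w i ∈ ws) (hlen : ws.length < D) :
    ClockRel D K v (fun i => normalize D K (residues D K ws) (w i)) := by
  have hD' : (0 : ℝ) < D := by exact_mod_cast hD
  set l := residues D K ws with hl
  have hlD : l.length ≤ D := by
    have := List.length_filter_le (fun w => Nat.ble w (2 * D * K)) ws
    simp only [hl, residues, List.length_cons, List.length_map]
    omega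
  have h0l : 0 ∈ l := List.mem_cons_self
  have hres : ∀ i, w i ≤ 2 * D * K → w i % (2 * D) ∈ l := by
    intro i hi
    refine List.mem_cons_of_mem _ (List.mem_map.2 ⟨w i, List.mem_filter.2 ⟨hws i, ?_⟩, rfl⟩)
    exact ble_iff.2 hi
  have hlow : ∀ i, w i ≤ 2 * D * K → ClockedGolog.normalize D K l (w i) =
      D * (w i / (2 * D)) + rank l (w i % (2 * D)) := by
    intro i hi
    simp [ClockedGolog.normalize, ble_iff.2 hi]
  have hhigh : ∀ i, 2 * D * K < w i → ClockedGolog.normalize D K l (w i) = D * (K + 1) := by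
    intro i hi
    have : Nat.ble (w i) (2 * D * K) = false := by
      rw [← Bool.not_eq_true, ble_iff]; omega
    simp [ClockedGolog.normalize, this]
  have hle : ∀ i, w i ≤ 2 * D * K → ClockedGolog.normalize D K l (w i) ≤ D * K := by
    intro i hi
    rw [hlow i hi]
    have h1 : w i / (2 * D) ≤ K := Nat.div_le_of_le_mul hi
    have h2 := rank_lt_length (hres i hi)
    rcases h1.eq_or_lt with h3 | h3
    · have h4 : w i % (2 * D) = 0 := by
        have := Nat.div_add_mod (w i) (2 * D)
        rw [h3] at this
        omega
      rw [h4, rank_zero, h3]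
      omega
    · have h5 : D * (w i / (2 * D) + 1) ≤ D * K := Nat.mul_le_mul_left D h3
      rw [mul_add] at h5
      omega
  have hiff : ∀ i, ClockedGolog.normalize D K l (w i) ≤ D * K → w i ≤ 2 * D * K := by
    intro i hi
    by_contra h1
    rw [hhigh i (by omega), mul_add] at hi
    omega
  refine ⟨fun i hi => ?_, ?_⟩
  · have h1 : 2 * D * K < w i := by
      by_contra h1
      exact absurd (hle i (by omega)) (by omega)
    exact ⟨hhigh i h1, h.above i h1⟩
  · have hA : active (D * K) (fun i => ClockedGolog.normalize D K l (w i)) =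
        active (2 * D * K) w := by
      ext o
      cases o with
      | none => simp
      | some i => simpa using ⟨hiff i, hle i⟩
    rw [hA]
    refine h.order.trans ?_
    let a : Option ι → ℤ := fun o => o.elim 0 fun i => (w i / (2 * D) : ℕ)
    let x : Option ι → ℕ := fun o => o.elim 0 fun i => w i % (2 * D)
    have hx : ∀ o ∈ active (2 * D * K) w, x o ∈ l := by
      intro o ho
      cases o with
      | none => exact h0l
      | some i => exact hres i (some_mem_active.1 ho)
    have hx2 : ∀ o, x o < 2 * D := by
      intro o
      cases o with
      | none => exact (by omega : 0 < 2 * D)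
      | some i => exact Nat.mod_lt _ (by omega)
    have hparts := sameOrder_of_parts (A := active (2 * D * K) w) (a := a)
      (f := fun o => (x o : ℝ) / (2 * D)) (g := fun o => (rank l (x o) : ℝ) / D)
      (fun o _ => ⟨by positivity, by
        rw [div_lt_one (by positivity)]; exact_mod_cast hx2 o⟩)
      (fun o ho => ⟨by positivity, by
        rw [div_lt_one hD']; exact_mod_cast (rank_lt_length (hx o ho)).trans_le hlD⟩)
      (fun o ho o' ho' => by
        rw [div_lt_div_iff_of_pos_right (by positivity), div_lt_div_iff_of_pos_right hD',
          Nat.cast_lt, Nat.cast_lt, rank_lt_rank_iff (hx o ho) (hx o' ho')])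
    have hw : ∀ o, withZero (fun i => (w i : ℝ) / (2 * D)) o = a o + (x o : ℝ) / (2 * D) := by
      intro o
      cases o with
      | none => simp [a, x]
      | some i =>
        have h1 : (w i : ℝ) = 2 * D * (w i / (2 * D) : ℕ) + (w i % (2 * D) : ℕ) := by
          exact_mod_cast (Nat.div_add_mod (w i) (2 * D)).symm
        simp only [withZero_some, a, x, Option.elim_some, Int.cast_natCast]
        rw [h1]
        field_simp
    have hu : ∀ o ∈ active (2 * D * K) w,
        withZero (fun i => (ClockedGolog.normalize D K l (w i) : ℝ) / D) o =
          a o + (rank l (x o) : ℝ) / D := by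
      intro o ho
      cases o with
      | none => simp [a, x, rank_zero]
      | some i =>
        simp only [withZero_some, a, x, Option.elim_some, Int.cast_natCast]
        rw [hlow i (some_mem_active.1 ho)]
        push_cast
        field_simp
    intro o ho o' ho' m
    rw [hw, hw, hu o ho, hu o' ho']
    exact hparts o ho o' ho' m

/-! ### Isomorphic interpretations -/

/-- Bijections between the objects and the actions of two interpretations that preserve the rigid
symbols and the action types. -/
structure StaticIso {S : Signature} (M M' : Interp S) where
  fo : M.Obj → M'.Obj
  fa : M.Act → M'.Act
  fo_bij : Function.Bijective fo
  fa_bij : Function.Bijective fa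
  const : ∀ c, M'.const c = fo (M.const c)
  rigidFun : ∀ f o, M'.rigidFun f (fo ∘ o) = fo (M.rigidFun f o)
  rigidRel : ∀ P o, M'.rigidRel P (fo ∘ o) ↔ M.rigidRel P o
  act : ∀ A o, M'.act A (fo ∘ o) = fa (M.act A o)

namespace StaticIso

variable {S : Signature} {M M' : Interp S} (h : StaticIso M M')

/-- The situations `s` and `s'` agree on the fluents and the clocks. -/
structure AgreeAt (s : M.Sit) (s' : M'.Sit) : Prop where
  fluent : ∀ R o, M'.fluent R (h.fo ∘ o) s' ↔ M.fluent R o s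
  clock : ∀ f o, M'.clock f (h.fo ∘ o) s' = M.clock f o s

variable {h}

theorem term {n : ℕ} (e : Fin n → M.Obj) (t : Term S n) :
    M'.term (h.fo ∘ e) t = h.fo (M.term e t) := by
  induction t with
  | var i => rfl
  | const c => exact h.const c
  | app f ts ih =>
    simp only [Interp.term, ih]
    exact h.rigidFun f _

theorem actTerm {k n : ℕ} (ea : Fin k → M.Act) (e : Fin n → M.Obj) (a : ActTerm S k n) :
    M'.actTerm (h.fa ∘ ea) (h.fo ∘ e) a = h.fa (M.actTerm ea e a) := by
  cases a with
  | var i => rfl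
  | app A ts =>
    simp only [Interp.actTerm, term]
    exact h.act A _

theorem AgreeAt.sat_iff {s : M.Sit} {s' : M'.Sit} (hs : h.AgreeAt s s') {k n : ℕ}
    (φ : Formula S k n) : ∀ (ea : Fin k → M.Act) (e : Fin n → M.Obj),
    M'.Sat φ (h.fa ∘ ea) (h.fo ∘ e) s' ↔ M.Sat φ ea e s := by
  induction φ with
  | verum => intro ea e; exact Iff.rfl
  | fluent R ts =>
    intro ea e
    simp only [Interp.Sat, term]
    exact hs.fluent R _
  | rigid P ts =>
    intro ea e
    simp only [Interp.Sat, term]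
    exact h.rigidRel P _
  | objEq t u => intro ea e; simp only [Interp.Sat, term, h.fo_bij.injective.eq_iff]
  | actEq a b => intro ea e; simp only [Interp.Sat, actTerm, h.fa_bij.injective.eq_iff]
  | clockCmp f ts r v =>
    intro ea e
    simp only [Interp.Sat, term]
    rw [← hs.clock f]
    rfl
  | natCmp v r w => intro ea e; exact Iff.rfl
  | neg φ ih => intro ea e; simp only [Interp.Sat, ih]
  | and φ ψ ih ih' => intro ea e; simp only [Interp.Sat, ih, ih']
  | allObj φ ih =>
    intro ea e
    simp only [Interp.Sat]
    rw [h.fo_bij.surjective.forall]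
    refine forall_congr' fun o => ?_
    rw [← ih ea (Fin.cons o e), Fin.comp_cons]
  | allAct φ ih =>
    intro ea e
    simp only [Interp.Sat]
    rw [h.fa_bij.surjective.forall]
    refine forall_congr' fun a => ?_
    rw [← ih (Fin.cons a ea) e, Fin.comp_cons]

theorem AgreeAt.satClosed_iff {s : M.Sit} {s' : M'.Sit} (hs : h.AgreeAt s s')
    (φ : Formula S 0 0) : M'.SatClosed φ s' ↔ M.SatClosed φ s := by
  have := hs.sat_iff φ Fin.elim0 Fin.elim0
  unfold Interp.SatClosed
  rwa [Subsingleton.elim (h.fa ∘ Fin.elim0) Fin.elim0,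
    Subsingleton.elim (h.fo ∘ Fin.elim0) Fin.elim0] at this

end StaticIso

/-! ### Canonical models -/

/-- The information that determines a model whose objects are the object names. -/
structure Frame (S : Signature) where
  rigidFun : (f : S.RigidFun) → (Fin (S.rigidFuns.get f) → S.ObjName) → S.ObjName
  rigidRel : (P : S.RigidRel) → (Fin (S.rigidRels.get P) → S.ObjName) → Prop
  fluent₀ : (R : S.Fluent) → (Fin (S.fluents.get R) → S.ObjName) → Prop

/-- The values of the fluents and clocks in a situation. -/
structure FluentState (S : Signature) where
  fluent : (R : S.Fluent) → (Fin (S.fluents.get R) → S.ObjName) → Prop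
  clock : (f : S.Clock) → (Fin (S.clocks.get f) → S.ObjName) → ℝ

namespace Frame

variable {S : Signature} (fr : Frame S) (D : ClockedBAT S)

/-- The interpretation with a single situation in which the fluents and clocks have given values. -/
def snap (x : FluentState S) : Interp S where
  Obj := S.ObjName
  Act := GroundAct S
  Sit := Unit
  const := id
  rigidFun := fr.rigidFun
  rigidRel := fr.rigidRel
  act := .act
  wait := .wait
  S₀ := ()
  doAct _ _ := ()
  before _ _ := False
  poss _ _ := True
  fluent R o _ := x.fluent R o
  clock f o _ := x.clock f o

open Classical in
/-- The effect of an action according to the successor state axioms. -/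
noncomputable def next (x : FluentState S) (a : GroundAct S) : FluentState S where
  fluent R o := (fr.snap x).Sat (D.ssa R) (fun _ => a) o ()
  clock f o :=
    match a with
    | .wait t => x.clock f o + t
    | .act A ρ =>
      if (fr.snap x).Sat (D.reset f) (fun _ => GroundAct.act A ρ) o () then 0 else x.clock f o

/-- The values of the fluents and clocks after the actions in the list, the last one first. -/
noncomputable def state : List (GroundAct S) → FluentState S
  | [] => ⟨fr.fluent₀, fun _ _ => 0⟩
  | a :: l => fr.next D (state l) a

/-- The ordering of situations in the canonical model. -/
def before (s : List (GroundAct S)) : List (GroundAct S) → Prop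
  | [] => False
  | _ :: t => before s t ∨ s = t

/-- The canonical model: objects are the object names, actions are the ground actions, and
situations are the finite sequences of ground actions, the last one first. -/
noncomputable def canon : Interp S where
  Obj := S.ObjName
  Act := GroundAct S
  Sit := List (GroundAct S)
  const := id
  rigidFun := fr.rigidFun
  rigidRel := fr.rigidRel
  act := .act
  wait := .wait
  S₀ := []
  doAct := List.cons
  before := before
  poss a l :=
    match a with
    | .wait _ => True
    | .act A ρ => (fr.snap (fr.state D l)).Sat (D.pre A) Fin.elim0 ρ ()
  fluent R o l := (fr.state D l).fluent R o
  clock f o l := (fr.state D l).clock f o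

/-- The canonical model and its snapshots have the same objects and actions. -/
def snapIso (x : FluentState S) : StaticIso (fr.snap x) (fr.canon D) where
  fo := id
  fa := id
  fo_bij := Function.bijective_id
  fa_bij := Function.bijective_id
  const _ := rfl
  rigidFun _ _ := rfl
  rigidRel _ _ := Iff.rfl
  act _ _ := rfl

theorem sat_canon_iff {k n : ℕ} (φ : Formula S k n) (ea : Fin k → GroundAct S)
    (e : Fin n → S.ObjName) (l : List (GroundAct S)) :
    (fr.canon D).Sat φ ea e l ↔ (fr.snap (fr.state D l)).Sat φ ea e () :=
  StaticIso.AgreeAt.sat_iff (h := fr.snapIso D (fr.state D l)) (s := ()) (s' := l)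
    ⟨fun _ _ => Iff.rfl, fun _ _ => rfl⟩ φ ea e

theorem canon_models (hinit : ∀ φ ∈ D.init, (fr.canon D).SatClosed φ []) :
    (fr.canon D).Models D where
  foundational :=
    { doAct_inj := fun a b s t h => List.cons.inj h
      induction := fun P h0 hs s => by
        induction s with
        | nil => exact h0
        | cons a s ih => exact hs a s ih
      not_before_init := fun s h => h
      before_doAct := fun s a t => Iff.rfl }
  actions :=
    { closure := fun a => by
        cases a with
        | act A ρ => exact .inl ⟨A, ρ, rfl⟩
        | wait t => exact .inr ⟨t, rfl⟩
      act_ne := fun A B o o' h e => h (GroundAct.act.inj e).1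
      act_ne_wait := fun A o t e => GroundAct.noConfusion rfl (heq_of_eq e)
      act_inj := fun A o o' e => eq_of_heq (GroundAct.act.inj e).2
      wait_inj := fun t t' e => GroundAct.wait.inj e }
  objects :=
    { closure := fun o => ⟨o, rfl⟩
      const_ne := fun c d h => h }
  init := hinit
  clock_init := fun f o => rfl
  poss_act := fun A o s => (fr.sat_canon_iff D (D.pre A) Fin.elim0 o s).symm
  poss_wait := fun t s => Iff.rfl
  fluent_ssa := fun R o a s => (fr.sat_canon_iff D (D.ssa R) (fun _ => a) o s).symm
  clock_ssa := fun f o a s y => by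
    have hs := fr.sat_canon_iff D (D.reset f) (fun _ => a) o s
    refine Iff.trans ?_ (or_congr Iff.rfl (and_congr Iff.rfl (or_congr (and_congr hs.symm Iff.rfl)
      (and_congr (not_congr hs.symm) Iff.rfl))))
    change (fr.next D (fr.state D s) a).clock f o = y ↔ _
    cases a with
    | wait t =>
      constructor
      · rintro rfl
        exact .inl ⟨t, rfl, rfl⟩
      · rintro (⟨t', ht, rfl⟩ | ⟨hn, -⟩)
        · obtain rfl := GroundAct.wait.inj ht
          rfl
        · exact (hn ⟨t, rfl⟩).elim
    | act A ρ =>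
      have hn : ¬ ∃ t', (GroundAct.act A ρ : GroundAct S) = (fr.canon D).wait t' :=
        fun ⟨t', h⟩ => GroundAct.noConfusion rfl (heq_of_eq h)
      constructor
      · rintro rfl
        refine .inr ⟨hn, ?_⟩
        by_cases hp : (fr.snap (fr.state D s)).Sat (D.reset f) (fun _ => GroundAct.act A ρ) o ()
        · exact .inl ⟨hp, if_pos hp⟩
        · exact .inr ⟨hp, if_neg hp⟩
      · rintro (h | ⟨-, ⟨hp, rfl⟩ | ⟨hp, rfl⟩⟩)
        · exact (hn (h.imp fun _ h => h.1)).elim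
        · exact if_pos hp
        · exact if_neg hp

end Frame

/-- The model `M` has the frame `fr`. -/
structure HasFrame {S : Signature} (M : Interp S) (fr : Frame S) : Prop where
  rigidFun : ∀ f o, M.rigidFun f (M.const ∘ o) = M.const (fr.rigidFun f o)
  rigidRel : ∀ P o, M.rigidRel P (M.const ∘ o) ↔ fr.rigidRel P o
  fluent₀ : ∀ R o, M.fluent R (M.const ∘ o) M.S₀ ↔ fr.fluent₀ R o

section

variable {S : Signature} {D : ClockedBAT S} {M : Interp S}

theorem Interp.ObjectAxioms.const_bijective (h : M.ObjectAxioms) :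
    Function.Bijective M.const :=
  ⟨fun c d e => by_contra fun hne => h.const_ne c d hne e,
    fun o => (h.closure o).imp fun _ hc => hc.symm⟩

theorem Interp.ActionAxioms.groundAct_bijective (h : M.ActionAxioms) (ho : M.ObjectAxioms) :
    Function.Bijective M.groundAct := by
  constructor
  · rintro (⟨A, ρ⟩ | t) (⟨B, ρ'⟩ | t') e <;> simp only [Interp.groundAct] at e
    · by_cases hAB : A = B
      · subst hAB
        have h1 := h.act_inj _ _ _ e
        congr 1
        funext i
        exact ho.const_bijective.injective (congrFun h1 i)
      · exact (h.act_ne _ _ _ _ hAB e).elim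
    · exact (h.act_ne_wait _ _ _ e).elim
    · exact (h.act_ne_wait _ _ _ e.symm).elim
    · rw [h.wait_inj _ _ e]
  · intro a
    rcases h.closure a with ⟨A, o, rfl⟩ | ⟨t, rfl⟩
    · choose c hc using fun i => ho.closure (o i)
      exact ⟨.act A c, congrArg (M.act A) (funext fun i => (hc i).symm)⟩
    · exact ⟨.wait t, rfl⟩

variable {fr : Frame S}

/-- The isomorphism of the objects and actions of the canonical model with those of a model. -/
def HasFrame.iso (hf : HasFrame M fr) (hM : M.Models D) : StaticIso (fr.canon D) M where
  fo := M.const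
  fa := M.groundAct
  fo_bij := hM.objects.const_bijective
  fa_bij := hM.actions.groundAct_bijective hM.objects
  const _ := rfl
  rigidFun := hf.rigidFun
  rigidRel := hf.rigidRel
  act _ _ := rfl

/-- The situation of `M` reached by the actions in the list, the last one first. -/
def sitOf (M : Interp S) (l : List (GroundAct S)) : M.Sit :=
  l.foldr (fun α s => M.doAct (M.groundAct α) s) M.S₀

theorem groundSit_reverse (l : List (GroundAct S)) : M.groundSit l.reverse = sitOf M l := by
  simp [Interp.groundSit, sitOf, List.foldl_reverse]

theorem HasFrame.agreeAt_init (hf : HasFrame M fr) (hM : M.Models D) :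
    (hf.iso hM).AgreeAt [] M.S₀ :=
  ⟨hf.fluent₀, fun f _ => hM.clock_init f _⟩

/-- A model agrees with the canonical model for its frame in all situations. -/
theorem HasFrame.agreeAt (hf : HasFrame M fr) (hM : M.Models D)
    (hC : (fr.canon D).Models D) (l : List (GroundAct S)) :
    (hf.iso hM).AgreeAt l (sitOf M l) := by
  induction l with
  | nil => exact hf.agreeAt_init hM
  | cons a l ih =>
    refine ⟨fun R o => ?_, fun f o => ?_⟩
    · exact (hM.fluent_ssa R _ _ _).trans
        ((ih.sat_iff (D.ssa R) (fun _ => a) o).trans (hC.fluent_ssa R o a l).symm)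
    · refine (hM.clock_ssa f _ _ _ _).2 ?_
      have h1 := (hC.clock_ssa f o a l _).1 rfl
      have h2 := ih.sat_iff (D.reset f) (fun _ => a) o
      have h3 := ih.clock f o
      have h4 : ∀ t, a = .wait t ↔ M.groundAct a = M.wait t := fun t =>
        ((hf.iso hM).fa_bij.injective.eq_iff (a := a) (b := GroundAct.wait t)).symm
      rcases h1 with ⟨t, ha, hy⟩ | ⟨hn, h1⟩
      · exact .inl ⟨t, (h4 t).1 ha, hy.trans (congrArg (· + (t : ℝ)) h3.symm)⟩
      · refine .inr ⟨fun ⟨t, ht⟩ => hn ⟨t, (h4 t).2 ht⟩, ?_⟩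
        rcases h1 with ⟨h5, h6⟩ | ⟨h5, h6⟩
        · exact .inl ⟨h2.2 h5, h6⟩
        · exact .inr ⟨fun h7 => h5 (h2.1 h7), h6.trans h3.symm⟩

theorem HasFrame.final (hf : HasFrame M fr) (hM : M.Models D) (hC : (fr.canon D).Models D)
    {δ : Prog S 0} {l : (fr.canon D).Sit} (h : Final (fr.canon D) δ l) :
    Final M δ (sitOf M l) := by
  induction h with
  | @test φ l h => exact .test (((hf.agreeAt hM hC l).satClosed_iff φ).2 h)
  | seq _ _ ih ih' => exact .seq ih ih'
  | choice_left _ ih => exact .choice_left ih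
  | choice_right _ ih => exact .choice_right ih
  | pick c _ ih => exact .pick c ih
  | star => exact .star
  | conc _ _ ih ih' => exact .conc ih ih'

theorem HasFrame.trans (hf : HasFrame M fr) (hM : M.Models D) (hC : (fr.canon D).Models D)
    {δ δ' : Prog S 0} {l l' : (fr.canon D).Sit} {a : (fr.canon D).Act}
    (h : Trans (fr.canon D) δ l a δ' l') :
    Trans M δ (sitOf M l) (M.groundAct a) δ' (sitOf M l') := by
  induction h with
  | @act A ts l hp =>
    have ht : ∀ i, M.term Fin.elim0 (ts i) = M.const ((fr.canon D).term Fin.elim0 (ts i)) := by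
      intro i
      have := StaticIso.term (h := hf.iso hM) Fin.elim0 (ts i)
      rwa [Subsingleton.elim ((hf.iso hM).fo ∘ Fin.elim0) Fin.elim0] at this
    have he : M.groundAct (.act A fun i => (fr.canon D).term Fin.elim0 (ts i)) =
        M.act A (fun i => M.term Fin.elim0 (ts i)) :=
      congrArg (M.act A) (funext fun i => (ht i).symm)
    have hp' : M.poss (M.act A (fun i => M.term Fin.elim0 (ts i))) (sitOf M l) := by
      rw [← he]
      refine (hM.poss_act A _ _).2 ?_
      have h1 := (hf.agreeAt hM hC l).sat_iff (D.pre A) Fin.elim0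
        (fun i => (fr.canon D).term Fin.elim0 (ts i))
      rw [Subsingleton.elim ((hf.iso hM).fa ∘ Fin.elim0) Fin.elim0] at h1
      exact h1.2 ((hC.poss_act A _ _).1 hp)
    have h2 := Trans.act (M := M) hp'
    change Trans M _ _ (M.groundAct (.act A fun i => (fr.canon D).term Fin.elim0 (ts i))) _
      (M.doAct (M.groundAct (.act A fun i => (fr.canon D).term Fin.elim0 (ts i))) _)
    rw [he]
    exact h2
  | wait t => exact .wait t
  | seq_left _ ih => exact .seq_left ih
  | seq_right h _ ih => exact .seq_right (hf.final hM hC h) ih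
  | choice_left _ ih => exact .choice_left ih
  | choice_right _ ih => exact .choice_right ih
  | pick c _ ih => exact .pick c ih
  | star _ ih => exact .star ih
  | conc_left _ ih => exact .conc_left ih
  | conc_right _ ih => exact .conc_right ih

theorem HasFrame.transStar (hf : HasFrame M fr) (hM : M.Models D) (hC : (fr.canon D).Models D)
    {δ δ' : Prog S 0} {l l' : (fr.canon D).Sit} {α : List (fr.canon D).Act}
    (h : TransStar (fr.canon D) δ l α δ' l') :
    TransStar M δ (sitOf M l) (List.map M.groundAct α) δ' (sitOf M l') := by
  induction h with
  | refl => exact .refl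
  | step h _ ih => exact .step (hf.trans hM hC h) ih

theorem Interp.Models.exists_frame (hM : M.Models D) : ∃ fr, HasFrame M fr := by
  choose g hg using fun f o => hM.objects.closure (M.rigidFun f (M.const ∘ o))
  exact ⟨⟨g, fun P o => M.rigidRel P (M.const ∘ o), fun R o => M.fluent R (M.const ∘ o) M.S₀⟩,
    hg, fun _ _ => Iff.rfl, fun _ _ => Iff.rfl⟩

theorem HasFrame.canon_models (hf : HasFrame M fr) (hM : M.Models D) :
    (fr.canon D).Models D :=
  fr.canon_models D fun φ hφ => ((hf.agreeAt_init hM).satClosed_iff φ).1 (hM.init φ hφ)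

/-- By complete information, all models have the same frame. -/
theorem ClockedBAT.CompleteInfo.hasFrame (hc : D.CompleteInfo) (hC : (fr.canon D).Models D)
    (hM : M.Models D) : HasFrame M fr := by
  have key : ∀ φ : Formula S 0 0, φ.IsAtomic →
      (M.SatClosed φ M.S₀ ↔ (fr.canon D).SatClosed φ []) := by
    intro φ hφ
    rcases hc φ hφ with h | h
    · exact ⟨fun _ => h _ hC, fun _ => h _ hM⟩
    · exact ⟨fun h' => (h _ hM h').elim, fun h' => (h _ hC h').elim⟩
  refine ⟨fun f o => ?_, fun P o => ?_, fun R o => ?_⟩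
  · exact (key (.objEq (.app f fun i => .const (o i)) (.const (fr.rigidFun f o))) trivial).2 rfl
  · exact key (.rigid P fun i => .const (o i)) trivial
  · exact key (.fluent R fun i => .const (o i)) trivial

end

/-- Realizations are the successful runs in the canonical model of a frame for which the axioms
about the initial situation hold; if there is none, then the theory is inconsistent. -/
theorem ClockedProgram.hasRealization_iff (Δ : ClockedProgram) : Δ.HasRealization ↔
    (∀ fr : Frame Δ.sig, ¬ ∀ φ ∈ Δ.bat.init, (fr.canon Δ.bat).SatClosed φ []) ∨
    ∃ fr : Frame Δ.sig, (∀ φ ∈ Δ.bat.init, (fr.canon Δ.bat).SatClosed φ []) ∧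
      ∃ α δ' l, TransStar (fr.canon Δ.bat) Δ.prog [] α δ' l ∧ Final (fr.canon Δ.bat) δ' l := by
  constructor
  · rintro ⟨α, δ', σ', h⟩
    by_cases hfr : ∃ fr : Frame Δ.sig, ∀ φ ∈ Δ.bat.init, (fr.canon Δ.bat).SatClosed φ []
    · obtain ⟨fr, hfr⟩ := hfr
      obtain ⟨h1, h2⟩ := h _ (fr.canon_models Δ.bat hfr)
      exact .inr ⟨fr, hfr, _, _, _, h1, h2⟩
    · exact .inl (not_exists.1 hfr)
  · rintro (h | ⟨fr, hfr, α, δ', l, h1, h2⟩)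
    · refine ⟨[], Δ.prog, [], fun M hM => ?_⟩
      obtain ⟨fr, hf⟩ := hM.exists_frame
      exact (h fr (hf.canon_models hM).init).elim
    · refine ⟨α, δ', List.reverse l, fun M hM => ?_⟩
      have hC := fr.canon_models Δ.bat hfr
      have hf := Δ.completeInfo.hasFrame hC hM
      have hl := groundSit_reverse (M := M) l
      exact hl ▸ ⟨hf.transStar hM hC h1, hf.final hM hC h2⟩

/-! ### Substitution -/

section Subst

variable {S : Signature}

theorem Term.subst_subst {n m p : ℕ} (σ : Fin n → Term S m) (τ : Fin m → Term S p)
    (t : Term S n) : (t.subst σ).subst τ = t.subst fun i => (σ i).subst τ := by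
  induction t with
  | var i => rfl
  | const c => rfl
  | app f ts ih => simp only [Term.subst, ih]

theorem Term.subst_var {n : ℕ} (t : Term S n) : t.subst .var = t := by
  induction t with
  | var i => rfl
  | const c => rfl
  | app f ts ih => simp only [Term.subst, ih]

theorem liftSubst_subst {n m p : ℕ} (σ : Fin n → Term S m) (τ : Fin m → Term S p) :
    (fun i => (liftSubst σ i).subst (liftSubst τ)) = liftSubst fun i => (σ i).subst τ := by
  funext i
  refine Fin.cases rfl (fun i => ?_) i
  simp only [liftSubst, Fin.cons_succ, Term.subst_subst, Term.subst]

theorem liftSubst_var {n : ℕ} : liftSubst (.var : Fin n → Term S n) = .var := by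
  funext i
  exact Fin.cases rfl (fun i => rfl) i

theorem ActTerm.subst_subst {k n m p : ℕ} (σ : Fin n → Term S m) (τ : Fin m → Term S p)
    (a : ActTerm S k n) : (a.subst σ).subst τ = a.subst fun i => (σ i).subst τ := by
  cases a <;> simp only [ActTerm.subst, Term.subst_subst]

theorem ActTerm.subst_var {k n : ℕ} (a : ActTerm S k n) : a.subst .var = a := by
  cases a <;> simp only [ActTerm.subst, Term.subst_var]

theorem Formula.subst_subst {k n : ℕ} (φ : Formula S k n) : ∀ {m p : ℕ} (σ : Fin n → Term S m)
    (τ : Fin m → Term S p), (φ.subst σ).subst τ = φ.subst fun i => (σ i).subst τ := by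
  induction φ <;> intro m p σ τ <;>
    simp_all only [Formula.subst, Term.subst_subst, ActTerm.subst_subst, liftSubst_subst]

theorem Formula.subst_var {k n : ℕ} (φ : Formula S k n) : φ.subst .var = φ := by
  induction φ <;> simp_all only [Formula.subst, Term.subst_var, ActTerm.subst_var, liftSubst_var]

theorem Prog.subst_subst {n : ℕ} (δ : Prog S n) : ∀ {m p : ℕ} (σ : Fin n → Term S m)
    (τ : Fin m → Term S p), (δ.subst σ).subst τ = δ.subst fun i => (σ i).subst τ := by
  induction δ <;> intro m p σ τ <;>
    simp_all only [Prog.subst, Term.subst_subst, Formula.subst_subst, liftSubst_subst]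

theorem Prog.subst_var {n : ℕ} (δ : Prog S n) : δ.subst .var = δ := by
  induction δ <;> simp_all only [Prog.subst, Term.subst_var, Formula.subst_var, liftSubst_var]

/-- The program `δ` in the environment `e`. -/
def Prog.close {m : ℕ} (δ : Prog S m) (e : Fin m → S.ObjName) : Prog S 0 :=
  δ.subst fun i => .const (e i)

theorem Prog.inst_close {m : ℕ} (δ : Prog S (m + 1)) (e : Fin m → S.ObjName) (c : S.ObjName) :
    (δ.subst (liftSubst fun i => .const (e i))).inst c = δ.close (Fin.cons c e) := by
  rw [Prog.inst, Prog.subst_subst, Prog.close]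
  congr 1
  funext i
  exact Fin.cases rfl (fun i => rfl) i

theorem Interp.term_subst (M : Interp S) {n m : ℕ} (e : Fin m → M.Obj) (σ : Fin n → Term S m)
    (t : Term S n) : M.term e (t.subst σ) = M.term (fun i => M.term e (σ i)) t := by
  induction t with
  | var i => rfl
  | const c => rfl
  | app f ts ih => simp only [Term.subst, Interp.term, ih]

theorem Interp.term_liftSubst (M : Interp S) {n m : ℕ} (o : M.Obj) (e : Fin m → M.Obj)
    (σ : Fin n → Term S m) : (fun i => M.term (Fin.cons o e : Fin (m + 1) → M.Obj) (liftSubst σ i))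
      = Fin.cons o fun i => M.term e (σ i) := by
  funext i
  refine Fin.cases rfl (fun i => ?_) i
  simp only [liftSubst, Fin.cons_succ, Interp.term_subst, Interp.term]

theorem Interp.sat_subst (M : Interp S) (s : M.Sit) {k n : ℕ} (φ : Formula S k n) :
    ∀ {m : ℕ} (σ : Fin n → Term S m) (ea : Fin k → M.Act) (e : Fin m → M.Obj),
      M.Sat (φ.subst σ) ea e s ↔ M.Sat φ ea (fun i => M.term e (σ i)) s := by
  have hact : ∀ {k n m : ℕ} (σ : Fin n → Term S m) (ea : Fin k → M.Act) (e : Fin m → M.Obj)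
      (a : ActTerm S k n), M.actTerm ea e (a.subst σ) =
        M.actTerm ea (fun i => M.term e (σ i)) a := by
    intro k n m σ ea e a
    cases a <;> simp only [ActTerm.subst, Interp.actTerm, Interp.term_subst]
  induction φ <;> intro m σ ea e <;>
    simp_all only [Formula.subst, Interp.Sat, Interp.term_subst, Interp.term_liftSubst]

end Subst

/-! ### Correctness of the evaluation -/

/-- The list of the numbers of the objects in a tuple. -/
def vals {N m : ℕ} (o : Fin m → Fin N) : List ℕ := List.ofFn fun i => (o i : ℕ)

theorem vals_injective {N m : ℕ} : Function.Injective (vals : (Fin m → Fin N) → List ℕ) := by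
  intro o o' h
  funext i
  exact Fin.ext (congrFun (List.ofFn_injective h) i)

theorem vals_cons {N m : ℕ} (c : Fin N) (o : Fin m → Fin N) :
    vals (Fin.cons c o : Fin (m + 1) → Fin N) = (c : ℕ) :: vals o := by
  simp [vals, List.ofFn_succ]

theorem getI_ofFn {α : Type*} [Inhabited α] {m : ℕ} (g : Fin m → α) (i : Fin m) :
    (List.ofFn g).getI i = g i := by
  rw [List.getI_eq_getElem _ (by simp), List.getElem_ofFn]

theorem mem_tuples {N k : ℕ} {l : List ℕ} :
    l ∈ tuples N k ↔ l.length = k ∧ ∀ x ∈ l, x < N := by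
  induction k generalizing l with
  | zero => simp +contextual [tuples, List.length_eq_zero_iff]
  | succ k ih =>
    have : tuples N (k + 1) =
      (tuples N k).flatMap fun l => (List.range N).map fun x => x :: l := rfl
    rw [this]
    cases l with
    | nil => simp
    | cons a l =>
      simp only [List.mem_flatMap, List.mem_map, List.mem_range, List.cons.injEq, ih,
        List.length_cons, Nat.add_right_cancel_iff, List.mem_cons, forall_eq_or_imp]
      constructor
      · rintro ⟨l, ⟨h1, h2⟩, _, h3, rfl, rfl⟩; exact ⟨h1, h3, h2⟩
      · rintro ⟨h1, h3, h2⟩; exact ⟨l, ⟨h1, h2⟩, a, h3, rfl, rfl⟩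

theorem mem_tuples_iff {N k : ℕ} {l : List ℕ} :
    l ∈ tuples N k ↔ ∃ o : Fin k → Fin N, l = vals o := by
  rw [mem_tuples]
  constructor
  · rintro ⟨rfl, h⟩
    exact ⟨fun i => ⟨l[i], h _ (List.getElem_mem _)⟩, by simp [vals]⟩
  · rintro ⟨o, rfl⟩
    refine ⟨by simp [vals], fun x hx => ?_⟩
    obtain ⟨i, rfl⟩ := (List.mem_ofFn' _ _).1 hx
    exact (o i).2

theorem mem_atoms_iff {n kind N : ℕ} {ar : List ℕ} (har : arities n kind = ar)
    (hN : numObj n = N) {a : Atom} : a ∈ atoms n kind ↔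
      ∃ (s : Fin ar.length) (o : Fin (ar.get s) → Fin N), a = (kind, (s : ℕ), vals o) := by
  subst har hN
  simp only [atoms, List.mem_flatMap, List.mem_map, List.mem_range, mem_tuples_iff]
  constructor
  · rintro ⟨s, hs, l, ⟨o, rfl⟩, rfl⟩
    have h : (arities n kind).getI s = (arities n kind).get ⟨s, hs⟩ :=
      List.getI_eq_getElem _ hs
    refine ⟨⟨s, hs⟩, fun i => o (i.cast h.symm), ?_⟩
    simp only [vals, Prod.mk.injEq, true_and]
    exact List.ofFn_congr h _
  · rintro ⟨s, o, rfl⟩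
    have h : (arities n kind).getI s = (arities n kind).get s := List.getI_eq_getElem _ s.2
    refine ⟨s, s.2, _, ⟨fun i => o (i.cast h), rfl⟩, ?_⟩
    simp only [vals, Prod.mk.injEq, true_and]
    exact List.ofFn_congr h _

theorem item_encode (l : List ℕ) (i : ℕ) : item (Encodable.encode l) i = l.getI i := by
  rw [item, seqOf_encode]

theorem item_le (c i : ℕ) : item c i ≤ c := by
  unfold item
  rcases lt_or_ge i (seqOf c).length with h | h
  · rw [List.getI_eq_getElem _ h]
    exact (lt_of_mem_seqOf (List.getElem_mem h)).le
  · rw [List.getI_eq_default _ h]; exact Nat.zero_le _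

theorem axioms_getI_le (n kind i : ℕ) : (axioms n kind).getI i ≤ n :=
  (item_le (item (item n 1) kind) i).trans ((item_le _ _).trans (item_le _ _))

section Codes

variable (Δ : ClockedProgram)

theorem item_sig (i : ℕ) : item (item Δ.code 0) i =
    [Δ.sig.numObj, Encodable.encode Δ.sig.acts, Encodable.encode Δ.sig.fluents,
      Encodable.encode Δ.sig.clocks, Encodable.encode Δ.sig.rigidRels,
      Encodable.encode Δ.sig.rigidFuns].getI i := by
  have : item Δ.code 0 = Δ.sig.code := item_encode _ _
  rw [this]
  exact item_encode _ _

theorem item_bat (i : ℕ) : item (item Δ.code 1) i =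
    [Encodable.encode (Δ.bat.init.map Formula.code), codeSeq fun A => (Δ.bat.pre A).code,
      codeSeq fun R => (Δ.bat.ssa R).code, codeSeq fun f => (Δ.bat.reset f).code].getI i := by
  have : item Δ.code 1 = Δ.bat.code := item_encode _ _
  rw [this]
  exact item_encode _ _

theorem numObj_code : numObj Δ.code = Δ.sig.numObj := item_sig Δ 0

theorem arities_acts : arities Δ.code 1 = Δ.sig.acts := by
  rw [arities, item_sig]; exact seqOf_encode _

theorem arities_fluents : arities Δ.code 2 = Δ.sig.fluents := by
  rw [arities, item_sig]; exact seqOf_encode _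

theorem arities_clocks : arities Δ.code 3 = Δ.sig.clocks := by
  rw [arities, item_sig]; exact seqOf_encode _

theorem arities_rigidRels : arities Δ.code 4 = Δ.sig.rigidRels := by
  rw [arities, item_sig]; exact seqOf_encode _

theorem arities_rigidFuns : arities Δ.code 5 = Δ.sig.rigidFuns := by
  rw [arities, item_sig]; exact seqOf_encode _

theorem axioms_init : axioms Δ.code 0 = Δ.bat.init.map Formula.code := by
  rw [axioms, item_bat]; exact seqOf_encode _

theorem axioms_pre (A : Δ.sig.ActType) : (axioms Δ.code 1).getI A = (Δ.bat.pre A).code := by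
  have : axioms Δ.code 1 = List.ofFn fun A => (Δ.bat.pre A).code := by
    rw [axioms, item_bat]; exact seqOf_codeSeq _
  rw [this, getI_ofFn]

theorem axioms_ssa (R : Δ.sig.Fluent) : (axioms Δ.code 2).getI R = (Δ.bat.ssa R).code := by
  have : axioms Δ.code 2 = List.ofFn fun R => (Δ.bat.ssa R).code := by
    rw [axioms, item_bat]; exact seqOf_codeSeq _
  rw [this, getI_ofFn]

theorem axioms_reset (f : Δ.sig.Clock) : (axioms Δ.code 3).getI f = (Δ.bat.reset f).code := by
  have : axioms Δ.code 3 = List.ofFn fun f => (Δ.bat.reset f).code := by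
    rw [axioms, item_bat]; exact seqOf_codeSeq _
  rw [this, getI_ofFn]

theorem item_prog : item Δ.code 2 = Δ.prog.code := item_encode _ _

theorem code_pos : 0 < Δ.code := by
  simp [ClockedProgram.code, Encodable.encode_list_cons]

theorem gridSize_pos (n : ℕ) : 0 < gridSize n := Nat.succ_pos _

theorem two_le_storeBound : 2 ≤ storeBound Δ.code := by
  have h1 := code_pos Δ
  have h2 := gridSize_pos Δ.code
  have : 1 * 2 ≤ gridSize Δ.code * (Δ.code + 1) := Nat.mul_le_mul h2 (by omega)
  unfold storeBound cap
  omega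

end Codes

variable {Δ : ClockedProgram} {fr : Frame Δ.sig} {x : FluentState Δ.sig} {st : Store}

/-- The store `st` describes the rigid symbols of `fr` and the state `x` up to region equivalence
of the clocks. -/
structure Describes (Δ : ClockedProgram) (fr : Frame Δ.sig) (x : FluentState Δ.sig)
    (st : Store) : Prop where
  rigidFun : ∀ (f : Δ.sig.RigidFun) o, look st (5, (f : ℕ), vals o) = fr.rigidFun f o
  rigidRel : ∀ (P : Δ.sig.RigidRel) o, look st (4, (P : ℕ), vals o) = 1 ↔ fr.rigidRel P o
  fluent : ∀ (R : Δ.sig.Fluent) o, look st (2, (R : ℕ), vals o) = 1 ↔ x.fluent R o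
  clock : ClockRel (gridSize Δ.code) Δ.code
    (fun i : (f : Δ.sig.Clock) × (Fin (Δ.sig.clocks.get f) → Δ.sig.ObjName) => x.clock i.1 i.2)
    (fun i => look st (3, (i.1 : ℕ), vals i.2))

/-- An environment `ea` of actions and its abstraction `eb`. Waiting actions are abstracted to
numbers below the length of the environment, and only equality between them is retained. -/
structure ActEnv {S : Signature} {k : ℕ} (ea : Fin k → GroundAct S) (eb : List Atom) : Prop where
  length : eb.length = k
  act : ∀ i A ρ, ea i = .act A ρ ↔ eb.getI i = (1, (A : ℕ), vals ρ)
  eq : ∀ i j, ea i = ea j ↔ eb.getI i = eb.getI j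
  wait : ∀ i t, ea i = .wait t → ∃ j < k, eb.getI i = (0, j, [])

theorem act_eq_act_iff {S : Signature} {A B : S.ActType} {ρ : Fin (S.acts.get A) → S.ObjName}
    {ρ' : Fin (S.acts.get B) → S.ObjName} : GroundAct.act A ρ = GroundAct.act B ρ' ↔
      ((1, (A : ℕ), vals ρ) : Atom) = (1, (B : ℕ), vals ρ') := by
  constructor
  · intro h
    obtain ⟨rfl, h⟩ := GroundAct.act.inj h
    rw [eq_of_heq h]
  · intro h
    simp only [Prod.mk.injEq, true_and] at h
    obtain ⟨h1, h2⟩ := h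
    obtain rfl := Fin.ext h1
    rw [vals_injective h2]

theorem ActEnv.cons {S : Signature} {k : ℕ} {ea : Fin k → GroundAct S} {eb : List Atom}
    (h : ActEnv ea eb) {a : GroundAct S} {b : Atom}
    (h1 : ∀ A ρ, a = .act A ρ ↔ b = (1, (A : ℕ), vals ρ))
    (h2 : ∀ i : Fin k, a = ea i ↔ b = eb.getI i)
    (h3 : ∀ t, a = .wait t → ∃ j < k + 1, b = (0, j, [])) :
    ActEnv (Fin.cons a ea : Fin (k + 1) → GroundAct S) (b :: eb) where
  length := by simp [h.length]
  act i := by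
    refine Fin.cases ?_ (fun i => ?_) i
    · simpa using h1
    · simpa using h.act i
  eq i j := by
    refine Fin.cases ?_ (fun i => ?_) i <;> refine Fin.cases ?_ (fun j => ?_) j
    · simp
    · simpa using h2 j
    · simpa [eq_comm] using h2 i
    · simpa using h.eq i j
  wait i := by
    refine Fin.cases ?_ (fun i => ?_) i
    · simpa using h3
    · intro t ht
      obtain ⟨j, hj, hb⟩ := h.wait i t (by simpa using ht)
      exact ⟨j, by omega, by simpa using hb⟩

theorem ActEnv.nil {S : Signature} (ea : Fin 0 → GroundAct S) : ActEnv ea [] :=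
  ⟨rfl, fun i => i.elim0, fun i => i.elim0, fun i => i.elim0⟩

/-- Every action has an abstraction. -/
theorem ActEnv.exists_abstract {k : ℕ} {ea : Fin k → GroundAct Δ.sig} {eb : List Atom}
    (h : ActEnv ea eb) (a : GroundAct Δ.sig) : ∃ b ∈ actDomain Δ.code k,
      ActEnv (Fin.cons a ea : Fin (k + 1) → GroundAct Δ.sig) (b :: eb) := by
  cases a with
  | act A ρ =>
    refine ⟨(1, (A : ℕ), vals ρ), List.mem_append_left _
      ((mem_atoms_iff (arities_acts Δ) (numObj_code Δ)).2 ⟨A, ρ, rfl⟩), h.cons ?_ ?_ ?_⟩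
    · exact fun B ρ' => act_eq_act_iff
    · exact fun i => eq_comm.trans ((h.act i A ρ).trans eq_comm)
    · intro t ht
      cases ht
  | wait t =>
    by_cases ht : ∃ i, ea i = .wait t
    · obtain ⟨i, hi⟩ := ht
      obtain ⟨j, hj, hb⟩ := h.wait i t hi
      refine ⟨eb.getI i, List.mem_append_right _ (List.mem_map.2 ⟨j, ?_, hb.symm⟩),
        hi ▸ h.cons (h.act i) (h.eq i) fun _ _ => ⟨j, by omega, hb⟩⟩
      exact List.mem_range.2 (by omega)
    · -- the number `k` is not in use
      refine ⟨(0, k, []), List.mem_append_right _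
        (List.mem_map.2 ⟨k, List.mem_range.2 (by omega), rfl⟩),
        h.cons (fun A ρ => by simp) (fun i => ?_) fun _ _ => ⟨k, by omega, rfl⟩⟩
      refine ⟨fun e => (ht ⟨i, e.symm⟩).elim, fun e => ?_⟩
      cases ha : ea i with
      | act A ρ => rw [(h.act i A ρ).1 ha] at e; simp at e
      | wait t' =>
        obtain ⟨j, hj, hb⟩ := h.wait i t' ha
        rw [hb] at e
        simp only [Prod.mk.injEq, and_true, true_and] at e
        omega

/-- Every abstract action is the abstraction of an action. -/
theorem ActEnv.exists_concrete {k : ℕ} {ea : Fin k → GroundAct Δ.sig} {eb : List Atom}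
    (h : ActEnv ea eb) {b : Atom} (hb : b ∈ actDomain Δ.code k) : ∃ a,
      ActEnv (Fin.cons a ea : Fin (k + 1) → GroundAct Δ.sig) (b :: eb) := by
  by_cases hi : ∃ i : Fin k, eb.getI i = b
  · obtain ⟨i, rfl⟩ := hi
    refine ⟨ea i, h.cons (h.act i) (h.eq i) fun t ht => ?_⟩
    obtain ⟨j, hj, hb⟩ := h.wait i t ht
    exact ⟨j, by omega, hb⟩
  push Not at hi
  rcases List.mem_append.1 hb with hb | hb
  · obtain ⟨A, ρ, rfl⟩ := (mem_atoms_iff (arities_acts Δ) (numObj_code Δ)).1 hb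
    refine ⟨.act A ρ, h.cons (fun B ρ' => act_eq_act_iff)
      (fun i => eq_comm.trans ((h.act i A ρ).trans eq_comm)) fun t ht => ?_⟩
    cases ht
  · obtain ⟨j, hj, rfl⟩ := List.mem_map.1 hb
    -- a duration that does not occur in the environment
    obtain ⟨t, ht⟩ := Infinite.exists_notMem_finset
      (Finset.univ.image fun i => match ea i with | .wait t => t | .act _ _ => 0)
    refine ⟨.wait t, h.cons (fun A ρ => by simp) (fun i => ?_)
      fun _ _ => ⟨j, List.mem_range.1 hj, rfl⟩⟩
    refine ⟨fun e => (ht ?_).elim, fun e => (hi i e.symm).elim⟩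
    exact Finset.mem_image.2 ⟨i, Finset.mem_univ _, by rw [← e]⟩

theorem Describes.evalT_eq (h : Describes Δ fr x st) {m : ℕ} (e : Fin m → Δ.sig.ObjName)
    (t : Term Δ.sig m) :
    evalT st (vals e) t.code = ((fr.snap x).term e t : Δ.sig.ObjName).val := by
  induction t with
  | var i =>
    rw [ClockedGolog.evalT_eq]
    simp only [Term.code, tag_pair, body_pair, BEq.rfl, cond_true]
    exact getI_ofFn _ i
  | const c =>
    rw [ClockedGolog.evalT_eq]
    simp [Term.code, Interp.term, Frame.snap]
  | app f ts ih =>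
    rw [ClockedGolog.evalT_eq]
    simp only [Term.code, tag_pair, lft_pair, rgt_pair, Nat.reduceBEq, BEq.rfl, cond_true,
      cond_false, seqOf_codeSeq, List.map_ofFn, Function.comp_def, ih]
    exact h.rigidFun f _

theorem Describes.evalTs_eq (h : Describes Δ fr x st) {m p : ℕ} (e : Fin m → Δ.sig.ObjName)
    (ts : Fin p → Term Δ.sig m) : evalTs st (vals e) (codeSeq fun i => (ts i).code) =
      vals (N := Δ.sig.numObj) fun i => (fr.snap x).term e (ts i) := by
  simp only [evalTs, seqOf_codeSeq, List.map_ofFn, Function.comp_def, h.evalT_eq]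
  rfl

theorem Describes.actTerm_eq_iff (h : Describes Δ fr x st) {k m : ℕ}
    {ea : Fin k → GroundAct Δ.sig} {eb : List Atom} (hea : ActEnv ea eb)
    (e : Fin m → Δ.sig.ObjName) (a b : ActTerm Δ.sig k m) :
    (fr.snap x).actTerm ea e a = (fr.snap x).actTerm ea e b ↔
      evalA st eb (vals e) a.code = evalA st eb (vals e) b.code := by
  have hvar : ∀ i : Fin k, evalA st eb (vals e) (ActTerm.var (S := Δ.sig) (n := m) i).code =
      eb.getI i := fun i => by simp [evalA, ActTerm.code]
  have happ : ∀ A ts, evalA st eb (vals e) (ActTerm.app (S := Δ.sig) (k := k) (n := m) A ts).code =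
      (1, (A : ℕ), vals (N := Δ.sig.numObj) fun i => (fr.snap x).term e (ts i)) := fun A ts => by
    simp only [evalA, ActTerm.code, tag_pair, Nat.reduceBEq, cond_false, lft_pair, rgt_pair]
    rw [h.evalTs_eq]
  cases a with
  | var i =>
    cases b with
    | var j => rw [hvar, hvar]; exact hea.eq i j
    | app B us => rw [hvar, happ]; exact hea.act i B _
  | app A ts =>
    cases b with
    | var j => rw [hvar, happ]; exact eq_comm.trans ((hea.act j A _).trans eq_comm)
    | app B us => rw [happ, happ]; exact act_eq_act_iff

theorem le_pair_right {a b c : ℕ} (h : c ≤ b) : c ≤ Nat.pair a b := h.trans (Nat.right_le_pair a b)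

/-- The evaluation on codes computes the truth values of formulas. -/
theorem Describes.evalF_iff (h : Describes Δ fr x st) {k m : ℕ} (φ : Formula Δ.sig k m) :
    ∀ {ea : Fin k → GroundAct Δ.sig} {eb : List Atom} (_ : ActEnv ea eb)
      (e : Fin m → Δ.sig.ObjName) (_ : φ.code ≤ Δ.code),
      evalF Δ.code st eb (vals e) φ.code = true ↔ (fr.snap x).Sat φ ea e () := by
  induction φ with
  | verum => intro ea eb hea e hφ; rw [evalF_eq]; simp [Formula.code, combF, subF, Interp.Sat]
  | fluent R ts =>
    intro ea eb hea e hφ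
    rw [evalF_eq]
    simp only [Formula.code, combF, tag_pair, lft_pair, rgt_pair, BEq.rfl, cond_true,
      h.evalTs_eq, beq_iff_eq]
    exact h.fluent R _
  | rigid P ts =>
    intro ea eb hea e hφ
    rw [evalF_eq]
    simp only [Formula.code, combF, tag_pair, lft_pair, rgt_pair, BEq.rfl, Nat.reduceBEq,
      cond_true, cond_false, h.evalTs_eq, beq_iff_eq]
    exact h.rigidRel P _
  | objEq t u =>
    intro ea eb hea e hφ
    rw [evalF_eq]
    simp only [Formula.code, combF, tag_pair, lft_pair, rgt_pair, BEq.rfl, Nat.reduceBEq,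
      cond_true, cond_false, h.evalT_eq, beq_iff_eq]
    exact Fin.ext_iff.symm
  | actEq a b =>
    intro ea eb hea e hφ
    rw [evalF_eq]
    simp only [Formula.code, combF, tag_pair, lft_pair, rgt_pair, BEq.rfl, Nat.reduceBEq,
      cond_true, cond_false, beq_iff_eq]
    exact (h.actTerm_eq_iff hea e a b).symm
  | clockCmp f ts r v =>
    intro ea eb hea e hφ
    rw [evalF_eq]
    simp only [Formula.code, combF, tag_pair, lft_pair, rgt_pair, BEq.rfl, Nat.reduceBEq,
      cond_true, cond_false, h.evalTs_eq]
    have hv : v ≤ Δ.code := by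
      refine le_trans ?_ hφ
      simp only [Formula.code]
      exact le_pair_right (le_pair_right (le_pair_right (le_pair_right le_rfl)))
    exact (h.clock.holds_iff (gridSize_pos _) ⟨f, fun i => (fr.snap x).term e (ts i)⟩ hv r).symm
  | natCmp v r w =>
    intro ea eb hea e hφ
    rw [evalF_eq]
    simp only [Formula.code, combF, tag_pair, body_pair, lft_pair, rgt_pair, BEq.rfl,
      Nat.reduceBEq, cond_true, cond_false]
    exact cmpB_code_iff r v w
  | neg φ ih =>
    intro ea eb hea e hφ
    simp only [Formula.code] at hφ ⊢
    rw [evalF_eq]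
    simp only [combF, subF, tag_pair, body_pair, BEq.rfl, Nat.reduceBEq, cond_true, cond_false,
      List.map_cons, List.map_nil, List.all_cons, List.all_nil, Bool.and_true, Interp.Sat,
      ← ih hea e ((Nat.right_le_pair _ _).trans hφ), Bool.not_eq_true', Bool.not_eq_true]
  | and φ ψ ih ih' =>
    intro ea eb hea e hφ
    simp only [Formula.code] at hφ ⊢
    have h1 := (Nat.right_le_pair _ _).trans hφ
    rw [evalF_eq]
    simp only [combF, subF, tag_pair, lft_pair, rgt_pair, BEq.rfl, Nat.reduceBEq, cond_true,
      cond_false, List.map_cons, List.map_nil, List.all_cons, List.all_nil, Bool.and_true,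
      Interp.Sat, ← ih hea e ((Nat.left_le_pair _ _).trans h1),
      ← ih' hea e ((Nat.right_le_pair _ _).trans h1), Bool.and_eq_true]
  | allObj φ ih =>
    intro ea eb hea e hφ
    simp only [Formula.code] at hφ ⊢
    have h1 := (Nat.right_le_pair _ _).trans hφ
    rw [evalF_eq]
    simp only [combF, subF, tag_pair, body_pair, BEq.rfl, Nat.reduceBEq, cond_true,
      cond_false, List.map_map, Function.comp_def, List.all_map, List.all_eq_true, List.mem_range,
      numObj_code, Interp.Sat]
    have hv : ∀ c : Δ.sig.ObjName, vals (Fin.cons c e : Fin (_ + 1) → Δ.sig.ObjName) =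
      (c : ℕ) :: vals e := fun c => vals_cons c e
    constructor
    · intro h2 o
      exact (ih hea (Fin.cons o e) h1).1 ((hv o).symm ▸ h2 _ (o : Δ.sig.ObjName).2)
    · intro h2 o ho
      exact hv ⟨o, ho⟩ ▸ (ih hea (Fin.cons ⟨o, ho⟩ e) h1).2 (h2 _)
  | allAct φ ih =>
    intro ea eb hea e hφ
    simp only [Formula.code] at hφ ⊢
    have h1 := (Nat.right_le_pair _ _).trans hφ
    rw [evalF_eq]
    simp only [combF, subF, tag_pair, body_pair, BEq.rfl, Nat.reduceBEq, cond_true,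
      cond_false, List.map_map, Function.comp_def, List.all_map, List.all_eq_true,
      hea.length, Interp.Sat]
    constructor
    · intro h2 a
      obtain ⟨b, hb, hab⟩ := hea.exists_abstract a
      exact (ih hab e h1).1 (h2 b hb)
    · intro h2 b hb
      obtain ⟨a, hab⟩ := hea.exists_concrete hb
      exact (ih hab e h1).2 (h2 a)

/-! ### Correctness of the steps of programs -/

section Inversion

variable {S : Signature} {M : Interp S} {s s' : M.Sit} {a : M.Act} {δ' δ₁ δ₂ : Prog S 0}

theorem final_test_iff {φ : Formula S 0 0} : Final M (.test φ) s ↔ M.SatClosed φ s :=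
  ⟨fun h => by cases h; assumption, .test⟩

theorem not_final_act {A : S.ActType} {ts : Fin (S.acts.get A) → Term S 0} :
    ¬ Final M (.act A ts) s := nofun

theorem not_final_wait : ¬ Final M .wait s := nofun

theorem final_seq_iff : Final M (.seq δ₁ δ₂) s ↔ Final M δ₁ s ∧ Final M δ₂ s :=
  ⟨fun h => by cases h; exact ⟨‹_›, ‹_›⟩, fun h => .seq h.1 h.2⟩

theorem final_conc_iff : Final M (.conc δ₁ δ₂) s ↔ Final M δ₁ s ∧ Final M δ₂ s :=
  ⟨fun h => by cases h; exact ⟨‹_›, ‹_›⟩, fun h => .conc h.1 h.2⟩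

theorem final_choice_iff : Final M (.choice δ₁ δ₂) s ↔ Final M δ₁ s ∨ Final M δ₂ s :=
  ⟨fun h => by cases h <;> [left; right] <;> assumption,
    fun h => h.elim .choice_left .choice_right⟩

theorem final_pick_iff {δ : Prog S 1} : Final M (.pick δ) s ↔ ∃ c, Final M (δ.inst c) s :=
  ⟨fun h => by cases h with | pick c h => exact ⟨c, h⟩, fun ⟨c, h⟩ => .pick c h⟩

theorem not_trans_test {φ : Formula S 0 0} : ¬ Trans M (.test φ) s a δ' s' := nofun

theorem trans_wait_iff : Trans M .wait s a δ' s' ↔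
    ∃ t, a = M.wait t ∧ δ' = .nil ∧ s' = M.doAct a s := by
  constructor
  · intro h
    cases h with
    | wait t => exact ⟨t, rfl, rfl, rfl⟩
  · rintro ⟨t, rfl, rfl, rfl⟩
    exact .wait t

theorem trans_act_iff {A : S.ActType} {ts : Fin (S.acts.get A) → Term S 0} :
    Trans M (.act A ts) s a δ' s' ↔
      a = M.act A (fun i => M.term Fin.elim0 (ts i)) ∧ M.poss a s ∧ δ' = .nil ∧
        s' = M.doAct a s := by
  constructor
  · intro h
    cases h with
    | act h => exact ⟨rfl, h, rfl, rfl⟩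
  · rintro ⟨rfl, h, rfl, rfl⟩
    exact .act h

theorem trans_seq_iff : Trans M (.seq δ₁ δ₂) s a δ' s' ↔
    (∃ γ, δ' = .seq γ δ₂ ∧ Trans M δ₁ s a γ s') ∨ Final M δ₁ s ∧ Trans M δ₂ s a δ' s' := by
  constructor
  · intro h
    cases h with
    | seq_left h => exact .inl ⟨_, rfl, h⟩
    | seq_right h h' => exact .inr ⟨h, h'⟩
  · rintro (⟨γ, rfl, h⟩ | ⟨h, h'⟩)
    exacts [.seq_left h, .seq_right h h']

theorem trans_choice_iff : Trans M (.choice δ₁ δ₂) s a δ' s' ↔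
    Trans M δ₁ s a δ' s' ∨ Trans M δ₂ s a δ' s' :=
  ⟨fun h => by cases h <;> [left; right] <;> assumption,
    fun h => h.elim .choice_left .choice_right⟩

theorem trans_pick_iff {δ : Prog S 1} : Trans M (.pick δ) s a δ' s' ↔
    ∃ c, Trans M (δ.inst c) s a δ' s' :=
  ⟨fun h => by cases h with | pick c h => exact ⟨c, h⟩, fun ⟨c, h⟩ => .pick c h⟩

theorem trans_star_iff : Trans M (.star δ₁) s a δ' s' ↔
    ∃ γ, δ' = .seq γ (.star δ₁) ∧ Trans M δ₁ s a γ s' :=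
  ⟨fun h => by cases h with | star h => exact ⟨_, rfl, h⟩, fun ⟨_, e, h⟩ => e ▸ .star h⟩

theorem trans_conc_iff : Trans M (.conc δ₁ δ₂) s a δ' s' ↔
    (∃ γ, δ' = .conc γ δ₂ ∧ Trans M δ₁ s a γ s') ∨
      ∃ γ, δ' = .conc δ₁ γ ∧ Trans M δ₂ s a γ s' := by
  constructor
  · intro h
    cases h with
    | conc_left h => exact .inl ⟨_, rfl, h⟩
    | conc_right h => exact .inr ⟨_, rfl, h⟩
  · rintro (⟨γ, rfl, h⟩ | ⟨γ, rfl, h⟩)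
    exacts [.conc_left h, .conc_right h]

end Inversion

/-- The residual program with code `r` stands for the program `p`. -/
inductive Repr (Δ : ClockedProgram) : ℕ → Prog Δ.sig 0 → Prop
  | nil : Repr Δ nilR .nil
  | clo {m : ℕ} (δ : Prog Δ.sig m) (e : Fin m → Δ.sig.ObjName) (h : δ.code ≤ Δ.code) :
      Repr Δ (cloR δ.code (vals e)) (δ.close e)
  | seq {r : ℕ} {p : Prog Δ.sig 0} {m : ℕ} (h : Repr Δ r p) (δ : Prog Δ.sig m)
      (e : Fin m → Δ.sig.ObjName) (hδ : δ.code ≤ Δ.code) :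
      Repr Δ (seqR r δ.code (vals e)) (.seq p (δ.close e))
  | conc {r r' : ℕ} {p p' : Prog Δ.sig 0} (h : Repr Δ r p) (h' : Repr Δ r' p') :
      Repr Δ (concR r r') (.conc p p')

/-- The action `a` has the code `b`, which omits the duration. -/
inductive Matches {S : Signature} : GroundAct S → Atom → Prop
  | act (A : S.ActType) (ρ : Fin (S.acts.get A) → S.ObjName) :
      Matches (.act A ρ) (1, (A : ℕ), vals ρ)
  | wait (t : ℝ≥0) : Matches (.wait t) (0, 0, [])

variable {Δ : ClockedProgram} {fr : Frame Δ.sig} {x : FluentState Δ.sig} {st : Store}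
  {l : List (GroundAct Δ.sig)}

theorem Frame.canon_term_subst (fr : Frame Δ.sig) (x : FluentState Δ.sig) {m : ℕ}
    (e : Fin m → Δ.sig.ObjName) (t : Term Δ.sig m) :
    (fr.canon Δ.bat).term Fin.elim0 (t.subst fun i => .const (e i)) = (fr.snap x).term e t :=
  ((fr.canon Δ.bat).term_subst _ _ t).trans (StaticIso.term (h := fr.snapIso Δ.bat x) e t)

theorem Describes.finC_iff (h : Describes Δ fr (fr.state Δ.bat l) st) {m : ℕ}
    (δ : Prog Δ.sig m) : ∀ (e : Fin m → Δ.sig.ObjName) (_ : δ.code ≤ Δ.code),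
    finC Δ.code st (vals e) δ.code = true ↔ Final (fr.canon Δ.bat) (δ.close e) l := by
  induction δ with
  | act A ts =>
    intro e hδ
    rw [finC_act (.inl (by simp [Prog.code]))]
    exact ⟨fun h => by simp at h, fun h => (not_final_act h).elim⟩
  | wait =>
    intro e hδ
    rw [finC_act (.inr (by simp [Prog.code]))]
    exact ⟨fun h => by simp at h, fun h => (not_final_wait h).elim⟩
  | test φ =>
    intro e hδ
    rw [finC_test (by simp [Prog.code])]
    refine Iff.trans ?_ final_test_iff.symm
    simp only [Prog.code, body_pair] at hδ ⊢
    rw [h.evalF_iff φ (ActEnv.nil Fin.elim0) e ((Nat.right_le_pair _ _).trans hδ),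
      ← fr.sat_canon_iff]
    exact ((fr.canon Δ.bat).sat_subst l φ (fun i => .const (e i)) Fin.elim0 Fin.elim0).symm
  | seq δ₁ δ₂ ih ih' =>
    intro e hδ
    rw [finC_both (.inl (by simp [Prog.code]))]
    simp only [Prog.code, lft_pair, rgt_pair] at hδ ⊢
    have h1 := (Nat.right_le_pair _ _).trans hδ
    rw [Bool.and_eq_true, ih e ((Nat.left_le_pair _ _).trans h1),
      ih' e ((Nat.right_le_pair _ _).trans h1)]
    exact final_seq_iff.symm
  | choice δ₁ δ₂ ih ih' =>
    intro e hδ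
    rw [finC_choice (by simp [Prog.code])]
    simp only [Prog.code, lft_pair, rgt_pair] at hδ ⊢
    have h1 := (Nat.right_le_pair _ _).trans hδ
    rw [Bool.or_eq_true, ih e ((Nat.left_le_pair _ _).trans h1),
      ih' e ((Nat.right_le_pair _ _).trans h1)]
    exact final_choice_iff.symm
  | pick δ ih =>
    intro e hδ
    rw [finC_pick (by simp [Prog.code])]
    simp only [Prog.code, body_pair] at hδ ⊢
    have h1 := (Nat.right_le_pair _ _).trans hδ
    refine Iff.trans ?_ final_pick_iff.symm
    simp only [List.any_eq_true, List.mem_range, numObj_code, Prog.inst_close]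
    constructor
    · rintro ⟨o, ho, hf⟩
      rw [← vals_cons ⟨o, ho⟩ e] at hf
      exact ⟨⟨o, ho⟩, (ih _ h1).1 hf⟩
    · rintro ⟨c, hc⟩
      refine ⟨c, c.2, ?_⟩
      rw [← vals_cons c e]
      exact (ih _ h1).2 hc
  | star δ ih =>
    intro e hδ
    rw [finC_star (by simp [Prog.code])]
    exact ⟨fun _ => .star, fun _ => rfl⟩
  | conc δ₁ δ₂ ih ih' =>
    intro e hδ
    rw [finC_both (.inr (by simp [Prog.code]))]
    simp only [Prog.code, lft_pair, rgt_pair] at hδ ⊢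
    have h1 := (Nat.right_le_pair _ _).trans hδ
    rw [Bool.and_eq_true, ih e ((Nat.left_le_pair _ _).trans h1),
      ih' e ((Nat.right_le_pair _ _).trans h1)]
    exact final_conc_iff.symm

theorem Describes.finR_iff (h : Describes Δ fr (fr.state Δ.bat l) st) {r : ℕ}
    {p : Prog Δ.sig 0} (hr : Repr Δ r p) :
    finR Δ.code st r = true ↔ Final (fr.canon Δ.bat) p l := by
  induction hr with
  | nil =>
    rw [nilR, finR_cloR, finC_test (by simp), body_pair, evalF_eq]
    exact ⟨fun _ => .test (M := fr.canon Δ.bat) trivial, fun _ => by simp [combF, subF]⟩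
  | clo δ e hδ => rw [finR_cloR]; exact h.finC_iff δ e hδ
  | seq _ δ e hδ ih => rw [finR_seqR, Bool.and_eq_true, ih, h.finC_iff δ e hδ]; exact final_seq_iff.symm
  | conc _ _ ih ih' => rw [finR_concR, Bool.and_eq_true, ih, ih']; exact final_conc_iff.symm

/-- The steps `ps` of a residual program are those of the program `p` after the actions `l`. The
code of a `wait` action leaves the duration open, and all durations are possible. -/
structure StepsMatch (Δ : ClockedProgram) (fr : Frame Δ.sig) (l : List (GroundAct Δ.sig))
    (p : Prog Δ.sig 0) (ps : List (Atom × ℕ)) : Prop where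
  complete : ∀ {a p' l'}, Trans (fr.canon Δ.bat) p l a p' l' →
    l' = a :: l ∧ ∃ q ∈ ps, Matches a q.1 ∧ Repr Δ q.2 p'
  exists_matches : ∀ q ∈ ps, ∃ a : GroundAct Δ.sig, Matches a q.1
  sound : ∀ q ∈ ps, ∀ a : GroundAct Δ.sig, Matches a q.1 →
    ∃ p', Trans (fr.canon Δ.bat) p l a p' (a :: l) ∧ Repr Δ q.2 p'

variable {p p' p₁ p₂ : Prog Δ.sig 0} {ps ps' : List (Atom × ℕ)}

theorem StepsMatch.of_forall_not
    (h : ∀ a p' l', ¬ Trans (fr.canon Δ.bat) p l a p' l') : StepsMatch Δ fr l p [] where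
  complete ht := (h _ _ _ ht).elim
  exists_matches _ hq := (List.not_mem_nil hq).elim
  sound _ hq := (List.not_mem_nil hq).elim

theorem StepsMatch.seq (h : StepsMatch Δ fr l p ps) {b : Bool} {m : ℕ} {δ : Prog Δ.sig m}
    {e : Fin m → Δ.sig.ObjName} (hb : b = true ↔ Final (fr.canon Δ.bat) p l)
    (hδ : δ.code ≤ Δ.code) (h' : StepsMatch Δ fr l (δ.close e) ps') :
    StepsMatch Δ fr l (.seq p (δ.close e))
      ((ps.map fun q => (q.1, seqR q.2 δ.code (vals e))) ++ bif b then ps' else []) where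
  complete {a p' l'} ht := by
    rcases trans_seq_iff.1 ht with ⟨γ, rfl, ht'⟩ | ⟨hf, ht'⟩
    · obtain ⟨h1, q, hq, h2, h3⟩ := h.complete ht'
      exact ⟨h1, _, List.mem_append_left _ (List.mem_map_of_mem hq), h2, h3.seq δ e hδ⟩
    · obtain ⟨h1, q, hq, h2⟩ := h'.complete ht'
      refine ⟨h1, q, List.mem_append_right _ ?_, h2⟩
      rwa [hb.2 hf, cond_true]
  exists_matches q hq := by
    rcases List.mem_append.1 hq with hq' | hq'
    · obtain ⟨z, hz, rfl⟩ := List.mem_map.1 hq'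
      exact h.exists_matches z hz
    · cases b
      · simp at hq'
      · exact h'.exists_matches q hq'
  sound q hq a ha := by
    rcases List.mem_append.1 hq with hq' | hq'
    · obtain ⟨z, hz, rfl⟩ := List.mem_map.1 hq'
      obtain ⟨p', h1, h2⟩ := h.sound z hz a ha
      exact ⟨_, .seq_left h1, h2.seq δ e hδ⟩
    · cases b
      · simp at hq'
      · obtain ⟨p', h1, h2⟩ := h'.sound q hq' a ha
        exact ⟨_, .seq_right (hb.1 rfl) h1, h2⟩

theorem StepsMatch.conc {r₁ r₂ : ℕ} (h : StepsMatch Δ fr l p₁ ps) (h' : StepsMatch Δ fr l p₂ ps')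
    (hr₁ : Repr Δ r₁ p₁) (hr₂ : Repr Δ r₂ p₂) : StepsMatch Δ fr l (.conc p₁ p₂)
      ((ps.map fun q => (q.1, concR q.2 r₂)) ++ ps'.map fun q => (q.1, concR r₁ q.2)) where
  complete {a p' l'} ht := by
    rcases trans_conc_iff.1 ht with ⟨γ, rfl, ht'⟩ | ⟨γ, rfl, ht'⟩
    · obtain ⟨h1, q, hq, h2, h3⟩ := h.complete ht'
      exact ⟨h1, _, List.mem_append_left _ (List.mem_map_of_mem hq), h2, h3.conc hr₂⟩
    · obtain ⟨h1, q, hq, h2, h3⟩ := h'.complete ht'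
      exact ⟨h1, _, List.mem_append_right _ (List.mem_map_of_mem hq), h2, hr₁.conc h3⟩
  exists_matches q hq := by
    rcases List.mem_append.1 hq with hq' | hq' <;> obtain ⟨z, hz, rfl⟩ := List.mem_map.1 hq'
    exacts [h.exists_matches z hz, h'.exists_matches z hz]
  sound q hq a ha := by
    rcases List.mem_append.1 hq with hq' | hq' <;> obtain ⟨z, hz, rfl⟩ := List.mem_map.1 hq'
    · obtain ⟨p', h1, h2⟩ := h.sound z hz a ha
      exact ⟨_, .conc_left h1, h2.conc hr₂⟩
    · obtain ⟨p', h1, h2⟩ := h'.sound z hz a ha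
      exact ⟨_, .conc_right h1, hr₁.conc h2⟩

theorem Describes.stepsMatch_act (h : Describes Δ fr (fr.state Δ.bat l) st) {m : ℕ}
    (A : Δ.sig.ActType) (ts : Fin (Δ.sig.acts.get A) → Term Δ.sig m)
    (e : Fin m → Δ.sig.ObjName) :
    StepsMatch Δ fr l ((Prog.act A ts).close e)
      (stepC Δ.code st (vals e) (Prog.act A ts).code) := by
  let ρ : Fin (Δ.sig.acts.get A) → Δ.sig.ObjName := fun i =>
    (fr.snap (fr.state Δ.bat l)).term e (ts i)
  have hev := h.evalF_iff (Δ.bat.pre A) (ActEnv.nil Fin.elim0) ρ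
    (axioms_pre Δ A ▸ axioms_getI_le _ _ _)
  have ht : ∀ a p' l', Trans (fr.canon Δ.bat) ((Prog.act A ts).close e) l a p' l' ↔
      a = .act A ρ ∧ evalF Δ.code st [] (vals ρ) (Δ.bat.pre A).code = true ∧ p' = .nil ∧
        l' = a :: l := by
    intro a p' l'
    refine trans_act_iff.trans ?_
    have hρ : (fr.canon Δ.bat).act A (fun i => (fr.canon Δ.bat).term Fin.elim0
        ((ts i).subst fun i => .const (e i))) = GroundAct.act A ρ :=
      congrArg (GroundAct.act A) (funext fun i => fr.canon_term_subst (fr.state Δ.bat l) e (ts i))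
    rw [hρ, hev]
    refine and_congr_right ?_
    rintro rfl
    exact Iff.rfl
  rw [stepC_act (by simp [Prog.code])]
  simp only [Prog.code, lft_pair, rgt_pair, axioms_pre]
  rw [h.evalTs_eq e ts]
  change StepsMatch Δ fr l _
    (bif evalF Δ.code st [] (vals ρ) (Δ.bat.pre A).code then [((1, (A : ℕ), vals ρ), nilR)] else [])
  cases hb : evalF Δ.code st [] (vals ρ) (Δ.bat.pre A).code
  · rw [hb] at ht
    exact .of_forall_not fun _ _ _ h => by simpa using (ht _ _ _).1 h
  · rw [hb] at ht
    simp only [cond_true]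
    refine ⟨fun h => ?_, ?_, ?_⟩
    · obtain ⟨rfl, -, rfl, rfl⟩ := (ht _ _ _).1 h
      exact ⟨rfl, _, List.mem_singleton_self _, .act A ρ, .nil⟩
    · intro q hq
      obtain rfl := List.mem_singleton.1 hq
      exact ⟨_, .act A ρ⟩
    · intro q hq a ha
      obtain rfl := List.mem_singleton.1 hq
      have : a = .act A ρ := by
        generalize hb : ((1, (A : ℕ), vals ρ) : Atom) = b at ha
        cases ha with
        | act B ρ' => exact (act_eq_act_iff.2 hb).symm
        | wait t => simp at hb
      exact ⟨.nil, (ht _ _ _).2 ⟨this, rfl, rfl, rfl⟩, .nil⟩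

/-- The steps computed on codes are those of the program. -/
theorem Describes.stepsMatch_clo (h : Describes Δ fr (fr.state Δ.bat l) st) {m : ℕ}
    (δ : Prog Δ.sig m) : ∀ (e : Fin m → Δ.sig.ObjName) (_ : δ.code ≤ Δ.code),
    StepsMatch Δ fr l (δ.close e) (stepC Δ.code st (vals e) δ.code) := by
  induction δ with
  | act A ts => exact fun e _ => h.stepsMatch_act A ts e
  | wait =>
    intro e hδ
    rw [stepC_wait (by simp [Prog.code])]
    refine ⟨fun ht => ?_, ?_, ?_⟩
    · obtain ⟨t, rfl, rfl, rfl⟩ := trans_wait_iff.1 ht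
      exact ⟨rfl, _, List.mem_singleton_self _, .wait t, .nil⟩
    · intro q hq
      obtain rfl := List.mem_singleton.1 hq
      exact ⟨_, .wait 0⟩
    · intro q hq a ha
      obtain rfl := List.mem_singleton.1 hq
      generalize hb : ((0, 0, []) : Atom) = b at ha
      cases ha with
      | act B ρ' => simp at hb
      | wait t => exact ⟨.nil, .wait (M := fr.canon Δ.bat) t, .nil⟩
  | test φ =>
    intro e hδ
    rw [stepC_other (.inl (by simp [Prog.code]))]
    exact .of_forall_not fun _ _ _ => not_trans_test
  | seq δ₁ δ₂ ih ih' =>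
    intro e hδ
    rw [stepC_seq (by simp [Prog.code])]
    simp only [Prog.code, lft_pair, rgt_pair] at hδ ⊢
    have h1 := (Nat.right_le_pair _ _).trans hδ
    have h2 := (Nat.left_le_pair _ _).trans h1
    have h3 := (Nat.right_le_pair _ _).trans h1
    exact (ih e h2).seq (h.finC_iff δ₁ e h2) h3 (ih' e h3)
  | choice δ₁ δ₂ ih ih' =>
    intro e hδ
    rw [stepC_choice (by simp [Prog.code])]
    simp only [Prog.code, lft_pair, rgt_pair] at hδ ⊢
    have h1 := (Nat.right_le_pair _ _).trans hδ
    replace ih := ih e ((Nat.left_le_pair _ _).trans h1)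
    replace ih' := ih' e ((Nat.right_le_pair _ _).trans h1)
    refine ⟨fun ht => ?_, fun q hq => ?_, fun q hq a ha => ?_⟩
    · rcases trans_choice_iff.1 ht with ht | ht
      · obtain ⟨h1, q, hq, h2⟩ := ih.complete ht
        exact ⟨h1, q, List.mem_append_left _ hq, h2⟩
      · obtain ⟨h1, q, hq, h2⟩ := ih'.complete ht
        exact ⟨h1, q, List.mem_append_right _ hq, h2⟩
    · exact (List.mem_append.1 hq).elim (ih.exists_matches q) (ih'.exists_matches q)
    · rcases List.mem_append.1 hq with hq | hq
      · exact (ih.sound q hq a ha).imp fun _ h => ⟨.choice_left h.1, h.2⟩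
      · exact (ih'.sound q hq a ha).imp fun _ h => ⟨.choice_right h.1, h.2⟩
  | pick δ ih =>
    intro e hδ
    rw [stepC_pick (by simp [Prog.code])]
    simp only [Prog.code, body_pair] at hδ ⊢
    have h1 := (Nat.right_le_pair _ _).trans hδ
    have hmem : ∀ q, q ∈ ((List.range (numObj Δ.code)).flatMap fun o =>
        stepC Δ.code st (o :: vals e) δ.code) ↔
        ∃ c : Δ.sig.ObjName, q ∈ stepC Δ.code st
          (vals (Fin.cons c e : Fin (_ + 1) → Δ.sig.ObjName)) δ.code := by
      intro q
      simp only [List.mem_flatMap, List.mem_range, numObj_code, vals_cons]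
      exact ⟨fun ⟨o, ho, hq⟩ => ⟨⟨o, ho⟩, hq⟩, fun ⟨c, hq⟩ => ⟨c, c.2, hq⟩⟩
    have hin := fun c => Prog.inst_close δ e c
    refine ⟨fun ht => ?_, fun q hq => ?_, fun q hq a ha => ?_⟩
    · obtain ⟨c, ht⟩ := trans_pick_iff.1 ht
      rw [hin] at ht
      obtain ⟨h2, q, hq, h3⟩ := (ih _ h1).complete ht
      exact ⟨h2, q, (hmem q).2 ⟨c, hq⟩, h3⟩
    · obtain ⟨c, hq⟩ := (hmem q).1 hq
      exact (ih _ h1).exists_matches q hq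
    · obtain ⟨c, hq⟩ := (hmem q).1 hq
      obtain ⟨p', h2, h3⟩ := (ih _ h1).sound q hq a ha
      exact ⟨p', .pick c (by rwa [hin]), h3⟩
  | star δ ih =>
    intro e hδ
    rw [stepC_star (by simp [Prog.code])]
    have h1 : δ.code ≤ Δ.code := by
      simp only [Prog.code] at hδ
      exact (Nat.right_le_pair _ _).trans hδ
    have hbody : body (Prog.star δ).code = δ.code := by simp [Prog.code]
    rw [hbody]
    replace ih := ih e h1
    refine ⟨fun ht => ?_, fun q hq => ?_, fun q hq a ha => ?_⟩
    · obtain ⟨γ, rfl, ht'⟩ := trans_star_iff.1 ht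
      obtain ⟨h2, q, hq, h3, h4⟩ := ih.complete ht'
      exact ⟨h2, _, List.mem_map_of_mem hq, h3, h4.seq δ.star e hδ⟩
    · obtain ⟨z, hz, rfl⟩ := List.mem_map.1 hq
      exact ih.exists_matches z hz
    · obtain ⟨z, hz, rfl⟩ := List.mem_map.1 hq
      obtain ⟨p', h2, h3⟩ := ih.sound z hz a ha
      exact ⟨_, .star h2, h3.seq δ.star e hδ⟩
  | conc δ₁ δ₂ ih ih' =>
    intro e hδ
    rw [stepC_conc (by simp [Prog.code])]
    simp only [Prog.code, lft_pair, rgt_pair] at hδ ⊢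
    have h1 := (Nat.right_le_pair _ _).trans hδ
    have h2 := (Nat.left_le_pair _ _).trans h1
    have h3 := (Nat.right_le_pair _ _).trans h1
    exact (ih e h2).conc (ih' e h3) (.clo δ₁ e h2) (.clo δ₂ e h3)

theorem Describes.stepsMatch (h : Describes Δ fr (fr.state Δ.bat l) st) {r : ℕ}
    (hr : Repr Δ r p) : StepsMatch Δ fr l p (stepR Δ.code st r) := by
  induction hr with
  | nil =>
    rw [stepR_nilR]
    exact .of_forall_not fun _ _ _ => not_trans_test
  | clo δ e hδ => rw [stepR_cloR]; exact h.stepsMatch_clo δ e hδ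
  | seq hr δ e hδ ih =>
    rw [stepR_seqR]
    exact ih.seq (h.finR_iff hr) hδ (h.stepsMatch_clo δ e hδ)
  | conc hr hr' ih ih' => rw [stepR_concR]; exact ih.conc ih' hr hr'

/-! ### Correctness of the steps of stores -/

theorem look_map (F : Atom → ℕ) {ks : List Atom} {k : Atom} (hk : k ∈ ks) :
    look (ks.map fun k => (k, F k)) k = F k := by
  induction ks with
  | nil => simp at hk
  | cons a ks ih =>
    unfold look at ih ⊢
    rw [List.map_cons, List.lookup_cons]
    by_cases h : k = a
    · subst h; simp
    · rw [beq_false_of_ne h]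
      exact ih ((List.mem_cons.1 hk).resolve_left h)

section Keys

variable (Δ : ClockedProgram)

theorem fluent_mem_keys (R : Δ.sig.Fluent) (o : Fin (Δ.sig.fluents.get R) → Δ.sig.ObjName) :
    (2, (R : ℕ), vals o) ∈ keys Δ.code := by
  simp only [keys, List.mem_append]
  exact .inl (.inl (.inl ((mem_atoms_iff (arities_fluents Δ) (numObj_code Δ)).2 ⟨R, o, rfl⟩)))

theorem clock_mem_atoms (f : Δ.sig.Clock) (o : Fin (Δ.sig.clocks.get f) → Δ.sig.ObjName) :
    (3, (f : ℕ), vals o) ∈ atoms Δ.code 3 :=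
  (mem_atoms_iff (arities_clocks Δ) (numObj_code Δ)).2 ⟨f, o, rfl⟩

theorem clock_mem_keys (f : Δ.sig.Clock) (o : Fin (Δ.sig.clocks.get f) → Δ.sig.ObjName) :
    (3, (f : ℕ), vals o) ∈ keys Δ.code := by
  simp only [keys, List.mem_append]
  exact .inl (.inl (.inr (clock_mem_atoms Δ f o)))

theorem rigidRel_mem_keys (P : Δ.sig.RigidRel)
    (o : Fin (Δ.sig.rigidRels.get P) → Δ.sig.ObjName) : (4, (P : ℕ), vals o) ∈ keys Δ.code := by
  simp only [keys, List.mem_append]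
  exact .inl (.inr ((mem_atoms_iff (arities_rigidRels Δ) (numObj_code Δ)).2 ⟨P, o, rfl⟩))

theorem rigidFun_mem_atoms (f : Δ.sig.RigidFun)
    (o : Fin (Δ.sig.rigidFuns.get f) → Δ.sig.ObjName) : (5, (f : ℕ), vals o) ∈ atoms Δ.code 5 :=
  (mem_atoms_iff (arities_rigidFuns Δ) (numObj_code Δ)).2 ⟨f, o, rfl⟩

theorem rigidFun_mem_keys (f : Δ.sig.RigidFun)
    (o : Fin (Δ.sig.rigidFuns.get f) → Δ.sig.ObjName) : (5, (f : ℕ), vals o) ∈ keys Δ.code := by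
  simp only [keys, List.mem_append]
  exact .inr (rigidFun_mem_atoms Δ f o)

end Keys

variable {Δ : ClockedProgram} {fr : Frame Δ.sig} {x : FluentState Δ.sig} {st : Store}
  {l : List (GroundAct Δ.sig)} {p : Prog Δ.sig 0}

/-- The bound on the values in a store is not effective for the values that occur. -/
theorem describes_map {F : Atom → ℕ}
    (h5 : ∀ (f : Δ.sig.RigidFun) o, F (5, (f : ℕ), vals o) = fr.rigidFun f o)
    (h4 : ∀ (P : Δ.sig.RigidRel) o, F (4, (P : ℕ), vals o) = 1 ↔ fr.rigidRel P o)
    (h2 : ∀ (R : Δ.sig.Fluent) o, F (2, (R : ℕ), vals o) = 1 ↔ x.fluent R o)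
    (h3 : ClockRel (gridSize Δ.code) Δ.code
      (fun i : (f : Δ.sig.Clock) × (Fin (Δ.sig.clocks.get f) → Δ.sig.ObjName) =>
        x.clock i.1 i.2) (fun i => F (3, (i.1 : ℕ), vals i.2))) :
    Describes Δ fr x ((keys Δ.code).map fun k => (k, min (F k) (storeBound Δ.code))) := by
  have hB := two_le_storeBound Δ
  have hlook := fun {k} (hk : k ∈ keys Δ.code) =>
    look_map (fun k => min (F k) (storeBound Δ.code)) hk
  refine ⟨fun f o => ?_, fun P o => ?_, fun R o => ?_, ?_⟩
  · rw [hlook (rigidFun_mem_keys Δ f o), h5]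
    have h1 := (fr.rigidFun f o).2
    have h2 := numObj_code Δ
    unfold storeBound
    omega
  · rw [hlook (rigidRel_mem_keys Δ P o), ← h4]
    omega
  · rw [hlook (fluent_mem_keys Δ R o), ← h2]
    omega
  · refine h3.congr (fun _ => rfl) fun i => ?_
    rw [hlook (clock_mem_keys Δ i.1 i.2)]
    refine min_eq_left ((h3.le i).trans ?_)
    unfold storeBound cap
    omega

theorem Matches.actEnv {a : GroundAct Δ.sig} {b : Atom} (h : Matches a b) :
    ActEnv (fun _ : Fin 1 => a) [b] := by
  have h0 : ∀ i : Fin 1, [b].getI i = b := fun i => by rw [Subsingleton.elim i 0]; rfl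
  refine ⟨rfl, fun i A ρ => ?_, fun i j => by simp, fun i t ht => ?_⟩ <;> rw [h0] <;>
    cases h
  · exact act_eq_act_iff
  · simp
  · cases ht
  · exact ⟨0, by omega, rfl⟩

theorem toNat_eq_one_iff {b : Bool} : b.toNat = 1 ↔ b = true := by cases b <;> simp

/-- Actions have the intended effect on stores, provided that they have on the clocks. -/
theorem Describes.next_aux (h : Describes Δ fr x st) {a : GroundAct Δ.sig} {b : Atom}
    (hab : Matches a b) (d : ℕ)
    (hclock : ClockRel (gridSize Δ.code) Δ.code
      (fun i : (f : Δ.sig.Clock) × (Fin (Δ.sig.clocks.get f) → Δ.sig.ObjName) =>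
        (fr.next Δ.bat x a).clock i.1 i.2)
      (fun i => nextVal Δ.code st b d (3, (i.1 : ℕ), vals i.2))) :
    Describes Δ fr (fr.next Δ.bat x a) (nextStore Δ.code st b d) := by
  refine describes_map (fun f o => ?_) (fun P o => ?_) (fun R o => ?_) hclock
  · simpa [nextVal] using h.rigidFun f o
  · simpa [nextVal] using h.rigidRel P o
  · simp only [nextVal, BEq.rfl, cond_true, toNat_eq_one_iff, axioms_ssa]
    exact h.evalF_iff (Δ.bat.ssa R) hab.actEnv o (axioms_ssa Δ R ▸ axioms_getI_le _ _ _)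

theorem Describes.next_act (h : Describes Δ fr x st) (A : Δ.sig.ActType)
    (ρ : Fin (Δ.sig.acts.get A) → Δ.sig.ObjName) :
    Describes Δ fr (fr.next Δ.bat x (.act A ρ)) (nextStore Δ.code st (1, (A : ℕ), vals ρ) 0) := by
  classical
  refine h.next_aux (.act A ρ) 0 ?_
  refine (h.clock.reset fun i => (fr.snap x).Sat (Δ.bat.reset i.1)
    (fun _ => GroundAct.act A ρ) i.2 ()).congr (fun i => ?_) fun i => ?_
  · simp only [Frame.next]
  have hev := h.evalF_iff (Δ.bat.reset i.1) (Matches.act A ρ).actEnv i.2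
    (axioms_reset Δ i.1 ▸ axioms_getI_le _ _ _)
  simp only [nextVal, Nat.reduceBEq, BEq.rfl, cond_true, cond_false, axioms_reset, ← hev]
  cases evalF Δ.code st [(1, (A : ℕ), vals ρ)] (vals i.2) (Δ.bat.reset i.1).code <;> rfl

theorem Describes.next_wait (h : Describes Δ fr x st) {t : ℝ≥0} {d : ℕ}
    (hd : HalfRel (gridSize Δ.code) Δ.code
      (fun i : (f : Δ.sig.Clock) × (Fin (Δ.sig.clocks.get f) → Δ.sig.ObjName) =>
        x.clock i.1 i.2 + t) (fun i => 2 * look st (3, (i.1 : ℕ), vals i.2) + d)) :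
    Describes Δ fr (fr.next Δ.bat x (.wait t)) (nextStore Δ.code st (0, 0, []) d) := by
  refine h.next_aux (.wait t) d ?_
  have := hd.normalize (gridSize_pos _) (ws := delayed Δ.code st d)
    (fun i => List.mem_map.2 ⟨_, clock_mem_atoms Δ i.1 i.2, rfl⟩) (by
      simp only [delayed, gridSize, keys, List.length_map, List.length_append]
      omega)
  exact this.congr (fun _ => rfl) fun i => by simp [nextVal]

/-! ### The simulation -/

/-- Every step of the program is simulated. -/
theorem Describes.exists_succ (h : Describes Δ fr (fr.state Δ.bat l) st) {r : ℕ}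
    (hr : Repr Δ r p) {a : GroundAct Δ.sig} {p' : Prog Δ.sig 0} {l' : List (GroundAct Δ.sig)}
    (ht : Trans (fr.canon Δ.bat) p l a p' l') :
    ∃ y ∈ succs Δ.code (r, st), Repr Δ y.1 p' ∧ Describes Δ fr (fr.state Δ.bat l') y.2 := by
  obtain ⟨rfl, ⟨b, r'⟩, hq, hab, hr'⟩ := (h.stepsMatch hr).complete ht
  cases hab with
  | act A ρ =>
    exact ⟨(r', _), List.mem_flatMap.2 ⟨_, hq, List.mem_singleton_self _⟩, hr', h.next_act A ρ⟩
  | wait t =>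
    obtain ⟨d, hd, hrel⟩ := h.clock.exists_delay (gridSize_pos _) t.2
    refine ⟨(r', nextStore Δ.code st (0, 0, []) d), List.mem_flatMap.2 ⟨_, hq, ?_⟩, hr',
      h.next_wait hrel⟩
    exact List.mem_map.2 ⟨d, List.mem_range.2 (Nat.lt_succ_of_le hd), rfl⟩

/-- Every successor of a configuration comes from a step of the program. -/
theorem Describes.exists_trans (h : Describes Δ fr (fr.state Δ.bat l) st) {r : ℕ}
    (hr : Repr Δ r p) {y : ℕ × Store} (hy : y ∈ succs Δ.code (r, st)) :
    ∃ (a : GroundAct Δ.sig) (p' : Prog Δ.sig 0), Trans (fr.canon Δ.bat) p l a p' (a :: l) ∧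
      Repr Δ y.1 p' ∧ Describes Δ fr (fr.state Δ.bat (a :: l)) y.2 := by
  obtain ⟨⟨b, r'⟩, hq, hy⟩ := List.mem_flatMap.1 hy
  have hs := h.stepsMatch hr
  obtain ⟨a, hab⟩ := hs.exists_matches _ hq
  dsimp only at hab hy
  cases hab with
  | act A ρ =>
    obtain rfl := List.mem_singleton.1 hy
    obtain ⟨p', h1, h2⟩ := hs.sound _ hq _ (.act A ρ)
    exact ⟨_, p', h1, h2, h.next_act A ρ⟩
  | wait =>
    obtain ⟨d, -, rfl⟩ := List.mem_map.1 hy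
    obtain ⟨t, ht, hrel⟩ := h.clock.exists_delay_of_grid (gridSize_pos _) d
    obtain ⟨p', h1, h2⟩ := hs.sound _ hq _ (.wait ⟨t, ht⟩)
    exact ⟨_, p', h1, h2, h.next_wait (t := ⟨t, ht⟩) hrel⟩

/-- Runs of the program are simulated by paths of configurations. -/
theorem Describes.exists_reach {p' : Prog Δ.sig 0} {α : List (GroundAct Δ.sig)}
    {l l' : (fr.canon Δ.bat).Sit} (ht : TransStar (fr.canon Δ.bat) p l α p' l') :
    ∀ {r : ℕ} {st : Store}, Repr Δ r p → Describes Δ fr (fr.state Δ.bat l) st →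
      ∃ y, Reach succs Δ.code (r, st) y ∧ Repr Δ y.1 p' ∧
        Describes Δ fr (fr.state Δ.bat l') y.2 := by
  induction ht with
  | refl => exact fun hr h => ⟨_, .refl, hr, h⟩
  | step ht _ ih =>
    intro r st hr h
    obtain ⟨y, hy, hr', h'⟩ := h.exists_succ hr ht
    obtain ⟨z, hz, h2⟩ := ih hr' h'
    exact ⟨z, .head hy hz, h2⟩

/-- Paths of configurations come from runs of the program. -/
theorem Describes.exists_transStar {y z : ℕ × Store} (hy : Reach succs Δ.code y z) :
    ∀ {p : Prog Δ.sig 0} {l : List (GroundAct Δ.sig)}, Repr Δ y.1 p →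
      Describes Δ fr (fr.state Δ.bat l) y.2 → ∃ (α : List (GroundAct Δ.sig)) (p' : Prog Δ.sig 0)
        (l' : List (GroundAct Δ.sig)), TransStar (fr.canon Δ.bat) p l α p' l' ∧ Repr Δ z.1 p' ∧
          Describes Δ fr (fr.state Δ.bat l') z.2 := by
  induction hy using Relation.ReflTransGen.head_induction_on with
  | refl => exact fun {p l} hr h => ⟨[], p, l, .refl, hr, h⟩
  | head hy _ ih =>
    intro p l hr h
    obtain ⟨a, p', h1, h2, h3⟩ := h.exists_trans hr hy
    obtain ⟨α, p'', l', h4, h5⟩ := ih h2 h3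
    exact ⟨a :: α, p'', l', .step h1 h4, h5⟩

/-! ### Initial stores -/

/-- In an initial store, the evaluation on codes decides the axioms about the initial
situation. -/
theorem Describes.init_iff (h : Describes Δ fr (fr.state Δ.bat []) st) :
    ((axioms Δ.code 0).all fun c => evalF Δ.code st [] [] c) = true ↔
      ∀ φ ∈ Δ.bat.init, (fr.canon Δ.bat).SatClosed φ [] := by
  rw [List.all_eq_true]
  have hle : ∀ c ∈ axioms Δ.code 0, c ≤ Δ.code := fun c hc =>
    (lt_of_mem_seqOf hc).le.trans ((item_le _ _).trans (item_le _ _))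
  rw [axioms_init] at hle ⊢
  rw [List.forall_mem_map] at hle ⊢
  refine forall₂_congr fun φ hφ => ?_
  exact (h.evalF_iff φ (ActEnv.nil Fin.elim0) Fin.elim0 (hle φ hφ)).trans
    (fr.sat_canon_iff Δ.bat φ Fin.elim0 Fin.elim0 []).symm

theorem exists_frame_of_mem_initStores (hst : st ∈ initStores Δ.code) : ∃ fr : Frame Δ.sig,
    Describes Δ fr (fr.state Δ.bat []) st ∧
      ∀ φ ∈ Δ.bat.init, (fr.canon Δ.bat).SatClosed φ [] := by
  have h1 := (List.mem_filter.1 hst).2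
  simp only [Bool.and_eq_true] at h1
  obtain ⟨⟨h5, h3⟩, h0⟩ := h1
  rw [List.all_eq_true] at h5 h3
  have hlt : ∀ (f : Δ.sig.RigidFun) (o : Fin (Δ.sig.rigidFuns.get f) → Δ.sig.ObjName),
      look st (5, (f : ℕ), vals o) < Δ.sig.numObj := by
    intro f o
    have := not_ble_iff.1 (h5 _ (rigidFun_mem_atoms Δ f o))
    rwa [numObj_code] at this
  let fr : Frame Δ.sig :=
    { rigidFun := fun f o => ⟨_, hlt f o⟩
      rigidRel := fun P o => look st (4, (P : ℕ), vals o) = 1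
      fluent₀ := fun R o => look st (2, (R : ℕ), vals o) = 1 }
  have h : Describes Δ fr (fr.state Δ.bat []) st := by
    refine ⟨fun f o => rfl, fun P o => Iff.rfl, fun R o => Iff.rfl, ?_⟩
    refine (clockRel_zero _ _).congr (fun _ => rfl) fun i => ?_
    exact beq_iff_eq.1 (h3 _ (clock_mem_atoms Δ i.1 i.2))
  exact ⟨fr, h, h.init_iff.1 h0⟩

theorem exists_mem_initStores (h0 : ∀ φ ∈ Δ.bat.init, (fr.canon Δ.bat).SatClosed φ []) :
    ∃ st ∈ initStores Δ.code, Describes Δ fr (fr.state Δ.bat []) st := by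
  classical
  -- the value of an atom according to the frame
  let val : Atom → ℕ → Prop := fun k y =>
    (∀ (f : Δ.sig.RigidFun) o, k = (5, (f : ℕ), vals o) → y = fr.rigidFun f o) ∧
    (∀ (P : Δ.sig.RigidRel) o, k = (4, (P : ℕ), vals o) → (y = 1 ↔ fr.rigidRel P o)) ∧
    (∀ (R : Δ.sig.Fluent) o, k = (2, (R : ℕ), vals o) → (y = 1 ↔ fr.fluent₀ R o)) ∧
    (k.1 = 3 → y = 0)
  have hval : ∀ k, ∃ y, val k y := by
    intro k
    by_cases h5 : ∃ (f : Δ.sig.RigidFun) (o : Fin (Δ.sig.rigidFuns.get f) → Δ.sig.ObjName),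
        k = (5, (f : ℕ), vals o)
    · obtain ⟨f, o, rfl⟩ := h5
      refine ⟨fr.rigidFun f o, fun g o' e => ?_, by simp, by simp, by simp⟩
      simp only [Prod.mk.injEq, true_and] at e
      obtain ⟨e1, e2⟩ := e
      obtain rfl := Fin.ext e1
      rw [vals_injective e2]
    by_cases h4 : ∃ (f : Δ.sig.RigidRel) (o : Fin (Δ.sig.rigidRels.get f) → Δ.sig.ObjName),
        k = (4, (f : ℕ), vals o)
    · obtain ⟨f, o, rfl⟩ := h4
      refine ⟨if fr.rigidRel f o then 1 else 0, by simp, fun g o' e => ?_, by simp, by simp⟩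
      simp only [Prod.mk.injEq, true_and] at e
      obtain ⟨e1, e2⟩ := e
      obtain rfl := Fin.ext e1
      rw [vals_injective e2]
      simp
    by_cases h2 : ∃ (f : Δ.sig.Fluent) (o : Fin (Δ.sig.fluents.get f) → Δ.sig.ObjName),
        k = (2, (f : ℕ), vals o)
    · obtain ⟨f, o, rfl⟩ := h2
      refine ⟨if fr.fluent₀ f o then 1 else 0, by simp, by simp, fun g o' e => ?_, by simp⟩
      simp only [Prod.mk.injEq, true_and] at e
      obtain ⟨e1, e2⟩ := e
      obtain rfl := Fin.ext e1
      rw [vals_injective e2]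
      simp
    exact ⟨0, fun f o e => (h5 ⟨f, o, e⟩).elim, fun f o e => (h4 ⟨f, o, e⟩).elim,
      fun f o e => (h2 ⟨f, o, e⟩).elim, fun _ => rfl⟩
  choose F hF using hval
  have hclock : ∀ k ∈ atoms Δ.code 3, F k = 0 := by
    intro k hk
    obtain ⟨f, o, rfl⟩ := (mem_atoms_iff (arities_clocks Δ) (numObj_code Δ)).1 hk
    exact (hF _).2.2.2 rfl
  have h : Describes Δ fr (fr.state Δ.bat [])
      ((keys Δ.code).map fun k => (k, min (F k) (storeBound Δ.code))) := by
    refine describes_map (fun f o => (hF _).1 f o rfl) (fun P o => (hF _).2.1 P o rfl)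
      (fun R o => (hF _).2.2.1 R o rfl) ?_
    refine (clockRel_zero _ _).congr (fun _ => rfl) fun i => ?_
    exact (hF _).2.2.2 rfl
  refine ⟨_, List.mem_filter.2 ⟨map_mem_stores _ (fun _ => min_le_right _ _) _, ?_⟩, h⟩
  rw [Bool.and_eq_true, Bool.and_eq_true, List.all_eq_true, List.all_eq_true]
  refine ⟨⟨fun k hk => ?_, fun k hk => ?_⟩, h.init_iff.2 h0⟩
  · obtain ⟨f, o, rfl⟩ := (mem_atoms_iff (arities_rigidFuns Δ) (numObj_code Δ)).1 hk
    rw [not_ble_iff, h.rigidFun, numObj_code]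
    exact (fr.rigidFun f o).2
  · have hk' : k ∈ keys Δ.code := by simp [keys, hk]
    rw [look_map _ hk', hclock k hk]
    simp

theorem repr_prog (Δ : ClockedProgram) : Repr Δ (cloR (item Δ.code 2) []) Δ.prog := by
  have h := Repr.clo (Δ := Δ) Δ.prog Fin.elim0 (item_prog Δ ▸ item_le _ _)
  have hclose : Δ.prog.close Fin.elim0 = Δ.prog := by
    rw [Prog.close, Subsingleton.elim (fun i : Fin 0 => Term.const (S := Δ.sig) (i.elim0)) .var]
    exact Δ.prog.subst_var
  rw [hclose] at h
  rw [item_prog]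
  exact h

/-- A program has a realization if and only if the abstract transition system has no initial state
or reaches a final configuration. -/
theorem ClockedProgram.hasRealization_iff_reach (Δ : ClockedProgram) : Δ.HasRealization ↔
    initStores Δ.code = [] ∨ ∃ st ∈ initStores Δ.code, ∃ y,
      Reach succs Δ.code (cloR (item Δ.code 2) [], st) y ∧ finR Δ.code y.2 y.1 = true := by
  rw [Δ.hasRealization_iff]
  refine or_congr ⟨fun h => ?_, fun h fr hfr => ?_⟩ ⟨?_, ?_⟩
  · refine List.eq_nil_iff_forall_not_mem.2 fun st hst => ?_
    obtain ⟨fr, -, hfr⟩ := exists_frame_of_mem_initStores hst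
    exact h fr hfr
  · obtain ⟨st, hst, -⟩ := exists_mem_initStores hfr
    rw [h] at hst
    exact List.not_mem_nil hst
  · rintro ⟨fr, hfr, α, δ', l, ht, hf⟩
    obtain ⟨st, hst, h⟩ := exists_mem_initStores hfr
    obtain ⟨y, hy, hr, h'⟩ := Describes.exists_reach ht (repr_prog Δ) h
    exact ⟨st, hst, y, hy, (h'.finR_iff hr).2 hf⟩
  · rintro ⟨st, hst, y, hy, hf⟩
    obtain ⟨fr, h, hfr⟩ := exists_frame_of_mem_initStores hst
    obtain ⟨α, p', l', ht, hr, h'⟩ := Describes.exists_transStar hy (repr_prog Δ) h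
    exact ⟨fr, hfr, α, p', l', ht, (h'.finR_iff hr).1 hf⟩

end ClockedGolog

theorem mainTheorem2 :
    ∃ alg : ℕ → Bool, Computable alg ∧
      ∀ Δ : ClockedGolog.ClockedProgram, alg Δ.code = true ↔ Δ.HasRealization := by
  obtain ⟨alg, halg, h⟩ := ClockedGolog.exists_computable_decision
  exact ⟨alg, halg, fun Δ => (h Δ.code).trans Δ.hasRealization_iff_reach.symm⟩
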